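/- **Theorem (Extended Lagarias–Odlyzko guarantee).** Throughout, $\log$ is the logarithm to base $2$. *The algorithm ELO.* The input is $(Y,X,\hat R,\hat W)$ with $Y\in\mathbb Z^n$, $X\in\mathbb Z^{n\times p}$ and $n,p,\hat R,\hat W\in\mathbb Z_{>0}$. 1. Draw $Z\in\mathbb Z^p$ with i.i.d. coordinates, uniform on $\{\hat R+1,\hat R+2,\dots,2\hat R+\lfloor\log p\rfloor\}$, independently of $X$. 2. Set $Y_1=Y+XZ$. 3. For $i=1,\dots,n$ set $(Y_2)_i=3$ if $|(Y_1)_i|<3$, and $(Y_2)_i=(Y_1)_i$ otherwise. 4. Set $m=2^{n+\lceil p/2\rceil+3}\,p\,\bigl(\hat R\lceil\sqrt p\rceil+\hat W\lceil\sqrt n\rceil\bigr)$. 5. Let $\hat z\in\mathbb Z^{2n+p}$ be the first vector of the basis produced by the Lenstra–Lenstra–Lovász (LLL) basis reduction algorithm (with parameter $3/4$) from the columns of $$A_m=\begin{pmatrix} mX & -m\,\mathrm{Diag}(Y_2) & m I_{n}\\ I_{p} & 0 & 0\\ 0&0& I_{n}\end{pmatrix}.$$ 6. Compute with Euclid's algorithm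 the greatest common divisor $g$ of $\hat z_{n+1},\dots,\hat z_{n+p}$, taken with the sign of $\hat z_{n+1}+\dots+\hat z_{n+p}$. 7. If $g\ne0$ output $\frac1g(\hat z_{n+1},\dots,\hat z_{n+p})^t-Z$; otherwise output $0$. The running time is the number of bit operations: each operation on integers is charged by the bit lengths of its operands, linearly for addition, subtraction, comparison and copying, and by their product for multiplication, division and a division step of Euclid's algorithm; drawing a coordinate of $Z$ is charged the bit lengths of the end points of its range. *The claim.* There are absolute constants $a,k\in\mathbb N$ with the following two properties. (A) Let $n,p,\hat R,\hat W\in\mathbb Z_{>0}$ and $B\in\mathbb Z_{\ge0}$. On every input $(Y,X,\hat R,\hat W)$ whose entries satisfy $|Y_i|\le2^B$ and $|X_{ij}|\le 2^B$, and for every possible value of $Z$, ELO terminates within time $a\,(n+p+B+\log\hat R+\log\hat W)^k$. (B) For all constants $c,C>0$ and $0<\kappa<1$ there is a constant $K>0$, depending only on $c,C,\kappa$, such that the following holds for all $n,p,N,R,\hat R,\hat W\in\mathbb Z_{>0}$. Suppose * $X\in\mathbb Z^{n\times p}$ has i.i.d. entries with a distribution $\mathcal D$ on $\mathbb Z$ that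 assigns at most $c/2^N$ probability to each element of $\mathbb Z$ and satisfies $\mathbb E|V|\le C2^N$ for $V\sim\mathcal D$; * $\beta^*\in(\mathbb Z\cap[-R,R])^p$ and $W\in\mathbb Z^n$ are fixed, and $Y=X\beta^*+W$; * $\hat R\ge R$, $\hat W\ge\|W\|_\infty$, and $$N\ \ge\ \frac1{2n}(2n+p)\Bigl[2n+p+10\log\Bigl(\hat R\sqrt p+(\|W\|_\infty+1)\sqrt n\Bigr)\Bigr]+6\log\bigl((1+c)np\bigr).$$ Then, with probability at least $1-K\left(\frac1{np}+2^{-\kappa p}\right)$ over $X$ and $Z$, ELO with input $(Y,X,\hat R,\hat W)$ outputs exactly $\beta^*$ and does so within time $a\,(n+p+N+\log\hat R+\log\hat W)^k$. If moreover $n\le2^{\kappa p}$, this probability is at least $1-\frac{K}{np}$. In particular it tends to $1$ as $p\to\infty$, uniformly in the other parameters. -/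

import Mathlib

open MeasureTheory ProbabilityTheory
open scoped Matrix

/-! ## Cost model

Computations on integers with bit costs.  A `Timed α` is a computed value together with the number
of elementary (bit) operations spent on it.  Every arithmetic operation is charged by the bit
lengths of its operands (linear for addition, subtraction and comparison, the schoolbook product
for multiplication and division), every written array entry is charged `1` on top of the
computation of its value, and every pass of a loop is charged at least `1`. -/

/-- A value together with the cost of its computation. -/
structure Timed (α : Type) where
  val : α
  cost : ℕ

namespace Timed

/-- Sequential composition adds the costs. -/
instance : Monad Timed where
  pure a := ⟨a, 0⟩
  bind x f := ⟨(f x.val).val, x.cost + (f x.val).cost⟩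

/-- Spend `t` elementary operations. -/
def charge (t : ℕ) : Timed Unit := ⟨(), t⟩

/-- The bit length of an integer, without the sign. -/
def bits (a : ℤ) : ℕ := a.natAbs.size

def add (a b : ℤ) : Timed ℤ := ⟨a + b, 1 + bits a + bits b⟩

def sub (a b : ℤ) : Timed ℤ := ⟨a - b, 1 + bits a + bits b⟩

def mul (a b : ℤ) : Timed ℤ := ⟨a * b, (1 + bits a) * (1 + bits b)⟩

/-- Integer division (rounding down for a positive divisor, exact when the division is exact). -/
def div (a b : ℤ) : Timed ℤ := ⟨a / b, (1 + bits a) * (1 + bits b)⟩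

/-- The test `a < b`. -/
def lt (a b : ℤ) : Timed Bool := ⟨decide (a < b), 1 + bits a + bits b⟩

/-- The absolute value. -/
def abs (a : ℤ) : Timed ℤ := ⟨|a|, 1 + bits a⟩

/-- Copying an integer. -/
def copy (a : ℤ) : Timed ℤ := ⟨a, 1 + bits a⟩

/-- Compute and write down a vector entry by entry. -/
def vec {d : ℕ} {α : Type} (f : Fin d → Timed α) : Timed (Fin d → α) :=
  ⟨fun i => (f i).val, ∑ i, (1 + (f i).cost)⟩

/-- Sum of `d` computed integers, added up one after the other. -/
def sum : {d : ℕ} → (Fin d → Timed ℤ) → Timed ℤ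
  | 0, _ => pure 0
  | _ + 1, f => do
    let s ← sum fun i => f i.castSucc
    let t ← f (Fin.last _)
    add s t

/-- A loop: `body` either produces a new state or the final result.  The value is `none` when the
loop has not ended after `fuel` passes. -/
def loop {σ α : Type} (body : σ → Timed (σ ⊕ α)) : ℕ → σ → Timed (Option α)
  | 0, _ => pure none
  | fuel + 1, s => do
    charge 1
    match ← body s with
    | .inl s' => loop body fuel s'
    | .inr a => pure (some a)

/-- Euclid's algorithm. -/
def euclid (a b : ℕ) : Timed ℕ :=
  if _h : b = 0 then do
    charge 1
    pure a
  else do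
    charge ((1 + a.size) * (1 + b.size))
    euclid b (a % b)
termination_by b
decreasing_by exact Nat.mod_lt _ (Nat.pos_of_ne_zero _h)

/-- The (nonnegative) greatest common divisor of the entries of an integer vector. -/
def gcdVec : {d : ℕ} → (Fin d → ℤ) → Timed ℕ
  | 0, _ => pure 0
  | _ + 1, x => do
    let g ← gcdVec fun i => x i.castSucc
    euclid g (x (Fin.last _)).natAbs

/-- `2 ^ e`, by repeated doubling. -/
def twoPow : ℕ → Timed ℤ
  | 0 => pure 1
  | e + 1 => do
    let t ← twoPow e
    mul 2 t

/-- The least `i ≥ j` with `k ≤ i ^ 2`, by linear search (at most `fuel` increments). -/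
def sqrtSearch (k : ℤ) : ℕ → ℤ → Timed ℤ
  | 0, j => pure j
  | fuel + 1, j => do
    let s ← mul j j
    if ← lt s k then do
      let j' ← add j 1
      sqrtSearch k fuel j'
    else pure j

/-- `⌈√k⌉`. -/
def ceilSqrt (k : ℕ) : Timed ℤ := sqrtSearch k k 0

/-- `⌊log₂ k⌋`, read off from the bit length of `k`. -/
def floorLog (k : ℕ) : Timed ℤ := ⟨(Nat.log 2 k : ℤ), 1 + k.size⟩

end Timed

/-! ## The LLL basis reduction algorithm

The basis consists of the rows `b 0, …, b (d - 1)` of an integer array.  All arithmetic is on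
integers.  Write `b*_i` for the Gram-Schmidt vectors, `μ_{i,j}` for the Gram-Schmidt coefficients,
`D_l = ∏_{i < l} ‖b*_i‖²`, and `π_l` for the orthogonal projection along `b 0, …, b (l - 1)`. -/

namespace LLL

open Timed

/-- The Gram matrix of the basis. -/
def gram {d e : ℕ} (b : Fin d → Fin e → ℤ) : Timed (Fin d → Fin d → ℤ) :=
  vec fun i => vec fun j => Timed.sum fun c => mul (b i c) (b j c)

/-- Fraction-free Gauss elimination of the Gram matrix, `l` pivots.  The result is `(M, D_l)` with
`M i j = D_l * ⟪π_l (b i), π_l (b j)⟫`; in particular `M l l = D_{l+1}` and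
`M i l = D_{l+1} * μ_{i,l}`.  All divisions are exact. -/
def stage {d e : ℕ} (b : Fin d → Fin e → ℤ) : ℕ → Timed ((Fin d → Fin d → ℤ) × ℤ)
  | 0 => do
    let G ← gram b
    pure (G, 1)
  | l + 1 => do
    let (M, prev) ← stage b l
    if h : l < d then
      let l : Fin d := ⟨l, h⟩
      let M' ← vec fun i => vec fun j => do
        let s ← mul (M l l) (M i j)
        let t ← mul (M i l) (M l j)
        let u ← sub s t
        div u prev
      pure (M', M l l)
    else pure (M, prev)

/-- Size reduction of `b k` against `b (l - 1), …, b 0`, in this order: the multiple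
`⌊μ_{k,j} + 1/2⌋` of `b j` is subtracted from `b k`. -/
def sizeReduce {d e : ℕ} (k : Fin d) : ℕ → (Fin d → Fin e → ℤ) → Timed (Fin d → Fin e → ℤ)
  | 0, b => pure b
  | l + 1, b =>
    if h : l < d then do
      let j : Fin d := ⟨l, h⟩
      let (M, _) ← stage b l
      let s ← mul 2 (M k j)
      let num ← add s (M j j)
      let den ← mul 2 (M j j)
      let q ← div num den
      let row ← vec fun c => do
        let t ← mul q (b j c)
        sub (b k c) t
      sizeReduce k l (Function.update b k row)
    else pure b

/-- One pass of the main loop, with state `(b, k)`.  The vector `b k` is size reduced and the Lovász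
condition `‖b*_k‖² ≥ (3/4 - μ_{k,k-1}²) ‖b*_{k-1}‖²`, that is
`3 ‖π_{k-1} (b (k-1))‖² ≤ 4 ‖π_{k-1} (b k)‖²`, is tested.  If it holds, `k` is
increased; otherwise `b (k-1)` and `b k` are exchanged and `k` is decreased.  The loop ends when
`k = d`. -/
def body {d e : ℕ} (s : (Fin d → Fin e → ℤ) × ℕ) :
    Timed (((Fin d → Fin e → ℤ) × ℕ) ⊕ (Fin d → Fin e → ℤ)) :=
  if h : s.2 < d then
    if s.2 = 0 then pure (.inl (s.1, 1))
    else do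
      let k : Fin d := ⟨s.2, h⟩
      let k' : Fin d := ⟨s.2 - 1, lt_of_le_of_lt (Nat.sub_le _ _) h⟩
      let b ← sizeReduce k s.2 s.1
      let (M, _) ← stage b (s.2 - 1)
      let u ← mul 3 (M k' k')
      let v ← mul 4 (M k k)
      if ← lt v u then
        pure (.inl (Function.update (Function.update b k' (b k)) k (b k'), s.2 - 1))
      else pure (.inl (b, s.2 + 1))
  else pure (.inr s.1)

/-- The LLL algorithm; the value is `none` if it has not ended after `fuel` passes. -/
def lll {d e : ℕ} (fuel : ℕ) (b : Fin d → Fin e → ℤ) : Timed (Option (Fin d → Fin e → ℤ)) :=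
  loop body fuel (b, 1)

end LLL

/-! ## The extended Lagarias-Odlyzko algorithm -/

namespace ELO

open Timed

/-- Position of an index in a range that is divided into three consecutive blocks. -/
def block {a b c : ℕ} (i : Fin (a + (b + c))) : Fin a ⊕ Fin b ⊕ Fin c :=
  (finSumFinEquiv.symm i).map id finSumFinEquiv.symm

/-- The entries of the block matrix
`[ m X , -m Diag(Y₂) , m I ; I , 0 , 0 ; 0 , 0 , I ]`. -/
def entry {n p : ℕ} (m : ℤ) (X : Matrix (Fin n) (Fin p) ℤ) (Y₂ : Fin n → ℤ) :
    Fin n ⊕ Fin p ⊕ Fin n → Fin p ⊕ Fin n ⊕ Fin n → Timed ℤ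
  | .inl i, .inl j => mul m (X i j)
  | .inl i, .inr (.inl j) => if i = j then do
      let t ← mul m (Y₂ i)
      sub 0 t
    else pure 0
  | .inl i, .inr (.inr j) => copy (if i = j then m else 0)
  | .inr (.inl i), .inl j => pure (if i = j then 1 else 0)
  | .inr (.inl _), .inr _ => pure 0
  | .inr (.inr _), .inl _ => pure 0
  | .inr (.inr _), .inr (.inl _) => pure 0
  | .inr (.inr i), .inr (.inr j) => pure (if i = j then 1 else 0)

/-- The columns of that matrix: `basis c` is the `c`-th column. -/
def basis {n p : ℕ} (m : ℤ) (X : Matrix (Fin n) (Fin p) ℤ) (Y₂ : Fin n → ℤ) :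
    Timed (Fin (p + (n + n)) → Fin (n + (p + n)) → ℤ) :=
  vec fun c => vec fun r => entry m X Y₂ (block r) (block c)

/-- `m = 2 ^ (n + ⌈p/2⌉ + 3) * p * (R̂ ⌈√p⌉ + Ŵ ⌈√n⌉)`. -/
def scale (n p Rhat What : ℕ) : Timed ℤ := do
  let a ← ceilSqrt p
  let b ← ceilSqrt n
  let s ← mul Rhat a
  let t ← mul What b
  let u ← add s t
  let w ← twoPow (n + (p + 1) / 2 + 3)
  let v ← mul w p
  mul v u

/-- The end points `R̂ + 1` and `2 R̂ + ⌊log₂ p⌋` of the range of the random shift. -/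
def shiftRange (p Rhat : ℕ) : Timed (ℤ × ℤ) := do
  let lo ← add Rhat 1
  let r ← mul 2 Rhat
  let l ← floorLog p
  let hi ← add r l
  pure (lo, hi)

/-- Drawing an integer between `lo` and `hi` is charged the bit length of the range; `z` is the
integer drawn. -/
def draw (lo hi z : ℤ) : Timed ℤ := do
  charge (1 + bits lo + bits hi)
  pure z

/-- The algorithm with input `(Y, X, R̂, Ŵ)`, when the random shift drawn in the first step is `Z`.
The value is `none` if the LLL loop has not ended after `fuel` passes.  The greatest common divisor
`g` is taken with the sign of the sum of the entries whose common divisor it is. -/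
def run {n p : ℕ} (fuel : ℕ) (Y : Fin n → ℤ) (X : Matrix (Fin n) (Fin p) ℤ) (Rhat What : ℕ)
    (Z : Fin p → ℤ) : Timed (Option (Fin p → ℤ)) := do
  let (lo, hi) ← shiftRange p Rhat
  let Z ← vec fun j => draw lo hi (Z j)
  let Y₁ ← vec fun i => do
    let s ← Timed.sum fun j => mul (X i j) (Z j)
    add (Y i) s
  let Y₂ ← vec fun i => do
    let a ← Timed.abs (Y₁ i)
    if ← lt a 3 then copy 3 else copy (Y₁ i)
  let m ← scale n p Rhat What
  let A ← basis m X Y₂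
  match ← LLL.lll fuel A with
  | none => pure none
  | some b => do
    -- the coordinates `n + 1, …, n + p` of the first vector of the reduced basis
    let x ← vec fun j : Fin p => copy
      (if h : 0 < p + (n + n) then b ⟨0, h⟩ (Fin.natAdd n (Fin.castAdd n j)) else 0)
    let g₀ ← gcdVec x
    let s ← Timed.sum fun j => pure (x j)
    let g ← if ← lt s 0 then sub 0 g₀ else pure (g₀ : ℤ)
    if g = 0 then pure (some 0)
    else do
      let out ← vec fun j => do
        let q ← div (x j) g
        sub q (Z j)
      pure (some out)

/-- On input `(Y, X, R̂, Ŵ)` and with random shift `Z` the algorithm terminates, its output is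
`out`, and it spends exactly `t` elementary operations. -/
def Returns {n p : ℕ} (Y : Fin n → ℤ) (X : Matrix (Fin n) (Fin p) ℤ) (Rhat What : ℕ)
    (Z : Fin p → ℤ) (out : Fin p → ℤ) (t : ℕ) : Prop :=
  ∃ fuel : ℕ, run fuel Y X Rhat What Z = ⟨some out, t⟩

/-- The algorithm outputs `out` and spends at most `T` elementary operations. -/
def ReturnsWithin {n p : ℕ} (Y : Fin n → ℤ) (X : Matrix (Fin n) (Fin p) ℤ) (Rhat What : ℕ)
    (Z : Fin p → ℤ) (out : Fin p → ℤ) (T : ℝ) : Prop :=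
  ∃ t : ℕ, Returns Y X Rhat What Z out t ∧ (t : ℝ) ≤ T

/-- The integers `R̂ + 1, …, 2 R̂ + ⌊log₂ p⌋`. -/
def shiftSet (p Rhat : ℕ) : Set ℤ :=
  Set.Icc ((Rhat : ℤ) + 1) (2 * (Rhat : ℤ) + (Nat.log 2 p : ℤ))

end ELO

/-!
The cost of every elementary operation of the algorithm is tracked next to its value, and the two
parts of the theorem need different facts about one and the same run.

*Running time.* Let `vol k` be the Gram determinant of the first `k` basis vectors.  These
determinants are positive integers, each of them is bounded in terms of the input, and an exchange
step of LLL multiplies one of them by at most `3 / 4`, while size reduction changes none.  Hence the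
number of exchange steps is polynomial in the bit length of the input (`LLL.loop_spec`).  The
fraction-free elimination by which the algorithm finds the Gram–Schmidt coefficients produces
integers that are controlled by the same determinants (`LLL.stage_val`), and size reduction keeps
the entries of the basis of polynomial bit length.  `ELO.run_spec` combines this with the cost of
the remaining steps; it also records that the final basis spans the same lattice and that its
Gram–Schmidt lengths do not drop too fast.

*Recovery.* Put `β' = β + Z`. When all `|Y₁ i| ≥ 3`, the lattice spanned by the columns contains the
vector with blocks `0`, `β'` and `W`, whose length is at most `(3 + ⌊log₂ p⌋) Q` with
`Q = R̂ √p + (‖W‖ + 1) √n`. The first LLL vector is therefore shorter than the integer `m`, so its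
first block, which consists of multiples of `m`, vanishes, and its other blocks `x` and `w` have
entries of absolute value at most some `M`; there are integers `e i` with
`∑ j, X i j * x j = e i * Y₁ i - w i`, that is, with
`∑ j, X i j * (x j - e i * β' j) = e i * W i - w i`. As `|Y₁ i|` is large, the `e i` are bounded by
some `E`. For a fixed `x`, a row with `x ≠ e i • β'` satisfies its equation with probability at most
`(2 E + 1) (2 M + 1) c / 2 ^ N` for some choice of `e i` and `w i`, because a nontrivial linear form
in independent variables has no heavier atoms than the variables; the rows are independent, and the
lower bound for `N` pays for a union bound over all `x`. So outside a small event some row has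
`x = e i • β'`, and the other rows then have the same multiplier `e i`, since their responses are
large. The vector is not zero, `β'` has positive entries, and with high probability these are
coprime; then the signed greatest common divisor of the entries of `x` is `e i`, and the algorithm
returns `β' - Z = β` (`ELO.output_eq`).

Coprimality fails with probability at most `(1 / 2 + o(1)) ^ p`, by a union bound over the possible
divisors (`ELO.shift_gcd_real_le`).  As `1 / 2 + ε < 2 ^ (-κ)` for small `ε`, this is
`O (2 ^ (-κ p) / p)`, and the extra factor `1 / p` gives the bound `K / (n p)` when `n ≤ 2 ^ (κ p)`
(`ELO.exists_gcd_bound`).  The other exceptional events together have probability at most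
`5 / (n p)`, by the choice of `M`, `E` and the two thresholds in `ELO.exists_parameters`.
-/

/-! ### Bit lengths and the cost of elementary operations -/

namespace Timed

variable {α β : Type}

@[simp] theorem pure_val (a : α) : (pure a : Timed α).val = a := rfl
@[simp] theorem pure_cost (a : α) : (pure a : Timed α).cost = 0 := rfl
@[simp] theorem bind_val (x : Timed α) (f : α → Timed β) : (x >>= f).val = (f x.val).val := rfl
@[simp] theorem bind_cost (x : Timed α) (f : α → Timed β) :
    (x >>= f).cost = x.cost + (f x.val).cost := rfl

theorem bits_le {a : ℤ} {s : ℕ} (h : |a| ≤ 2 ^ s) : bits a ≤ s + 1 := by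
  unfold bits
  rw [Nat.size_le]
  have h1 : (a.natAbs : ℤ) ≤ 2 ^ s := by rwa [← Int.abs_eq_natAbs]
  have h2 : a.natAbs ≤ 2 ^ s := by exact_mod_cast h1
  exact lt_of_le_of_lt h2 (Nat.pow_lt_pow_right (by norm_num) (by omega))

theorem vec_val {d : ℕ} (f : Fin d → Timed α) : (vec f).val = fun i => (f i).val := rfl

/-- Writing a vector whose entries cost at most `c` each. -/
theorem vec_cost_le {d c : ℕ} (f : Fin d → Timed α) (h : ∀ i, (f i).cost ≤ c) :
    (vec f).cost ≤ d * (1 + c) := by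
  have : ∑ i, (1 + (f i).cost) ≤ ∑ _i : Fin d, (1 + c) :=
    Finset.sum_le_sum fun i _ => Nat.add_le_add_left (h i) 1
  simpa [vec] using this

theorem sum_val : ∀ {d : ℕ} (f : Fin d → Timed ℤ), (Timed.sum f).val = ∑ i, (f i).val
  | 0, _ => by simp [Timed.sum]
  | d + 1, f => by
    simp [Timed.sum, add, Fin.sum_univ_castSucc, sum_val fun i : Fin d => f i.castSucc]

/-- Adding up `d` integers of absolute value at most `2 ^ s` that cost at most `c` each. -/
theorem sum_cost_le {s c : ℕ} : ∀ {d : ℕ} (f : Fin d → Timed ℤ), (∀ i, (f i).cost ≤ c) →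
    (∀ i, |(f i).val| ≤ 2 ^ s) → (Timed.sum f).cost ≤ d * (c + 2 * s + d + 3)
  | 0, _, _, _ => by simp [Timed.sum]
  | d + 1, f, hc, hs => by
    have ih := sum_cost_le (fun i : Fin d => f i.castSucc) (fun i => hc _) (fun i => hs _)
    have h1 : |∑ i : Fin d, (f i.castSucc).val| ≤ 2 ^ (s + d) := by
      calc |∑ i : Fin d, (f i.castSucc).val| ≤ ∑ i : Fin d, |(f i.castSucc).val| :=
            Finset.abs_sum_le_sum_abs _ _
        _ ≤ ∑ _i : Fin d, (2 : ℤ) ^ s := Finset.sum_le_sum fun i _ => hs _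
        _ = d * 2 ^ s := by simp
        _ ≤ 2 ^ d * 2 ^ s := by
          gcongr
          exact_mod_cast Nat.lt_two_pow_self.le
        _ = 2 ^ (s + d) := by rw [pow_add, mul_comm]
    have h2 := bits_le h1
    have h3 := bits_le (hs (Fin.last d))
    have h4 := hc (Fin.last d)
    simp only [Timed.sum, bind_cost, add, sum_val]
    nlinarith [Nat.zero_le d]

theorem mul_cost_le {a b : ℤ} {s t : ℕ} (ha : |a| ≤ 2 ^ s) (hb : |b| ≤ 2 ^ t) :
    (mul a b).cost ≤ (s + 2) * (t + 2) := by
  have := bits_le ha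
  have := bits_le hb
  exact Nat.mul_le_mul (by omega) (by omega)

theorem div_cost_le {a b : ℤ} {s t : ℕ} (ha : |a| ≤ 2 ^ s) (hb : |b| ≤ 2 ^ t) :
    (div a b).cost ≤ (s + 2) * (t + 2) := mul_cost_le ha hb

theorem add_cost_le {a b : ℤ} {s t : ℕ} (ha : |a| ≤ 2 ^ s) (hb : |b| ≤ 2 ^ t) :
    (add a b).cost ≤ s + t + 3 := by
  have := bits_le ha
  have := bits_le hb
  simp only [add]
  omega

theorem sub_cost_le {a b : ℤ} {s t : ℕ} (ha : |a| ≤ 2 ^ s) (hb : |b| ≤ 2 ^ t) :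
    (sub a b).cost ≤ s + t + 3 := add_cost_le ha hb

theorem lt_cost_le {a b : ℤ} {s t : ℕ} (ha : |a| ≤ 2 ^ s) (hb : |b| ≤ 2 ^ t) :
    (lt a b).cost ≤ s + t + 3 := add_cost_le ha hb

end Timed

/-! ### Gram-Schmidt orthogonalization of a list of vectors -/

namespace GS

open Submodule

variable {E : Type*} [NormedAddCommGroup E] [InnerProductSpace ℝ E] {d : ℕ}

/-- The span of the first `l` vectors of a list. -/
def initSpan (v : Fin d → E) (l : ℕ) : Submodule ℝ E := span ℝ (v '' {i | i.val < l})

theorem mem_initSpan (v : Fin d → E) {l : ℕ} {i : Fin d} (h : i.val < l) : v i ∈ initSpan v l :=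
  subset_span ⟨i, h, rfl⟩

theorem initSpan_zero (v : Fin d → E) : initSpan v 0 = ⊥ := by simp [initSpan]

theorem initSpan_succ (v : Fin d → E) (k : Fin d) :
    initSpan v (k.val + 1) = initSpan v k ⊔ span ℝ {v k} := by
  rw [initSpan, initSpan, ← span_union]
  congr 1
  ext x
  simp only [Set.mem_image, Set.mem_ofPred_eq, Set.union_singleton, Set.mem_insert_iff]
  constructor
  · rintro ⟨i, hi, rfl⟩
    rcases Nat.lt_succ_iff_lt_or_eq.1 hi with h | h
    · exact Or.inr ⟨i, h, rfl⟩
    · exact Or.inl (congrArg v (Fin.ext h))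
  · rintro (rfl | ⟨i, hi, rfl⟩)
    · exact ⟨k, by omega, rfl⟩
    · exact ⟨i, by omega, rfl⟩

theorem initSpan_mono (v : Fin d → E) {l l' : ℕ} (h : l ≤ l') : initSpan v l ≤ initSpan v l' :=
  span_mono (Set.image_mono fun _ hi => lt_of_lt_of_le hi h)

theorem initSpan_le {v w : Fin d → E} {l : ℕ} (h : ∀ i : Fin d, i.val < l → v i ∈ initSpan w l) :
    initSpan v l ≤ initSpan w l := by
  rw [initSpan, span_le]
  rintro _ ⟨i, hi, rfl⟩
  exact h i hi

theorem initSpan_congr {v w : Fin d → E} {l : ℕ} (h : ∀ i : Fin d, i.val < l → v i = w i) :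
    initSpan v l = initSpan w l :=
  le_antisymm (initSpan_le fun i hi => h i hi ▸ mem_initSpan w hi)
    (initSpan_le fun i hi => h i hi ▸ mem_initSpan v hi)

theorem inner_eq_zero_of_mem (v : Fin d → E) {l : ℕ} {x y : E} (hx : x ∈ initSpan v l)
    (hy : y ∈ (initSpan v l)ᗮ) : inner ℝ x y = 0 := hy x hx

theorem initSpan_update (v : Fin d → E) {k : Fin d} {x : E} (hx : x - v k ∈ initSpan v k) (l : ℕ) :
    initSpan (Function.update v k x) l = initSpan v l := by
  have key : ∀ l ≤ k.val, initSpan (Function.update v k x) l = initSpan v l := fun l hl =>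
    initSpan_congr fun i hi => Function.update_of_ne (fun h => by subst h; omega) _ _
  rcases Nat.lt_or_ge k.val l with hl | hl
  · have h1 : x ∈ initSpan v l := by
      have := add_mem (initSpan_mono v hl.le hx) (mem_initSpan v hl)
      rwa [sub_add_cancel] at this
    refine le_antisymm (initSpan_le fun i hi => ?_) (initSpan_le fun i hi => ?_)
    · by_cases hik : i = k
      · subst hik
        rwa [Function.update_self]
      · rw [Function.update_of_ne hik]
        exact mem_initSpan v hi
    · by_cases hik : i = k
      · subst hik
        have h2 : x - v i ∈ initSpan (Function.update v i x) l :=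
          initSpan_mono _ hl.le (by rwa [key i le_rfl])
        have h3 : x ∈ initSpan (Function.update v i x) l := by
          have := mem_initSpan (Function.update v i x) hi
          rwa [Function.update_self] at this
        have := sub_mem h3 h2
        rwa [sub_sub_cancel] at this
      · have := mem_initSpan (Function.update v k x) hi
        rwa [Function.update_of_ne hik] at this
  · exact key l hl

/-- The list `v` with `v k'` and `v k` exchanged. -/
def swap {α : Type*} (v : Fin d → α) (k k' : Fin d) : Fin d → α :=
  Function.update (Function.update v k' (v k)) k (v k')

section swap

variable {α : Type*} (v : Fin d → α) {k k' : Fin d}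

theorem swap_left (hk : k'.val + 1 = k.val) : swap v k k' k' = v k := by
  have : k' ≠ k := fun h => by subst h; omega
  simp [swap, Function.update_of_ne this]

theorem swap_right : swap v k k' k = v k' := by
  simp [swap]

theorem swap_of_ne {i : Fin d} (h : i ≠ k) (h' : i ≠ k') : swap v k k' i = v i := by
  simp [swap, Function.update_of_ne, h, h']

theorem swap_swap (hk : k'.val + 1 = k.val) : swap (swap v k k') k k' = v := by
  funext i
  by_cases h : i = k
  · subst h
    rw [swap_right, swap_left v hk]
  by_cases h' : i = k'
  · subst h'
    rw [swap_left _ hk, swap_right]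
  rw [swap_of_ne _ h h', swap_of_ne _ h h']

end swap

theorem initSpan_swap (v : Fin d → E) {k k' : Fin d} (hk : k'.val + 1 = k.val) {l : ℕ}
    (hl : l ≠ k) : initSpan (swap v k k') l = initSpan v l := by
  have key : ∀ w : Fin d → E, initSpan (swap w k k') l ≤ initSpan w l := by
    intro w
    refine initSpan_le fun i hi => ?_
    by_cases h : i = k
    · subst h
      rw [swap_right]
      exact mem_initSpan w (by omega)
    by_cases h' : i = k'
    · subst h'
      rw [swap_left w hk]
      exact mem_initSpan w (by omega)
    rw [swap_of_ne w h h']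
    exact mem_initSpan w hi
  refine le_antisymm (key v) ?_
  conv_lhs => rw [← swap_swap v hk]
  exact key _

variable [FiniteDimensional ℝ E]

/-- The orthogonal projection along the first `l` vectors of a list. -/
noncomputable def proj (v : Fin d → E) (l : ℕ) : E →L[ℝ] E := (initSpan v l)ᗮ.starProjection

/-- The squared length of the `i`-th Gram-Schmidt vector, and `1` beyond the end of the list. -/
noncomputable def gsq (v : Fin d → E) (i : ℕ) : ℝ :=
  if h : i < d then ‖proj v i (v ⟨i, h⟩)‖ ^ 2 else 1

/-- The squared volume spanned by the first `l` vectors of a list. -/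
noncomputable def vol (v : Fin d → E) (l : ℕ) : ℝ := ∏ i ∈ Finset.range l, gsq v i

theorem gsq_coe (v : Fin d → E) (k : Fin d) : gsq v k = ‖proj v k (v k)‖ ^ 2 := by
  simp [gsq]

theorem gsq_nonneg (v : Fin d → E) (i : ℕ) : 0 ≤ gsq v i := by
  unfold gsq
  split_ifs <;> positivity

theorem vol_succ (v : Fin d → E) (l : ℕ) : vol v (l + 1) = vol v l * gsq v l :=
  Finset.prod_range_succ _ _

theorem vol_zero (v : Fin d → E) : vol v 0 = 1 := Finset.prod_range_zero _

theorem vol_congr {v w : Fin d → E} {l : ℕ} (h : ∀ i < l, gsq v i = gsq w i) :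
    vol v l = vol w l :=
  Finset.prod_congr rfl fun i hi => h i (Finset.mem_range.1 hi)

theorem proj_mem (v : Fin d → E) (l : ℕ) (x : E) : proj v l x ∈ (initSpan v l)ᗮ :=
  starProjection_apply_mem _ _

theorem sub_proj_mem (v : Fin d → E) (l : ℕ) (x : E) : x - proj v l x ∈ initSpan v l := by
  have := sub_starProjection_mem_orthogonal (K := (initSpan v l)ᗮ) x
  rwa [orthogonal_orthogonal] at this

theorem proj_eq (v : Fin d → E) {l : ℕ} {x y : E} (hy : y ∈ (initSpan v l)ᗮ)
    (hxy : x - y ∈ initSpan v l) : proj v l x = y := by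
  refine eq_starProjection_of_mem_orthogonal hy ?_
  rwa [orthogonal_orthogonal]

theorem proj_eq_zero (v : Fin d → E) {l : ℕ} {x : E} (hx : x ∈ initSpan v l) : proj v l x = 0 :=
  proj_eq v (zero_mem _) (by simpa using hx)

theorem proj_zero (v : Fin d → E) (x : E) : proj v 0 x = x :=
  proj_eq v (by simp [initSpan_zero]) (by simp)

theorem inner_proj (v : Fin d → E) (l : ℕ) (x y : E) :
    inner ℝ (proj v l x) (proj v l y) = inner ℝ x (proj v l y) := by
  have := inner_eq_zero_of_mem v (sub_proj_mem v l x) (proj_mem v l y)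
  rw [inner_sub_left] at this
  linarith

theorem norm_proj_le (v : Fin d → E) (l : ℕ) (x : E) : ‖proj v l x‖ ≤ ‖x‖ :=
  norm_starProjection_apply_le _ _

theorem proj_succ (v : Fin d → E) (k : Fin d) (x : E) :
    proj v (k.val + 1) x = proj v k x
      - (inner ℝ (proj v k (v k)) (proj v k x) / ‖proj v k (v k)‖ ^ 2) • proj v k (v k) := by
  set u := proj v k (v k) with hu
  have hmem : u ∈ initSpan v (k.val + 1) := by
    have h1 := initSpan_mono v (Nat.le_succ k.val) (sub_proj_mem v k (v k))
    have h2 := mem_initSpan v (Nat.lt_succ_self k.val)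
    have := sub_mem h2 h1
    rwa [sub_sub_cancel] at this
  refine proj_eq v ?_ ?_
  · rw [mem_orthogonal, initSpan_succ]
    intro y hy
    rw [mem_sup] at hy
    obtain ⟨y, hy, z, hz, rfl⟩ := hy
    obtain ⟨t, rfl⟩ := mem_span_singleton.1 hz
    have h1 := inner_eq_zero_of_mem v hy (proj_mem v k x)
    have h2 := inner_eq_zero_of_mem v hy (proj_mem v k (v k))
    have h3 := inner_proj v k (v k) (v k)
    have h4 := inner_proj v k (v k) x
    rw [← hu, real_inner_self_eq_norm_sq] at h3
    rw [← hu] at h2 h4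
    simp only [inner_add_left, inner_sub_right, inner_smul_right, real_inner_smul_left, h1, h2,
      ← h3, ← h4]
    by_cases h0 : ‖u‖ ^ 2 = 0
    · have : u = 0 := by simpa using h0
      simp [this]
    · rw [zero_add, zero_add, div_mul_eq_mul_div, mul_div_assoc, mul_div_cancel_right₀ _ h0]
      ring
  · rw [← sub_add]
    exact add_mem (initSpan_mono v (Nat.le_succ k.val) (sub_proj_mem v k x)) (smul_mem _ _ hmem)

theorem inner_proj_succ (v : Fin d → E) (k : Fin d) (x y : E) :
    inner ℝ (proj v (k.val + 1) x) (proj v (k.val + 1) y) = inner ℝ (proj v k x) (proj v k y)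
      - inner ℝ (proj v k x) (proj v k (v k)) * inner ℝ (proj v k (v k)) (proj v k y)
        / gsq v k := by
  rw [proj_succ, proj_succ, gsq_coe]
  set u := proj v k (v k)
  by_cases h0 : ‖u‖ ^ 2 = 0
  · have : u = 0 := by simpa using h0
    simp [this]
  · simp only [inner_sub_left, inner_sub_right, inner_smul_right, real_inner_smul_left,
      real_inner_self_eq_norm_sq, real_inner_comm u]
    generalize inner ℝ (proj v k x) u = a
    generalize inner ℝ (proj v k y) u = b
    generalize inner ℝ (proj v k x) (proj v k y) = c
    generalize ‖u‖ ^ 2 = t at *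
    field_simp
    ring

theorem norm_sq_proj_succ (v : Fin d → E) (k : Fin d) (x : E) :
    ‖proj v k x‖ ^ 2 = ‖proj v (k.val + 1) x‖ ^ 2
      + (inner ℝ (proj v k (v k)) (proj v k x)) ^ 2 / gsq v k := by
  have := inner_proj_succ v k x x
  rw [real_inner_self_eq_norm_sq, real_inner_self_eq_norm_sq,
    real_inner_comm (proj v k (v k)) (proj v k x)] at this
  rw [this]
  ring

theorem norm_sq_proj_succ_le (v : Fin d → E) (k : Fin d) (x : E) :
    ‖proj v (k.val + 1) x‖ ^ 2 ≤ ‖proj v k x‖ ^ 2 := by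
  rw [norm_sq_proj_succ v k x]
  have := gsq_nonneg v k
  have : 0 ≤ (inner ℝ (proj v k (v k)) (proj v k x)) ^ 2 / gsq v k := by positivity
  linarith

/-- If the `x`-components along the first `l` Gram-Schmidt vectors have coefficients of absolute
value at most `1 / 2`, then `x` is not much longer than its projection. -/
theorem norm_sq_le_of_reduced (v : Fin d → E) {x : E} {m : ℝ} : ∀ {l : ℕ}, l ≤ d →
    (∀ i < l, 0 < gsq v i) → (∀ i < l, gsq v i ≤ m) →
    (∀ i : Fin d, i.val < l → |inner ℝ (proj v i (v i)) (proj v i x)| ≤ gsq v i / 2) →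
    ‖x‖ ^ 2 ≤ ‖proj v l x‖ ^ 2 + l * (m / 4)
  | 0, _, _, _, _ => by simp [proj_zero]
  | l + 1, hl, h0, hm, hx => by
    have ih := norm_sq_le_of_reduced v (x := x) (m := m) (l := l) (by omega)
      (fun i hi => h0 i (by omega)) (fun i hi => hm i (by omega)) (fun i hi => hx i (by omega))
    have h1 := norm_sq_proj_succ v ⟨l, hl⟩ x
    have h2 := hx ⟨l, hl⟩ (by simp)
    have h3 := h0 l (by omega)
    have h4 := hm l (by omega)
    simp only at h1 h2
    have h5 : (inner ℝ (proj v l (v ⟨l, hl⟩)) (proj v l x)) ^ 2 / gsq v l ≤ m / 4 := by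
      rw [div_le_iff₀ h3, ← sq_abs]
      have := abs_nonneg (inner ℝ (proj v l (v ⟨l, hl⟩)) (proj v l x))
      nlinarith
    push_cast
    linarith

theorem gsq_le_norm_sq (v : Fin d → E) (k : Fin d) : gsq v k ≤ ‖v k‖ ^ 2 := by
  rw [gsq_coe]
  have := norm_proj_le v k (v k)
  gcongr

theorem gsq_pos_of_linearIndependent {v : Fin d → E} (h : LinearIndependent ℝ v) (i : ℕ) :
    0 < gsq v i := by
  unfold gsq
  split_ifs with hi
  · have : proj v i (v ⟨i, hi⟩) ≠ 0 := by
      intro h0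
      have h1 := sub_proj_mem v i (v ⟨i, hi⟩)
      rw [h0, sub_zero] at h1
      exact h.notMem_span_image (s := {j | j.val < i}) (x := ⟨i, hi⟩) (by simp) h1
    positivity
  · exact one_pos

theorem proj_congr {v w : Fin d → E} {l : ℕ} (h : initSpan v l = initSpan w l) :
    proj v l = proj w l := by
  unfold proj
  congr

/-! Adding to `v k` a combination of earlier vectors changes nothing. -/

theorem proj_update (v : Fin d → E) {k : Fin d} {x : E} (hx : x - v k ∈ initSpan v k) (l : ℕ) :
    proj (Function.update v k x) l = proj v l :=
  proj_congr (initSpan_update v hx l)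

theorem proj_apply_eq (v : Fin d → E) {l : ℕ} {x y : E} (h : x - y ∈ initSpan v l) :
    proj v l x = proj v l y := by
  rw [← sub_eq_zero, ← map_sub]
  exact proj_eq_zero v h

theorem gsq_update (v : Fin d → E) {k : Fin d} {x : E} (hx : x - v k ∈ initSpan v k) (i : ℕ) :
    gsq (Function.update v k x) i = gsq v i := by
  unfold gsq
  split_ifs with hi
  · rw [proj_update v hx]
    by_cases hik : (⟨i, hi⟩ : Fin d) = k
    · subst hik
      rw [Function.update_self, proj_apply_eq v hx]
    · rw [Function.update_of_ne hik]
  · rfl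

/-! The exchange of two consecutive vectors. -/

section

variable (v : Fin d → E) {k k' : Fin d}

theorem proj_swap (hk : k'.val + 1 = k.val) {l : ℕ} (hl : l ≠ k) :
    proj (swap v k k') l = proj v l :=
  proj_congr (initSpan_swap v hk hl)

theorem gsq_swap_of_ne (hk : k'.val + 1 = k.val) {i : ℕ} (h : i ≠ k) (h' : i ≠ k') :
    gsq (swap v k k') i = gsq v i := by
  unfold gsq
  split_ifs with hi
  · rw [proj_swap v hk h, swap_of_ne v (fun e => h (by rw [← e])) (fun e => h' (by rw [← e]))]
  · rfl

theorem gsq_swap_left (hk : k'.val + 1 = k.val) : gsq (swap v k k') k' = ‖proj v k' (v k)‖ ^ 2 := by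
  rw [gsq_coe, proj_swap v hk (by omega), swap_left v hk]

theorem gsq_le_gsq_swap_left (hk : k'.val + 1 = k.val) : gsq v k ≤ gsq (swap v k k') k' := by
  rw [gsq_swap_left v hk, gsq_coe]
  have := norm_sq_proj_succ_le v k' (v k)
  rwa [hk] at this

theorem gsq_swap_right_le (hk : k'.val + 1 = k.val) : gsq (swap v k k') k ≤ gsq v k' := by
  have := norm_sq_proj_succ_le (swap v k k') k' (v k')
  rw [hk, proj_swap v hk (l := k'.val) (by omega)] at this
  rwa [gsq_coe, gsq_coe, swap_right]

/-- An exchange does not change the area spanned by the two projected vectors. -/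
theorem gsq_swap_mul (hk : k'.val + 1 = k.val) (h' : 0 < gsq v k') (h : 0 < gsq v k) :
    gsq (swap v k k') k' * gsq (swap v k k') k = gsq v k' * gsq v k := by
  have h1 := norm_sq_proj_succ v k' (v k)
  have h2 := norm_sq_proj_succ (swap v k k') k' (v k')
  have h3 := gsq_le_gsq_swap_left v hk
  have e1 : ‖proj (swap v k k') k.val (v k')‖ ^ 2 = gsq (swap v k k') k := by
    rw [gsq_coe, swap_right]
  rw [hk, ← gsq_swap_left v hk, ← gsq_coe] at h1
  rw [hk, e1, swap_left v hk, proj_swap v hk (by omega), ← gsq_coe] at h2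
  rw [real_inner_comm] at h2
  have h4 : 0 < gsq (swap v k k') k' := by linarith
  rw [← sub_eq_iff_eq_add', eq_div_iff h'.ne'] at h1
  rw [← sub_eq_iff_eq_add', eq_div_iff h4.ne'] at h2
  linarith

theorem gsq_swap_pos (hk : k'.val + 1 = k.val) (h : ∀ i, 0 < gsq v i) (i : ℕ) :
    0 < gsq (swap v k k') i := by
  have h1 := gsq_le_gsq_swap_left v hk
  have h2 := gsq_swap_mul v hk (h k') (h k)
  have h3 : 0 < gsq (swap v k k') k' := (h k).trans_le h1
  by_cases hik : i = k
  · rw [hik]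
    have h4 := mul_pos (h k') (h k)
    rw [← h2] at h4
    exact (mul_pos_iff_of_pos_left h3).1 h4
  by_cases hik' : i = k'
  · rwa [hik']
  rw [gsq_swap_of_ne v hk hik hik']
  exact h i

theorem vol_swap_of_ne (hk : k'.val + 1 = k.val) (h : ∀ i, 0 < gsq v i) {l : ℕ} (hl : l ≠ k) :
    vol (swap v k k') l = vol v l := by
  have key : ∀ l ≤ k'.val, vol (swap v k k') l = vol v l := fun l hl =>
    vol_congr fun i hi => gsq_swap_of_ne v hk (by omega) (by omega)
  induction l with
  | zero => rw [vol_zero, vol_zero]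
  | succ l ih =>
    by_cases h1 : l + 1 ≤ k'.val
    · exact key _ h1
    by_cases h2 : l = k
    · have e (w : Fin d → E) : vol w (l + 1) = vol w k' * (gsq w k' * gsq w k) := by
        rw [h2, vol_succ, ← hk, vol_succ, mul_assoc]
      rw [e, e, key _ le_rfl, gsq_swap_mul v hk (h _) (h _)]
    · rw [vol_succ, vol_succ, ih h2, gsq_swap_of_ne v hk h2 (by omega)]

theorem vol_swap_self (hk : k'.val + 1 = k.val) :
    vol (swap v k k') k = vol v k' * gsq (swap v k k') k' := by
  rw [← hk, vol_succ]
  congr 1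
  exact vol_congr fun i hi => gsq_swap_of_ne v hk (by omega) (by omega)

end

/-- A nonzero integer combination is at least as long as one of the Gram-Schmidt vectors. -/
theorem exists_gsq_le_of_combination (v : Fin d → E) (c : Fin d → ℤ)
    (hc : ∃ i, c i ≠ 0) : ∃ i : Fin d, gsq v i ≤ ‖∑ i, (c i : ℝ) • v i‖ ^ 2 := by
  classical
  obtain ⟨i, hi, hmax⟩ : ∃ i, c i ≠ 0 ∧ ∀ j, c j ≠ 0 → j ≤ i := by
    obtain ⟨i, hi, hm⟩ := (Finset.univ.filter fun i => c i ≠ 0).exists_max_image id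
      (by obtain ⟨i, hi⟩ := hc; exact ⟨i, by simpa using hi⟩)
    exact ⟨i, by simpa using hi, fun j hj => hm j (by simpa using hj)⟩
  refine ⟨i, ?_⟩
  have h1 : proj v i (∑ j, (c j : ℝ) • v j) = (c i : ℝ) • proj v i (v i) := by
    rw [map_sum, Finset.sum_eq_single i]
    · simp
    · intro j _ hj
      by_cases h0 : c j = 0
      · simp [h0]
      · have := lt_of_le_of_ne (hmax j h0) hj
        rw [map_smul, proj_eq_zero v (mem_initSpan v this), smul_zero]
    · simp
  have h2 := norm_proj_le v i (∑ j, (c j : ℝ) • v j)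
  rw [h1, norm_smul] at h2
  have h3 : (1 : ℝ) ≤ ‖(c i : ℝ)‖ := by
    rw [Real.norm_eq_abs]
    exact_mod_cast Int.one_le_abs hi
  rw [gsq_coe]
  have h4 : ‖proj v i (v i)‖ ≤ ‖(c i : ℝ)‖ * ‖proj v i (v i)‖ :=
    le_mul_of_one_le_left (norm_nonneg _) h3
  gcongr
  exact h4.trans h2

end GS

/-! ### Integrality of Gram determinants -/

namespace GS

open Submodule

variable {E : Type*} [NormedAddCommGroup E] [InnerProductSpace ℝ E] {d : ℕ}

/-- The Gram matrix of the first `l` vectors. -/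
noncomputable def initGram (v : Fin d → E) {l : ℕ} (hl : l ≤ d) : Matrix (Fin l) (Fin l) ℝ :=
  Matrix.of fun a b => inner ℝ (v (Fin.castLE hl a)) (v (Fin.castLE hl b))

/-- The Gram matrix of the first `l` vectors, bordered by the row of inner products with `x` and
the column of inner products with `y`. -/
noncomputable def borderedGram (v : Fin d → E) {l : ℕ} (hl : l ≤ d) (x y : E) :
    Matrix (Fin l ⊕ Fin 1) (Fin l ⊕ Fin 1) ℝ :=
  Matrix.fromBlocks (initGram v hl) (Matrix.of fun a _ => inner ℝ (v (Fin.castLE hl a)) y)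
    (Matrix.of fun _ b => inner ℝ x (v (Fin.castLE hl b))) (Matrix.of fun _ _ => inner ℝ x y)

theorem initSpan_eq_span_range (v : Fin d → E) {l : ℕ} (hl : l ≤ d) :
    initSpan v l = span ℝ (Set.range fun a : Fin l => v (Fin.castLE hl a)) := by
  unfold initSpan
  congr 1
  ext x
  constructor
  · rintro ⟨i, hi, rfl⟩
    exact ⟨⟨i, hi⟩, rfl⟩
  · rintro ⟨a, rfl⟩
    exact ⟨_, a.2, rfl⟩

theorem det_initGram_succ (v : Fin d → E) {l : ℕ} (hl : l + 1 ≤ d) :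
    (initGram v hl).det
      = (borderedGram v (Nat.le_of_succ_le hl) (v ⟨l, hl⟩) (v ⟨l, hl⟩)).det := by
  rw [← Matrix.det_submatrix_equiv_self finSumFinEquiv (initGram v hl)]
  congr 1
  ext i j
  have e1 (a : Fin l) : Fin.castLE hl (finSumFinEquiv (Sum.inl a))
      = Fin.castLE (Nat.le_of_succ_le hl) a := rfl
  have e2 (a : Fin 1) : Fin.castLE hl (finSumFinEquiv (Sum.inr a)) = ⟨l, hl⟩ :=
    Fin.ext (by simp)
  rcases i with i | i <;> rcases j with j | j <;>
    simp only [Matrix.submatrix_apply, initGram, borderedGram, Matrix.of_apply, e1, e2,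
      Matrix.fromBlocks_apply₁₁, Matrix.fromBlocks_apply₁₂, Matrix.fromBlocks_apply₂₁,
      Matrix.fromBlocks_apply₂₂]

variable [FiniteDimensional ℝ E]

/-- The Schur complement of a bordered Gram matrix is an inner product of projections. -/
theorem det_borderedGram (v : Fin d → E) {l : ℕ} (hl : l ≤ d) (x y : E)
    (h : (initGram v hl).det ≠ 0) :
    (borderedGram v hl x y).det
      = (initGram v hl).det * inner ℝ (proj v l x) (proj v l y) := by
  have hu : IsUnit (initGram v hl).det := h.isUnit
  let _ := (initGram v hl).invertibleOfIsUnitDet hu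
  rw [borderedGram, Matrix.det_fromBlocks₁₁, Matrix.invOf_eq_nonsing_inv]
  congr 1
  have hmem := sub_proj_mem v l y
  rw [initSpan_eq_span_range v hl, mem_span_range_iff_exists_fun] at hmem
  obtain ⟨t, ht⟩ := hmem
  -- the coefficients `t` of the projection of `y` solve the normal equations
  have h1 : initGram v hl *ᵥ t = fun a => inner ℝ (v (Fin.castLE hl a)) y := by
    funext a
    have h2 := inner_eq_zero_of_mem v (mem_initSpan v (i := Fin.castLE hl a) a.2) (proj_mem v l y)
    have h3 : inner ℝ (v (Fin.castLE hl a)) y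
        = inner ℝ (v (Fin.castLE hl a)) (y - proj v l y) := by rw [inner_sub_right, h2, sub_zero]
    rw [h3, ← ht, inner_sum]
    simp [Matrix.mulVec, dotProduct, initGram, inner_smul_right, mul_comm]
  have h2 : t = (initGram v hl)⁻¹ *ᵥ fun a => inner ℝ (v (Fin.castLE hl a)) y := by
    rw [← h1, Matrix.mulVec_mulVec, Matrix.nonsing_inv_mul _ hu, Matrix.one_mulVec]
  have h3 : proj v l y = y - ∑ a, t a • v (Fin.castLE hl a) := by rw [ht, sub_sub_cancel]
  rw [inner_proj, h3, inner_sub_right, inner_sum, Matrix.det_fin_one, Matrix.mul_assoc]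
  simp only [Matrix.sub_apply, Matrix.of_apply, Matrix.mul_apply, inner_smul_right]
  congr 1
  refine Finset.sum_congr rfl fun a _ => ?_
  rw [mul_comm]
  congr 1
  conv_rhs => rw [h2]
  rfl

theorem det_initGram (v : Fin d → E) (h : ∀ i, 0 < gsq v i) : ∀ {l : ℕ} (hl : l ≤ d),
    (initGram v hl).det = vol v l
  | 0, _ => by simp [vol_zero]
  | l + 1, hl => by
    have ih := det_initGram v h (Nat.le_of_succ_le hl)
    have hpos : 0 < vol v l := Finset.prod_pos fun i _ => h i
    rw [det_initGram_succ, det_borderedGram _ _ _ _ (by rw [ih]; exact hpos.ne'), ih, vol_succ,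
      real_inner_self_eq_norm_sq]
    congr 1
    exact (gsq_coe v ⟨l, hl⟩).symm

theorem vol_pos {v : Fin d → E} (h : ∀ i, 0 < gsq v i) (l : ℕ) : 0 < vol v l :=
  Finset.prod_pos fun i _ => h i

theorem exists_int_det {ι : Type*} [Fintype ι] [DecidableEq ι] (A : Matrix ι ι ℝ)
    (h : ∀ i j, ∃ z : ℤ, A i j = z) : ∃ z : ℤ, A.det = z := by
  choose f hf using h
  refine ⟨(Matrix.of f).det, ?_⟩
  rw [Int.cast_det]
  congr 1
  ext i j
  exact hf i j

/-- The entries of the fraction-free elimination of an integral Gram matrix are integers. -/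
theorem exists_int_vol_mul_inner {v : Fin d → E} (h : ∀ i, 0 < gsq v i)
    (hint : ∀ i j, ∃ z : ℤ, inner ℝ (v i) (v j) = (z : ℝ)) {l : ℕ} (hl : l ≤ d) (i j : Fin d) :
    ∃ z : ℤ, vol v l * inner ℝ (proj v l (v i)) (proj v l (v j)) = z := by
  rw [← det_initGram v h hl, ← det_borderedGram _ _ _ _ (by
    rw [det_initGram v h hl]; exact (vol_pos h l).ne')]
  refine exists_int_det _ fun a b => ?_
  rcases a with a | a <;> rcases b with b | b <;> exact hint _ _

theorem exists_int_vol {v : Fin d → E} (h : ∀ i, 0 < gsq v i)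
    (hint : ∀ i j, ∃ z : ℤ, inner ℝ (v i) (v j) = (z : ℝ)) {l : ℕ} (hl : l ≤ d) :
    ∃ z : ℤ, vol v l = z := by
  rw [← det_initGram v h hl]
  exact exists_int_det _ fun a b => hint _ _

theorem one_le_vol {v : Fin d → E} (h : ∀ i, 0 < gsq v i)
    (hint : ∀ i j, ∃ z : ℤ, inner ℝ (v i) (v j) = (z : ℝ)) {l : ℕ} (hl : l ≤ d) :
    1 ≤ vol v l := by
  obtain ⟨z, hz⟩ := exists_int_vol h hint hl
  have := vol_pos h l
  rw [hz] at this ⊢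
  exact_mod_cast this

theorem vol_le {v : Fin d → E} {S : ℝ} (hS : ∀ i < d, gsq v i ≤ S) {l : ℕ} (hl : l ≤ d) :
    vol v l ≤ S ^ l := by
  calc vol v l ≤ ∏ _i ∈ Finset.range l, S := Finset.prod_le_prod (fun i _ => gsq_nonneg v i)
        fun i hi => hS i (by have := Finset.mem_range.1 hi; omega)
    _ = S ^ l := by simp

end GS

/-! ### The fraction-free elimination computes projected inner products -/

namespace Timed

/-- Writing a vector of length at most `X` whose entries cost at most `X ^ k` each. -/
theorem vec_cost_le_pow {α : Type} {d X k : ℕ} (hX : 2 ≤ X) (hd : d ≤ X) (f : Fin d → Timed α)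
    (h : ∀ i, (f i).cost ≤ X ^ k) : (vec f).cost ≤ X ^ (k + 2) := by
  calc (vec f).cost ≤ d * (1 + X ^ k) := vec_cost_le f h
    _ ≤ X * (X ^ k + X ^ k) := by
      gcongr
      exact Nat.one_le_pow _ _ (by omega)
    _ = 2 * X ^ (k + 1) := by ring
    _ ≤ X * X ^ (k + 1) := by gcongr
    _ = X ^ (k + 2) := by ring

end Timed

namespace LLL

open Timed GS

/-- An integer vector as a vector of Euclidean space. -/
noncomputable def emb {e : ℕ} : (Fin e → ℤ) →+ EuclideanSpace ℝ (Fin e) where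
  toFun x := WithLp.toLp 2 fun c => (x c : ℝ)
  map_zero' := by ext; simp
  map_add' x y := by ext; simp

/-- A list of integer vectors as a list of vectors of Euclidean space. -/
noncomputable def embList {d e : ℕ} (b : Fin d → Fin e → ℤ) (i : Fin d) :
    EuclideanSpace ℝ (Fin e) := emb (b i)

variable {d e : ℕ}

theorem emb_apply (x : Fin e → ℤ) (c : Fin e) : emb x c = (x c : ℝ) := rfl

theorem emb_zsmul (q : ℤ) (x : Fin e → ℤ) : emb (q • x) = (q : ℝ) • emb x := by
  rw [map_zsmul, Int.cast_smul_eq_zsmul]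

theorem inner_emb (x y : Fin e → ℤ) : inner ℝ (emb x) (emb y) = ((∑ c, x c * y c : ℤ) : ℝ) := by
  simp [PiLp.inner_apply, emb_apply, mul_comm]

theorem norm_sq_emb (x : Fin e → ℤ) : ‖emb x‖ ^ 2 = ((∑ c, x c ^ 2 : ℤ) : ℝ) := by
  rw [← real_inner_self_eq_norm_sq, inner_emb]
  simp [sq]

theorem abs_apply_le {x : Fin e → ℤ} {T : ℕ} (h : ‖emb x‖ ^ 2 ≤ 2 ^ T) (c : Fin e) :
    |x c| ≤ 2 ^ T := by
  rw [norm_sq_emb] at h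
  have h1 : ∑ c, x c ^ 2 ≤ 2 ^ T := by exact_mod_cast h
  have h2 : x c ^ 2 ≤ ∑ c, x c ^ 2 :=
    Finset.single_le_sum (f := fun c => x c ^ 2) (fun _ _ => sq_nonneg _) (Finset.mem_univ c)
  have h3 : |x c| ≤ x c ^ 2 := by
    rw [← sq_abs, sq]
    rcases (abs_nonneg (x c)).eq_or_lt with h0 | h0
    · rw [← h0]; simp
    · exact le_mul_of_one_le_left h0.le h0
  linarith

/-- The size of a basis: the Gram-Schmidt vectors do not vanish, their squared lengths are at most
`2 ^ S`, and the squared lengths of the basis vectors are at most `2 ^ T`. -/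
structure SizeBound (b : Fin d → Fin e → ℤ) (S T : ℕ) : Prop where
  pos : ∀ i, 0 < gsq (embList b) i
  gsq_le : ∀ i < d, gsq (embList b) i ≤ 2 ^ S
  norm_le : ∀ i, ‖embList b i‖ ^ 2 ≤ 2 ^ T

theorem exists_int_inner (b : Fin d → Fin e → ℤ) (i j : Fin d) :
    ∃ z : ℤ, inner ℝ (embList b i) (embList b j) = (z : ℝ) := ⟨_, inner_emb _ _⟩

theorem vol_le_two_pow {b : Fin d → Fin e → ℤ} {S T : ℕ} (hb : SizeBound b S T) {l : ℕ}
    (hl : l ≤ d) : vol (embList b) l ≤ 2 ^ (S * d) :=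
  (GS.vol_le hb.gsq_le hl).trans (by
    rw [← pow_mul]
    exact pow_le_pow_right₀ (by norm_num) (Nat.mul_le_mul_left _ hl))

theorem abs_vol_mul_inner_le {b : Fin d → Fin e → ℤ} {S T : ℕ} (hb : SizeBound b S T) {l : ℕ}
    (hl : l ≤ d) (i j : Fin d) :
    |vol (embList b) l * inner ℝ (proj (embList b) l (embList b i))
      (proj (embList b) l (embList b j))| ≤ 2 ^ (S * d + T) := by
  rw [abs_mul, abs_of_pos (vol_pos hb.pos l), pow_add]
  have h1 := abs_real_inner_le_norm (proj (embList b) l (embList b i))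
    (proj (embList b) l (embList b j))
  have h2 := norm_proj_le (embList b) l (embList b i)
  have h3 := norm_proj_le (embList b) l (embList b j)
  have h4 : ‖embList b i‖ * ‖embList b j‖ ≤ 2 ^ T := by
    nlinarith [hb.norm_le i, hb.norm_le j, sq_nonneg (‖embList b i‖ - ‖embList b j‖)]
  have h5 : |inner ℝ (proj (embList b) l (embList b i)) (proj (embList b) l (embList b j))|
      ≤ 2 ^ T := h1.trans ((mul_le_mul h2 h3 (norm_nonneg _) (norm_nonneg _)).trans h4)
  exact mul_le_mul (vol_le_two_pow hb hl) h5 (abs_nonneg _) (by positivity)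

/-- The elimination with `l` pivots computes the Gram matrix of the projections along the first `l`
vectors, multiplied by the determinant `vol l`.  Its entries are therefore bordered Gram
determinants, which makes every division exact. -/
theorem stage_val {b : Fin d → Fin e → ℤ} (hb : ∀ i, 0 < gsq (embList b) i) : ∀ {l : ℕ}, l ≤ d →
    (((stage b l).val.2 : ℝ) = vol (embList b) l ∧
      ∀ i j, ((stage b l).val.1 i j : ℝ) = vol (embList b) l
        * inner ℝ (proj (embList b) l (embList b i)) (proj (embList b) l (embList b j)))
  | 0, _ => by
    simp [stage, gram, vec_val, sum_val, mul, vol_zero, proj_zero, embList, inner_emb]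
  | l + 1, hl => by
    obtain ⟨h1, h2⟩ := stage_val hb (Nat.le_of_succ_le hl)
    have hl' : l < d := hl
    have hv := vol_pos hb l
    set M := (stage b l).val.1 with hM
    set D := (stage b l).val.2 with hD
    have hval : (stage b (l + 1)).val
        = (fun i j => (M ⟨l, hl'⟩ ⟨l, hl'⟩ * M i j - M i ⟨l, hl'⟩ * M ⟨l, hl'⟩ j) / D,
          M ⟨l, hl'⟩ ⟨l, hl'⟩) := by
      simp only [stage, bind_val, hl', dif_pos, vec_val, mul, sub, div, pure_val, ← hM, ← hD]
    have hpivot : (M ⟨l, hl'⟩ ⟨l, hl'⟩ : ℝ) = vol (embList b) (l + 1) := by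
      rw [h2, vol_succ, real_inner_self_eq_norm_sq]
      congr 1
      exact (gsq_coe (embList b) ⟨l, hl'⟩).symm
    rw [hval]
    refine ⟨hpivot, fun i j => ?_⟩
    obtain ⟨z, hz⟩ := exists_int_vol_mul_inner hb (exists_int_inner b) hl i j
    -- the division is exact
    have key : M ⟨l, hl'⟩ ⟨l, hl'⟩ * M i j - M i ⟨l, hl'⟩ * M ⟨l, hl'⟩ j = z * D := by
      have h3 := inner_proj_succ (embList b) ⟨l, hl'⟩ (embList b i) (embList b j)
      simp only at h3
      rw [h3, vol_succ] at hz
      have hg := hb l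
      have : ((M ⟨l, hl'⟩ ⟨l, hl'⟩ * M i j - M i ⟨l, hl'⟩ * M ⟨l, hl'⟩ j : ℤ) : ℝ)
          = ((z * D : ℤ) : ℝ) := by
        push_cast
        rw [hpivot, h1, ← hz, h2, h2, h2, vol_succ]
        generalize gsq (embList b) l = g at *
        field_simp
      exact_mod_cast this
    have hD0 : D ≠ 0 := by
      intro h0
      rw [h0, Int.cast_zero] at h1
      exact hv.ne h1
    simp only [key]
    rw [Int.mul_ediv_cancel _ hD0, ← hz]

theorem stage_abs_le {b : Fin d → Fin e → ℤ} {S T : ℕ} (hb : SizeBound b S T) {l : ℕ}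
    (hl : l ≤ d) :
    |(stage b l).val.2| ≤ 2 ^ (S * d + T) ∧
      ∀ i j, |(stage b l).val.1 i j| ≤ 2 ^ (S * d + T) := by
  obtain ⟨h1, h2⟩ := stage_val hb.pos hl
  constructor
  · have h3 : |((stage b l).val.2 : ℝ)| ≤ 2 ^ (S * d + T) := by
      rw [h1, abs_of_pos (vol_pos hb.pos l)]
      exact (vol_le_two_pow hb hl).trans (pow_le_pow_right₀ (by norm_num) (by omega))
    exact_mod_cast h3
  · intro i j
    have h3 := abs_vol_mul_inner_le hb hl i j
    rw [← h2] at h3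
    exact_mod_cast h3

theorem stage_cost_le {b : Fin d → Fin e → ℤ} {S T X : ℕ} (hb : SizeBound b S T)
    (hX : S * d + T + 4 ≤ X) (hd : d ≤ X) (he : e ≤ X) : ∀ {l : ℕ}, l ≤ d →
    (stage b l).cost ≤ (l + 1) * X ^ 8
  | 0, _ => by
    have h1 : (gram b).cost ≤ X ^ 8 := by
      refine vec_cost_le_pow (k := 6) (by omega) hd _ fun i =>
        vec_cost_le_pow (k := 4) (by omega) hd _ fun j => ?_
      have hT : T + 4 ≤ X := by omega
      have h2 (c : Fin e) : (mul (b i c) (b j c)).cost ≤ (T + 2) * (T + 2) :=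
        mul_cost_le (abs_apply_le (hb.norm_le i) c) (abs_apply_le (hb.norm_le j) c)
      refine (sum_cost_le (s := T + T) _ h2 fun c => ?_).trans ?_
      · simp only [mul, abs_mul, pow_add]
        exact mul_le_mul (abs_apply_le (hb.norm_le i) c) (abs_apply_le (hb.norm_le j) c)
          (abs_nonneg _) (by positivity)
      · calc e * ((T + 2) * (T + 2) + 2 * (T + T) + e + 3)
            ≤ X * (X * X + X * X + X * X + X * X) := by
              have h4 : (T + 2) * (T + 2) ≤ X * X := by gcongr <;> omega
              exact Nat.mul_le_mul he (by nlinarith)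
          _ = 4 * X ^ 3 := by ring
          _ ≤ X * X ^ 3 := by gcongr; omega
          _ = X ^ 4 := by ring
    simpa [stage] using h1
  | l + 1, hl => by
    have ih := stage_cost_le hb hX hd he (Nat.le_of_succ_le hl)
    obtain ⟨hD, hM⟩ := stage_abs_le hb (Nat.le_of_succ_le hl)
    have hl' : l < d := hl
    generalize S * d + T = U at *
    simp only [stage, bind_cost, hl', dif_pos, pure_cost, add_zero]
    have h1 : ∀ f : Fin d → Fin d → Timed ℤ, (∀ i j, (f i j).cost ≤ X ^ 4) →
        (vec fun i => vec fun j => f i j).cost ≤ X ^ 8 := fun f hf =>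
      vec_cost_le_pow (k := 6) (by omega) hd _ fun i =>
        vec_cost_le_pow (k := 4) (by omega) hd _ fun j => hf i j
    have h2 := h1 (fun i j => do
        let s ← mul ((stage b l).val.1 ⟨l, hl'⟩ ⟨l, hl'⟩) ((stage b l).val.1 i j)
        let t ← mul ((stage b l).val.1 i ⟨l, hl'⟩) ((stage b l).val.1 ⟨l, hl'⟩ j)
        let u ← sub s t
        div u (stage b l).val.2) fun i j => by
      have hs : |(stage b l).val.1 ⟨l, hl'⟩ ⟨l, hl'⟩ * (stage b l).val.1 i j| ≤ 2 ^ (U + U) := by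
        rw [abs_mul, pow_add]
        exact mul_le_mul (hM _ _) (hM _ _) (abs_nonneg _) (by positivity)
      have ht : |(stage b l).val.1 i ⟨l, hl'⟩ * (stage b l).val.1 ⟨l, hl'⟩ j| ≤ 2 ^ (U + U) := by
        rw [abs_mul, pow_add]
        exact mul_le_mul (hM _ _) (hM _ _) (abs_nonneg _) (by positivity)
      have hu : |(stage b l).val.1 ⟨l, hl'⟩ ⟨l, hl'⟩ * (stage b l).val.1 i j
          - (stage b l).val.1 i ⟨l, hl'⟩ * (stage b l).val.1 ⟨l, hl'⟩ j| ≤ 2 ^ (U + U + 1) := by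
        refine (abs_sub _ _).trans ?_
        rw [pow_succ]
        linarith
      have c1 := mul_cost_le (hM ⟨l, hl'⟩ ⟨l, hl'⟩) (hM i j)
      have c2 := mul_cost_le (hM i ⟨l, hl'⟩) (hM ⟨l, hl'⟩ j)
      have c3 := sub_cost_le hs ht
      have c4 := div_cost_le hu hD
      have e1 : (U + 2) * (U + 2) ≤ X * X := by gcongr <;> omega
      have e2 : U + U + (U + U) + 3 ≤ X * X := by nlinarith
      have e3 : (U + U + 1 + 2) * (U + 2) ≤ (2 * X) * X := by gcongr <;> omega
      have e4 : 16 * (X * X) ≤ X ^ 4 := by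
        calc 16 * (X * X) ≤ (X * X) * (X * X) := by gcongr; nlinarith
          _ = X ^ 4 := by ring
      simp only [bind_cost]
      simp only [mul, sub, div] at *
      nlinarith
    nlinarith [h2, ih]

/-- The cost in the form of a single power of a common bound `X` for all the parameters, which keeps
the exponents of nested loops additive. -/
theorem stage_cost_le_pow {b : Fin d → Fin e → ℤ} {S T X : ℕ} (hb : SizeBound b S T)
    (hX : S * d + T + 4 ≤ X) (hd : d ≤ X) (he : e ≤ X) {l : ℕ} (hl : l ≤ d) :
    (stage b l).cost ≤ X ^ 10 := by
  calc (stage b l).cost ≤ (l + 1) * X ^ 8 := stage_cost_le hb hX hd he hl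
    _ ≤ (X * X) * X ^ 8 := by
      have h4 : 4 ≤ X := by omega
      gcongr
      nlinarith
    _ = X ^ 10 := by ring

end LLL

/-! ### Size reduction -/

namespace LLL

open Timed GS

variable {d e : ℕ}

theorem embList_update (b : Fin d → Fin e → ℤ) (k : Fin d) (x : Fin e → ℤ) :
    embList (Function.update b k x) = Function.update (embList b) k (emb x) := by
  funext i
  by_cases h : i = k
  · subst h
    simp [embList]
  · simp [embList, Function.update_of_ne h]

theorem emb_mem_initSpan {b : Fin d → Fin e → ℤ} {l : ℕ} {x : Fin e → ℤ}
    (hx : x ∈ AddSubgroup.closure (b '' {i | i.val < l})) : emb x ∈ initSpan (embList b) l := by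
  induction hx using AddSubgroup.closure_induction with
  | mem x hx =>
    obtain ⟨i, hi, rfl⟩ := hx
    exact mem_initSpan (embList b) hi
  | zero => rw [map_zero]; exact zero_mem _
  | add x y _ _ hx hy => rw [map_add]; exact add_mem hx hy
  | neg x _ hx => rw [map_neg]; exact neg_mem hx

/-- The multiple of `b l` that is subtracted from `b k`. -/
def reduceCoeff (b : Fin d → Fin e → ℤ) (k l : Fin d) : ℤ :=
  (2 * (stage b l).val.1 k l + (stage b l).val.1 l l) / (2 * (stage b l).val.1 l l)

/-- The multiplier is the integer nearest to the Gram-Schmidt coefficient. -/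
theorem abs_inner_sub_reduceCoeff_le {b : Fin d → Fin e → ℤ} (hb : ∀ i, 0 < gsq (embList b) i)
    (k l : Fin d) :
    |inner ℝ (proj (embList b) l (embList b l)) (proj (embList b) l (embList b k))
      - reduceCoeff b k l * gsq (embList b) l| ≤ gsq (embList b) l / 2 := by
  obtain ⟨-, h2⟩ := stage_val hb (l := l.val) l.2.le
  have hv := vol_pos hb l.val
  have hg := hb l.val
  have hkl := h2 k l
  have hll := h2 l l
  rw [real_inner_self_eq_norm_sq, ← gsq_coe] at hll
  rw [real_inner_comm] at hkl
  have hpos : (0 : ℤ) < 2 * (stage b l).val.1 l l := by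
    have : (0 : ℝ) < (stage b l).val.1 l l := by rw [hll]; positivity
    have : (0 : ℤ) < (stage b l).val.1 l l := by exact_mod_cast this
    linarith
  have q1 := Int.ediv_mul_le (2 * (stage b l).val.1 k l + (stage b l).val.1 l l) hpos.ne'
  have q2 := Int.lt_ediv_add_one_mul_self (2 * (stage b l).val.1 k l + (stage b l).val.1 l l) hpos
  change reduceCoeff b k l * _ ≤ _ at q1
  change _ < (reduceCoeff b k l + 1) * _ at q2
  have r1 : (reduceCoeff b k l : ℝ) * (2 * (stage b l).val.1 l l)
      ≤ 2 * (stage b l).val.1 k l + (stage b l).val.1 l l := by exact_mod_cast q1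
  have r2 : 2 * ((stage b l).val.1 k l : ℝ) + (stage b l).val.1 l l
      < ((reduceCoeff b k l : ℝ) + 1) * (2 * (stage b l).val.1 l l) := by exact_mod_cast q2
  rw [hll, hkl] at r1 r2
  generalize inner ℝ (proj (embList b) l (embList b l)) (proj (embList b) l (embList b k)) = I at *
  generalize gsq (embList b) l = g at *
  generalize (reduceCoeff b k l : ℝ) = q at *
  generalize vol (embList b) l = w at *
  have s1 : w * (q * (2 * g)) ≤ w * (2 * I + g) := by linarith
  have s2 : w * (2 * I + g) < w * ((q + 1) * (2 * g)) := by linarith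
  have t1 := le_of_mul_le_mul_left s1 hv
  have t2 := lt_of_mul_lt_mul_left s2 hv.le
  rw [abs_le]
  constructor <;> linarith

/-- Gram-Schmidt vectors of integer vectors are not too short, since `vol (l + 1) ≥ 1`. -/
theorem one_le_two_pow_mul_gsq {b : Fin d → Fin e → ℤ} {S T : ℕ} (hb : SizeBound b S T)
    (l : Fin d) : 1 ≤ 2 ^ (S * d) * gsq (embList b) l := by
  have h1 := one_le_vol hb.pos (exists_int_inner b) (l := l.val + 1) l.2
  rw [vol_succ] at h1
  exact h1.trans (mul_le_mul_of_nonneg_right (vol_le_two_pow hb l.2.le) (hb.pos _).le)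

theorem sq_reduceCoeff_mul_gsq_le {b : Fin d → Fin e → ℤ} (hb : ∀ i, 0 < gsq (embList b) i)
    (k l : Fin d) :
    (reduceCoeff b k l : ℝ) ^ 2 * gsq (embList b) l ≤ 4 * ‖embList b k‖ ^ 2 := by
  have h1 := abs_inner_sub_reduceCoeff_le hb k l
  have hg := hb l.val
  have h2 := abs_real_inner_le_norm (proj (embList b) l (embList b l))
    (proj (embList b) l (embList b k))
  have h3 := norm_proj_le (embList b) l (embList b k)
  have h4 := gsq_coe (embList b) l
  by_cases h0 : reduceCoeff b k l = 0
  · rw [h0]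
    simp
  have h5 : (1 : ℝ) ≤ |(reduceCoeff b k l : ℝ)| := by exact_mod_cast Int.one_le_abs h0
  generalize inner ℝ (proj (embList b) l (embList b l)) (proj (embList b) l (embList b k)) = I at *
  rw [← sq_abs (reduceCoeff b k l : ℝ)]
  generalize hq : (reduceCoeff b k l : ℝ) = q at *
  generalize ‖proj (embList b) l (embList b k)‖ = x at *
  have hs := norm_nonneg (proj (embList b) l (embList b l))
  generalize ‖proj (embList b) l (embList b l)‖ = s at *
  rw [h4] at h1 ⊢
  rw [h4] at hg
  have hs : 0 < s := lt_of_le_of_ne hs (fun h => by rw [← h] at hg; simp at hg)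
  have h6 : |q| * s ^ 2 ≤ |I| + s ^ 2 / 2 := by
    have := abs_sub_abs_le_abs_sub (q * s ^ 2) I
    rw [abs_mul, abs_of_pos hg, abs_sub_comm] at this
    linarith
  have h7 : s ^ 2 ≤ |q| * s ^ 2 := le_mul_of_one_le_left hg.le h5
  have h8 : s * (|q| * s) ≤ s * (2 * ‖embList b k‖) := by nlinarith
  have h9 := le_of_mul_le_mul_left h8 hs
  have h10 : 0 ≤ |q| * s := by positivity
  nlinarith

theorem sq_reduceCoeff_le {b : Fin d → Fin e → ℤ} {S T : ℕ} (hb : SizeBound b S T)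
    (k l : Fin d) : (reduceCoeff b k l : ℝ) ^ 2 ≤ 2 ^ (S * d) * (4 * 2 ^ T) := by
  have h1 := sq_reduceCoeff_mul_gsq_le hb.pos k l
  have h2 := one_le_two_pow_mul_gsq hb l
  have h3 := hb.norm_le k
  calc (reduceCoeff b k l : ℝ) ^ 2 = (reduceCoeff b k l : ℝ) ^ 2 * 1 := (mul_one _).symm
    _ ≤ (reduceCoeff b k l : ℝ) ^ 2 * (2 ^ (S * d) * gsq (embList b) l) :=
      mul_le_mul_of_nonneg_left h2 (sq_nonneg _)
    _ = 2 ^ (S * d) * ((reduceCoeff b k l : ℝ) ^ 2 * gsq (embList b) l) := by ring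
    _ ≤ 2 ^ (S * d) * (4 * 2 ^ T) :=
      mul_le_mul_of_nonneg_left (by linarith) (by positivity)

theorem abs_reduceCoeff_le {b : Fin d → Fin e → ℤ} {S T : ℕ} (hb : SizeBound b S T)
    (k l : Fin d) : |reduceCoeff b k l| ≤ 2 ^ (S * d + T + 2) := by
  have h4 : (reduceCoeff b k l : ℝ) ^ 2 ≤ 2 ^ (S * d + T + 2) := by
    refine (sq_reduceCoeff_le hb k l).trans (le_of_eq ?_)
    rw [pow_add, pow_add]
    ring
  have h5 : reduceCoeff b k l ^ 2 ≤ 2 ^ (S * d + T + 2) := by exact_mod_cast h4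
  refine le_trans ?_ h5
  by_cases h0 : reduceCoeff b k l = 0
  · simp [h0]
  · rw [← sq_abs, sq]
    exact le_mul_of_one_le_left (abs_nonneg _) (Int.one_le_abs h0)

/-- One step of the size reduction. -/
def reduceStep (b : Fin d → Fin e → ℤ) (k l : Fin d) : Fin d → Fin e → ℤ :=
  Function.update b k (b k - reduceCoeff b k l • b l)

theorem reduceStep_sub_mem (b : Fin d → Fin e → ℤ) {k l : Fin d} (hlk : l < k) :
    emb (b k - reduceCoeff b k l • b l) - embList b k ∈ initSpan (embList b) k := by
  rw [map_sub, emb_zsmul]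
  change embList b k - _ - _ ∈ _
  rw [sub_sub_cancel_left]
  exact neg_mem (Submodule.smul_mem _ _ (mem_initSpan (embList b) hlk))

/-- A step of the size reduction adds a fixed amount to the bit length of the reduced vector,
because the other vectors, whose size `T₀` bounds, stay as they are. -/
theorem sizeBound_reduceStep {b : Fin d → Fin e → ℤ} {S T T₀ : ℕ} (hb : SizeBound b S T)
    {k l : Fin d} (hlk : l < k) (hT₀ : ∀ i ≠ k, ‖embList b i‖ ^ 2 ≤ 2 ^ T₀) :
    SizeBound (reduceStep b k l) S (T + (S * d + T₀ + 4)) where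
  pos i := by
    rw [reduceStep, embList_update, gsq_update _ (reduceStep_sub_mem b hlk)]
    exact hb.pos i
  gsq_le i hi := by
    rw [reduceStep, embList_update, gsq_update _ (reduceStep_sub_mem b hlk)]
    exact hb.gsq_le i hi
  norm_le i := by
    rw [reduceStep, embList_update]
    by_cases hik : i = k
    · subst hik
      rw [Function.update_self, map_sub, emb_zsmul]
      have h3 := hb.norm_le i
      have h4 := hT₀ l hlk.ne
      have h5 := norm_sub_le (embList b i) ((reduceCoeff b i l : ℝ) • embList b l)
      rw [norm_smul, Real.norm_eq_abs] at h5
      have h6 : ‖embList b i - (reduceCoeff b i l : ℝ) • embList b l‖ ^ 2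
          ≤ 2 * ‖embList b i‖ ^ 2 + 2 * ((reduceCoeff b i l : ℝ) ^ 2 * ‖embList b l‖ ^ 2) := by
        have h7 := norm_nonneg (embList b i - (reduceCoeff b i l : ℝ) • embList b l)
        rw [← sq_abs (reduceCoeff b i l : ℝ), ← mul_pow]
        nlinarith [sq_nonneg (‖embList b i‖ - |(reduceCoeff b i l : ℝ)| * ‖embList b l‖)]
      have h8 := sq_reduceCoeff_le hb i l
      have h9 : (reduceCoeff b i l : ℝ) ^ 2 * ‖embList b l‖ ^ 2
          ≤ 2 ^ (S * d) * (4 * 2 ^ T) * 2 ^ T₀ :=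
        mul_le_mul h8 h4 (by positivity) (by positivity)
      have h10 : (1 : ℝ) ≤ 2 ^ (S * d) * 2 ^ T₀ := by
        rw [← pow_add]
        exact one_le_pow₀ (by norm_num)
      have h11 : (2 : ℝ) ^ T * 1 ≤ 2 ^ T * (2 ^ (S * d) * 2 ^ T₀) := by gcongr
      have h12 : (2 : ℝ) ^ (T + (S * d + T₀ + 4)) = 16 * (2 ^ T * (2 ^ (S * d) * 2 ^ T₀)) := by
        rw [pow_add, pow_add, pow_add]
        norm_num
        ring
      have h13 : (2 : ℝ) ^ (S * d) * (4 * 2 ^ T) * 2 ^ T₀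
          = 4 * (2 ^ T * (2 ^ (S * d) * 2 ^ T₀)) := by
        ring
      change ‖embList b i - (reduceCoeff b i l : ℝ) • embList b l‖ ^ 2 ≤ _
      rw [h12]
      rw [h13] at h9
      have h14 : (0 : ℝ) ≤ 2 ^ T * (2 ^ (S * d) * 2 ^ T₀) := by positivity
      generalize (2 : ℝ) ^ T * (2 ^ (S * d) * 2 ^ T₀) = z at *
      linarith
    · rw [Function.update_of_ne hik]
      exact (hb.norm_le i).trans (pow_le_pow_right₀ (by norm_num) (by omega))

/-- What size reduction of `b k` against the first `l` vectors achieves: `b k` is replaced by a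
vector `x` of the same coset modulo these vectors, with small Gram-Schmidt coefficients. -/
structure IsReduced (b : Fin d → Fin e → ℤ) (k : Fin d) (l : ℕ) (x : Fin e → ℤ) : Prop where
  sub_mem : x - b k ∈ AddSubgroup.closure (b '' {i | i.val < l})
  abs_inner_le : ∀ i : Fin d, i.val < l →
    |inner ℝ (proj (embList b) i (embList b i)) (proj (embList b) i (emb x))|
      ≤ gsq (embList b) i / 2

theorem isReduced_of_reduceStep {b : Fin d → Fin e → ℤ} (hb : ∀ i, 0 < gsq (embList b) i)
    {k l : Fin d} (hlk : l < k) {x : Fin e → ℤ} (hx : IsReduced (reduceStep b k l) k l x) :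
    IsReduced b k (l.val + 1) x := by
  have himg : reduceStep b k l '' {i | i.val < l.val} = b '' {i | i.val < l.val} :=
    Set.image_congr fun i hi => Function.update_of_ne
      (fun h => by subst h; exact absurd (lt_trans hi hlk) (lt_irrefl _)) _ _
  have hsub := hx.sub_mem
  rw [himg, reduceStep, Function.update_self] at hsub
  refine ⟨?_, fun i hi => ?_⟩
  · have h1 : x - b k = (x - (b k - reduceCoeff b k l • b l)) - reduceCoeff b k l • b l := by abel
    rw [h1]
    have hss : {i : Fin d | i.val < l.val} ⊆ {i : Fin d | i.val < l.val + 1} := by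
      intro i hi
      simp only [Set.mem_ofPred_eq] at hi ⊢
      omega
    exact sub_mem (AddSubgroup.closure_mono (Set.image_mono hss) hsub)
      (zsmul_mem (AddSubgroup.subset_closure (Set.mem_image_of_mem b (by simp))) _)
  · rcases Nat.lt_succ_iff_lt_or_eq.1 hi with h | h
    · have := hx.abs_inner_le i h
      rw [reduceStep, embList_update, gsq_update _ (reduceStep_sub_mem b hlk),
        proj_update _ (reduceStep_sub_mem b hlk),
        Function.update_of_ne (fun e => by subst e; exact absurd (lt_trans h hlk) (lt_irrefl _))]
        at this
      exact this
    · obtain rfl : i = l := Fin.ext h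
      have h2 : proj (embList b) i (emb x)
          = proj (embList b) i (emb (b k - reduceCoeff b k i • b i)) := by
        refine proj_apply_eq _ ?_
        rw [← map_sub]
        exact emb_mem_initSpan hsub
      have h3 := abs_inner_sub_reduceCoeff_le hb k i
      rw [h2, map_sub, emb_zsmul, map_sub, inner_sub_right, map_smul, inner_smul_right]
      change |inner ℝ _ (proj (embList b) i (embList b k)) - _ * inner ℝ
        (proj (embList b) i (embList b i)) (proj (embList b) i (embList b i))| ≤ _
      rwa [real_inner_self_eq_norm_sq, ← gsq_coe]

theorem sizeReduce_succ (k : Fin d) {l : ℕ} (hl : l < d) (b : Fin d → Fin e → ℤ) :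
    (sizeReduce k (l + 1) b).val = (sizeReduce k l (reduceStep b k ⟨l, hl⟩)).val := by
  simp only [sizeReduce, hl, dif_pos, bind_val]
  rfl

theorem reduceStep_cost_le {b : Fin d → Fin e → ℤ} {S T X : ℕ} (hb : SizeBound b S T)
    (k : Fin d) {l : ℕ} (hl : l < d) (hX : 2 * (S * d + T) + 16 ≤ X) (hd : d ≤ X) (he : e ≤ X) :
    (sizeReduce k (l + 1) b).cost
      ≤ X ^ 11 + (sizeReduce k l (reduceStep b k ⟨l, hl⟩)).cost := by
  have hst := stage_cost_le_pow hb (X := X) (by omega) hd he hl.le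
  obtain ⟨-, hM⟩ := stage_abs_le hb hl.le
  have hq := abs_reduceCoeff_le hb k ⟨l, hl⟩
  have hbk := fun i => abs_apply_le (hb.norm_le i)
  set U := S * d + T with hU
  set M := (stage b l).val.1 with hMdef
  have htwo : |(2 : ℤ)| ≤ 2 ^ 1 := by norm_num
  have hmul (i j : Fin d) : |2 * M i j| ≤ 2 ^ (U + 1) := by
    rw [abs_mul, pow_succ, mul_comm]
    exact mul_le_mul (hM i j) (by norm_num) (abs_nonneg _) (by positivity)
  have hnum (i j : Fin d) : |2 * M i j + M j j| ≤ 2 ^ (U + 2) := by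
    refine (abs_add_le _ _).trans ?_
    have h1 := hmul i j
    have h2 := hM j j
    rw [pow_succ] at h1 ⊢
    rw [pow_succ]
    linarith [pow_pos (show (0 : ℤ) < 2 by norm_num) U]
  have c1 := mul_cost_le htwo (hM k ⟨l, hl⟩)
  have c2 := add_cost_le (hmul k ⟨l, hl⟩) (hM ⟨l, hl⟩ ⟨l, hl⟩)
  have c3 := mul_cost_le htwo (hM ⟨l, hl⟩ ⟨l, hl⟩)
  have c4 := div_cost_le (hnum k ⟨l, hl⟩) (hmul ⟨l, hl⟩ ⟨l, hl⟩)
  have c5 : (vec fun c => do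
      let t ← mul (reduceCoeff b k ⟨l, hl⟩) (b ⟨l, hl⟩ c)
      sub (b k c) t).cost ≤ X ^ 5 := by
    refine vec_cost_le_pow (k := 3) (by omega) he _ fun c => ?_
    have h1 : |reduceCoeff b k ⟨l, hl⟩ * b ⟨l, hl⟩ c| ≤ 2 ^ (U + 2 + T) := by
      rw [abs_mul, pow_add]
      exact mul_le_mul hq (hbk _ c) (abs_nonneg _) (by positivity)
    have h2 := mul_cost_le hq (hbk ⟨l, hl⟩ c)
    have h3 := sub_cost_le (hbk k c) h1
    have h4 : (U + 2 + 2) * (T + 2) ≤ X * X := by gcongr <;> omega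
    have h5 : 2 * (X * X) ≤ X ^ 3 := by
      calc 2 * (X * X) ≤ X * (X * X) := by gcongr; omega
        _ = X ^ 3 := by ring
    have h6 : T + (U + 2 + T) + 3 ≤ 2 * X := by omega
    have h7 : 2 * X ≤ X * X := by gcongr; omega
    simp only [bind_cost]
    simp only [mul, sub] at *
    linarith
  have hcost : (sizeReduce k (l + 1) b).cost = (stage b l).cost + ((mul 2 (M k ⟨l, hl⟩)).cost
      + ((add (2 * M k ⟨l, hl⟩) (M ⟨l, hl⟩ ⟨l, hl⟩)).cost + ((mul 2 (M ⟨l, hl⟩ ⟨l, hl⟩)).cost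
      + ((div (2 * M k ⟨l, hl⟩ + M ⟨l, hl⟩ ⟨l, hl⟩) (2 * M ⟨l, hl⟩ ⟨l, hl⟩)).cost
      + ((vec fun c => do
        let t ← mul (reduceCoeff b k ⟨l, hl⟩) (b ⟨l, hl⟩ c)
        sub (b k c) t).cost + (sizeReduce k l (reduceStep b k ⟨l, hl⟩)).cost))))) := by
    simp only [sizeReduce, hl, dif_pos, bind_cost]
    rfl
  have e1 : (1 + 2) * (U + 2) ≤ X * X := by gcongr <;> omega
  have e2 : U + 1 + U + 3 ≤ X * X := by nlinarith
  have e3 : (U + 2 + 2) * (U + 1 + 2) ≤ X * X := by gcongr <;> omega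
  have e4 : X * X ≤ X ^ 5 := by
    rw [← sq]
    exact Nat.pow_le_pow_right (by omega) (by norm_num)
  have e5 : X ^ 5 ≤ X ^ 10 := Nat.pow_le_pow_right (by omega) (by norm_num)
  have e6 : 16 * X ^ 10 ≤ X ^ 11 := by
    calc 16 * X ^ 10 ≤ X * X ^ 10 := by gcongr; omega
      _ = X ^ 11 := by ring
  rw [hcost]
  linarith

/-- The effect of size reduction. -/
theorem sizeReduce_val (k : Fin d) : ∀ {l : ℕ}, l ≤ k.val → ∀ {b : Fin d → Fin e → ℤ},
    (∀ i, 0 < gsq (embList b) i) →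
    ∃ x, (sizeReduce k l b).val = Function.update b k x ∧ IsReduced b k l x
  | 0, _, b, _ => by
    refine ⟨b k, by simp [sizeReduce], ?_, fun i hi => by omega⟩
    rw [sub_self]
    exact zero_mem _
  | l + 1, hl, b, hb => by
    have hld : l < d := lt_trans hl k.2
    have hlk : (⟨l, hld⟩ : Fin d) < k := hl
    have hb' : ∀ i, 0 < gsq (embList (reduceStep b k ⟨l, hld⟩)) i := fun i => by
      rw [reduceStep, embList_update, gsq_update _ (reduceStep_sub_mem b hlk)]
      exact hb i
    obtain ⟨x, hx, hred⟩ := sizeReduce_val k (Nat.le_of_succ_le hl) hb'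
    refine ⟨x, ?_, isReduced_of_reduceStep hb hlk hred⟩
    rw [sizeReduce_succ k hld, hx, reduceStep, Function.update_idem]

theorem sizeReduce_cost_le (k : Fin d) {S T₀ X : ℕ} (hd : d ≤ X) (he : e ≤ X) : ∀ {l T : ℕ},
    l ≤ k.val → ∀ {b : Fin d → Fin e → ℤ}, SizeBound b S T →
    (∀ i ≠ k, ‖embList b i‖ ^ 2 ≤ 2 ^ T₀) →
    2 * (S * d + (T + l * (S * d + T₀ + 4))) + 16 ≤ X →
    (sizeReduce k l b).cost ≤ l * X ^ 11
  | 0, T, _, b, _, _, _ => by simp [sizeReduce]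
  | l + 1, T, hl, b, hb, hT₀, hX => by
    have hld : l < d := lt_trans hl k.2
    have hlk : (⟨l, hld⟩ : Fin d) < k := hl
    have hX' : (l + 1) * (S * d + T₀ + 4) = (S * d + T₀ + 4) + l * (S * d + T₀ + 4) := by ring
    have h1 := reduceStep_cost_le hb k hld (X := X) (by omega) hd he
    have h2 := sizeReduce_cost_le k (X := X) hd he (Nat.le_of_succ_le hl)
      (sizeBound_reduceStep hb hlk hT₀) (T₀ := T₀) (fun i hi => by
        rw [reduceStep, embList_update, Function.update_of_ne hi]
        exact hT₀ i hi) (by omega)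
    have h3 : (l + 1) * X ^ 11 = X ^ 11 + l * X ^ 11 := by ring
    omega

end LLL

/-! ### The main loop of the LLL algorithm -/

namespace LLL

open Timed GS

variable {d e : ℕ}

/-- The potential `∏ l, vol l`, whose decrease bounds the number of exchanges. -/
noncomputable def potential (b : Fin d → Fin e → ℤ) : ℝ :=
  ∏ l ∈ Finset.range d, vol (embList b) l

/-- The loop invariant at position `k`, for the lattice spanned by `b₀`.  Of Lovász's condition it
keeps the consequence `gsq i ≤ 2 * gsq (i + 1)`, where `2` is the inverse of `3 / 4 - (1 / 2) ^ 2`.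
Between the passes, the squared lengths of the basis vectors are at most `2 ^ (S + d)`: a
size-reduced vector is at most `√d` times as long as the longest Gram-Schmidt vector. -/
structure Inv (b₀ b : Fin d → Fin e → ℤ) (S k : ℕ) : Prop where
  size : SizeBound b S (S + d)
  closure_eq : AddSubgroup.closure (Set.range b) = AddSubgroup.closure (Set.range b₀)
  lovasz : ∀ i, i + 1 < k → gsq (embList b) i ≤ 2 * gsq (embList b) (i + 1)

theorem one_le_potential {b : Fin d → Fin e → ℤ} (hb : ∀ i, 0 < gsq (embList b) i) :
    1 ≤ potential b :=
  Finset.one_le_prod fun _ hl => one_le_vol hb (exists_int_inner b) (Finset.mem_range.1 hl).le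

/-- The potential in powers of `4 / 3`, the factor by which an exchange decreases it; note that
`2 ≤ (4 / 3) ^ 3`. -/
theorem potential_le {b : Fin d → Fin e → ℤ} {S T : ℕ} (hb : SizeBound b S T) :
    potential b ≤ (4 / 3) ^ (3 * (S * d * d)) := by
  calc potential b ≤ ∏ _l ∈ Finset.range d, (2 : ℝ) ^ (S * d) :=
        Finset.prod_le_prod (fun l _ => (vol_pos hb.pos l).le)
          fun l hl => vol_le_two_pow hb (Finset.mem_range.1 hl).le
    _ = 2 ^ (S * d * d) := by simp [pow_mul]
    _ ≤ ((4 / 3) ^ 3) ^ (S * d * d) := by gcongr; norm_num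
    _ = _ := by rw [← pow_mul]

theorem closure_range_update_le (b : Fin d → Fin e → ℤ) {k : Fin d} {x : Fin e → ℤ}
    (hx : x - b k ∈ AddSubgroup.closure (b '' {i | i.val < k.val})) :
    AddSubgroup.closure (Set.range (Function.update b k x))
      ≤ AddSubgroup.closure (Set.range b) := by
  rw [AddSubgroup.closure_le]
  rintro _ ⟨i, rfl⟩
  by_cases hik : i = k
  · subst hik
    rw [Function.update_self]
    have h1 := AddSubgroup.closure_mono (Set.image_subset_range b _) hx
    have h2 := add_mem h1 (AddSubgroup.subset_closure (Set.mem_range_self (f := b) i))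
    rwa [sub_add_cancel] at h2
  · rw [Function.update_of_ne hik]
    exact AddSubgroup.subset_closure (Set.mem_range_self i)

theorem closure_range_update (b : Fin d → Fin e → ℤ) {k : Fin d} {x : Fin e → ℤ}
    (hx : x - b k ∈ AddSubgroup.closure (b '' {i | i.val < k.val})) :
    AddSubgroup.closure (Set.range (Function.update b k x))
      = AddSubgroup.closure (Set.range b) := by
  refine le_antisymm (closure_range_update_le b hx) ?_
  have h1 := closure_range_update_le (Function.update b k x) (k := k) (x := b k) (by
    rw [Function.update_self, ← neg_sub]
    have himg : Function.update b k x '' {i | i.val < k.val} = b '' {i | i.val < k.val} :=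
      Set.image_congr fun i hi => Function.update_of_ne
        (fun h => by subst h; exact lt_irrefl _ (Set.mem_ofPred_eq ▸ hi)) _ _
    rw [himg]
    exact neg_mem hx)
  rwa [Function.update_idem, Function.update_eq_self] at h1

theorem range_swap {α : Type*} (b : Fin d → α) {k k' : Fin d} (hk : k'.val + 1 = k.val) :
    Set.range (swap b k k') = Set.range b := by
  have key : ∀ w : Fin d → α, Set.range (swap w k k') ⊆ Set.range w := by
    rintro w _ ⟨i, rfl⟩
    by_cases h : i = k
    · subst h
      exact ⟨k', by rw [swap_right]⟩
    by_cases h' : i = k'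
    · subst h'
      exact ⟨k, by rw [swap_left w hk]⟩
    exact ⟨i, by rw [swap_of_ne w h h']⟩
  refine Set.Subset.antisymm (key b) ?_
  conv_lhs => rw [← swap_swap b hk]
  exact key _

theorem embList_swap (b : Fin d → Fin e → ℤ) {k k' : Fin d} (hk : k'.val + 1 = k.val) :
    embList (swap b k k') = swap (embList b) k k' := by
  funext i
  by_cases h : i = k
  · subst h
    rw [swap_right, embList, swap_right, embList]
  by_cases h' : i = k'
  · subst h'
    rw [swap_left _ hk, embList, swap_left _ hk, embList]
  rw [swap_of_ne _ h h', embList, swap_of_ne _ h h', embList]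

/-- Size reduction of `b k` preserves the invariant, with the same Gram-Schmidt lengths. -/
theorem Inv.reduce {b₀ b : Fin d → Fin e → ℤ} {S : ℕ} {k : Fin d} (h : Inv b₀ b S k)
    {x : Fin e → ℤ} (hx : IsReduced b k k x) :
    Inv b₀ (Function.update b k x) S k ∧
      (∀ i, gsq (embList (Function.update b k x)) i = gsq (embList b) i) ∧
      ∀ i, proj (embList (Function.update b k x)) i = proj (embList b) i := by
  have hmem : emb x - embList b k ∈ initSpan (embList b) k := by
    have := emb_mem_initSpan hx.sub_mem
    rwa [map_sub] at this
  have hg : ∀ i, gsq (embList (Function.update b k x)) i = gsq (embList b) i := fun i => by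
    rw [embList_update, gsq_update _ hmem]
  have hp : ∀ i, proj (embList (Function.update b k x)) i = proj (embList b) i := fun i => by
    rw [embList_update, proj_update _ hmem]
  refine ⟨⟨⟨fun i => hg i ▸ h.size.pos i, fun i hi => hg i ▸ h.size.gsq_le i hi, fun i => ?_⟩, ?_,
    fun i hi => by rw [hg, hg]; exact h.lovasz i hi⟩, hg, hp⟩
  · rw [embList_update]
    by_cases hik : i = k
    · subst hik
      rw [Function.update_self]
      have h1 := norm_sq_le_of_reduced (embList b) (x := emb x) (m := 2 ^ S) (l := i) i.2.le
        (fun j _ => h.size.pos j) (fun j hj => h.size.gsq_le j (hj.trans i.2)) hx.abs_inner_le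
      rw [proj_apply_eq _ hmem, ← gsq_coe] at h1
      have h2 := h.size.gsq_le i i.2
      have h3 : (i.val : ℝ) + 1 ≤ 2 ^ d := by
        have : i.val + 1 ≤ 2 ^ d := le_trans i.2 Nat.lt_two_pow_self.le
        exact_mod_cast this
      have h4 : (0 : ℝ) ≤ i.val := Nat.cast_nonneg _
      have h5 : (0 : ℝ) < 2 ^ S := by positivity
      rw [pow_add]
      nlinarith
    · rw [Function.update_of_ne hik]
      exact h.size.norm_le i
  · rw [closure_range_update b hx.sub_mem, h.closure_eq]

/-- An exchange preserves the invariant and decreases the potential. -/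
theorem Inv.exchange {b₀ b : Fin d → Fin e → ℤ} {S : ℕ} {k k' : Fin d} (hk : k'.val + 1 = k.val)
    (h : Inv b₀ b S k)
    (hlt : 4 * ‖proj (embList b) k' (embList b k)‖ ^ 2 < 3 * gsq (embList b) k') :
    Inv b₀ (swap b k k') S k' ∧ potential (swap b k k') ≤ 3 / 4 * potential b := by
  have hleft : gsq (embList (swap b k k')) k' ≤ 3 / 4 * gsq (embList b) k' := by
    rw [embList_swap b hk, gsq_swap_left _ hk]
    linarith
  have hpos : ∀ i, 0 < gsq (embList (swap b k k')) i := fun i => by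
    rw [embList_swap b hk]
    exact gsq_swap_pos _ hk h.size.pos i
  refine ⟨⟨⟨hpos, fun i hi => ?_, fun i => ?_⟩, ?_, fun i hi => ?_⟩, ?_⟩
  · have h0 := h.size.gsq_le k' k'.2
    have hp := h.size.pos k'
    by_cases hik : i = k
    · rw [embList_swap b hk, hik]
      exact (gsq_swap_right_le _ hk).trans h0
    by_cases hik' : i = k'
    · rw [hik']
      linarith
    rw [embList_swap b hk, gsq_swap_of_ne _ hk hik hik']
    exact h.size.gsq_le i hi
  · rw [embList_swap b hk]
    by_cases hik : i = k
    · rw [hik, swap_right]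
      exact h.size.norm_le _
    by_cases hik' : i = k'
    · rw [hik', swap_left _ hk]
      exact h.size.norm_le _
    rw [swap_of_ne _ hik hik']
    exact h.size.norm_le i
  · rw [range_swap b hk, h.closure_eq]
  · rw [embList_swap b hk, gsq_swap_of_ne _ hk (by omega) (by omega),
      gsq_swap_of_ne _ hk (by omega) (by omega)]
    exact h.lovasz i (by omega)
  · have hmem : k.val ∈ Finset.range d := Finset.mem_range.2 k.2
    rw [potential, potential, ← Finset.mul_prod_erase _ _ hmem, ← Finset.mul_prod_erase _ _ hmem,
      ← mul_assoc]
    have h1 : ∏ l ∈ (Finset.range d).erase k, vol (embList (swap b k k')) l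
        = ∏ l ∈ (Finset.range d).erase k, vol (embList b) l :=
      Finset.prod_congr rfl fun l hl => by
        rw [embList_swap b hk, vol_swap_of_ne _ hk h.size.pos (Finset.ne_of_mem_erase hl)]
    rw [h1]
    refine mul_le_mul_of_nonneg_right ?_ (Finset.prod_nonneg fun l _ => (vol_pos h.size.pos l).le)
    have h2 : vol (embList b) k = vol (embList b) k' * gsq (embList b) k' := by
      rw [← hk, vol_succ]
    rw [embList_swap b hk, vol_swap_self _ hk, ← embList_swap b hk, h2]
    have := vol_pos h.size.pos k'
    nlinarith

/-- If the Lovász condition holds, the invariant extends to the next position. -/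
theorem Inv.advance {b₀ b : Fin d → Fin e → ℤ} {S : ℕ} {k k' : Fin d} (hk : k'.val + 1 = k.val)
    (h : Inv b₀ b S k)
    (hμ : |inner ℝ (proj (embList b) k' (embList b k')) (proj (embList b) k' (embList b k))|
      ≤ gsq (embList b) k' / 2)
    (hle : 3 * gsq (embList b) k' ≤ 4 * ‖proj (embList b) k' (embList b k)‖ ^ 2) :
    Inv b₀ b S (k.val + 1) := by
  refine ⟨h.size, h.closure_eq, fun i hi => ?_⟩
  by_cases hik : i + 1 < k
  · exact h.lovasz i hik
  obtain rfl : i = k' := by omega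
  have h1 := norm_sq_proj_succ (embList b) k' (embList b k)
  rw [hk, ← gsq_coe] at h1
  rw [hk]
  have hp := h.size.pos k'
  have h2 : inner ℝ (proj (embList b) k' (embList b k')) (proj (embList b) k' (embList b k)) ^ 2
      / gsq (embList b) k' ≤ gsq (embList b) k' / 4 := by
    rw [div_le_iff₀ hp, ← sq_abs]
    have := abs_nonneg
      (inner ℝ (proj (embList b) k' (embList b k')) (proj (embList b) k' (embList b k)))
    nlinarith
  linarith

/-- A pass of the loop at an inner position. -/
theorem body_spec {b₀ b : Fin d → Fin e → ℤ} {S X : ℕ} {k : ℕ} (h : Inv b₀ b S k) (hk0 : k ≠ 0)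
    (hkd : k < d) (hX : 2 * (S * d + (S + d + d * (S * d + (S + d) + 4))) + 16 ≤ X) (he : e ≤ X) :
    (body (b, k)).cost ≤ X ^ 13 ∧ ∃ b' : Fin d → Fin e → ℤ,
      ((body (b, k)).val = .inl (b', k + 1) ∧ Inv b₀ b' S (k + 1) ∧ potential b' = potential b) ∨
      ((body (b, k)).val = .inl (b', k - 1) ∧ Inv b₀ b' S (k - 1) ∧
        potential b' ≤ 3 / 4 * potential b) := by
  have hdX : d ≤ X := by omega
  set K : Fin d := ⟨k, hkd⟩ with hK
  set K' : Fin d := ⟨k - 1, lt_of_le_of_lt (Nat.sub_le _ _) hkd⟩ with hK'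
  have hKK : K'.val + 1 = K.val := by simp only [hK, hK']; omega
  obtain ⟨x, hval, hx⟩ := sizeReduce_val K (l := k) le_rfl h.size.pos
  have hcost1 : (sizeReduce K k b).cost ≤ k * X ^ 11 := by
    refine sizeReduce_cost_le K (S := S) (T₀ := S + d) (T := S + d) hdX he le_rfl h.size
      (fun i _ => h.size.norm_le i) ?_
    have : k * (S * d + (S + d) + 4) ≤ d * (S * d + (S + d) + 4) := Nat.mul_le_mul_right _ hkd.le
    have : 2 * (S * d + (S + d + k * (S * d + (S + d) + 4))) + 16 ≤ X := by omega
    exact this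
  obtain ⟨hinv, hg, hp⟩ := Inv.reduce (k := K) h hx
  have hk1 : k - 1 ≤ d := by omega
  have hcost2 := stage_cost_le_pow hinv.size (X := X) (by omega) hdX he hk1
  obtain ⟨-, hM⟩ := stage_val hinv.size.pos hk1
  obtain ⟨-, hMabs⟩ := stage_abs_le hinv.size hk1
  rw [← hval] at hinv hg hp hcost2 hM hMabs
  set b' := (sizeReduce K k b).val with hb'
  set M := (stage b' (k - 1)).val.1 with hMdef
  have hu : |3 * M K' K'| ≤ 2 ^ (S * d + (S + d) + 2) := by
    rw [abs_mul, pow_add, mul_comm]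
    exact mul_le_mul (hMabs _ _) (by norm_num) (abs_nonneg _) (by positivity)
  have hv : |4 * M K K| ≤ 2 ^ (S * d + (S + d) + 2) := by
    rw [abs_mul, pow_add, mul_comm]
    exact mul_le_mul (hMabs _ _) (by norm_num) (abs_nonneg _) (by positivity)
  have c1 := mul_cost_le (show |(3 : ℤ)| ≤ 2 ^ 2 by norm_num) (hMabs K' K')
  have c2 := mul_cost_le (show |(4 : ℤ)| ≤ 2 ^ 2 by norm_num) (hMabs K K)
  have c3 := lt_cost_le hv hu
  have hbody : body (b, k) = (do
      let b ← sizeReduce K k b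
      let (M, _) ← stage b (k - 1)
      let u ← mul 3 (M K' K')
      let v ← mul 4 (M K K)
      if ← lt v u then
        pure (.inl (Function.update (Function.update b K' (b K)) K (b K'), k - 1))
      else pure (.inl (b, k + 1))) := by
    simp only [body, hkd, dif_pos, hk0, if_neg, not_false_eq_true, hK, hK']
  have hbc : (body (b, k)).cost = (sizeReduce K k b).cost + ((stage b' (k - 1)).cost
      + ((mul 3 (M K' K')).cost + ((mul 4 (M K K)).cost
      + (lt (4 * M K K) (3 * M K' K')).cost))) := by
    rw [hbody]
    simp only [bind_cost]
    congr 4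
    simp only [mul, ← hb', ← hMdef]
    split <;> simp
  constructor
  · rw [hbc]
    have e1 : (2 + 2) * (S * d + (S + d) + 2) ≤ X * X := by
      have : 4 ≤ X := by omega
      exact Nat.mul_le_mul this (by omega)
    have e2 : S * d + (S + d) + 2 + (S * d + (S + d) + 2) + 3 ≤ X * X := by nlinarith
    have e3 : k * X ^ 11 ≤ X ^ 12 := by
      calc k * X ^ 11 ≤ X * X ^ 11 := by gcongr; omega
        _ = X ^ 12 := by ring
    have e4 : X * X ≤ X ^ 10 := by
      rw [← sq]
      exact Nat.pow_le_pow_right (by omega) (by norm_num)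
    have e5 : X ^ 10 ≤ X ^ 12 := Nat.pow_le_pow_right (by omega) (by norm_num)
    have e6 : 16 * X ^ 12 ≤ X ^ 13 := by
      calc 16 * X ^ 12 ≤ X * X ^ 12 := by gcongr; omega
        _ = X ^ 13 := by ring
    linarith
  · have hvol := vol_pos hinv.size.pos (k - 1)
    have hMk' : (M K' K' : ℝ) = vol (embList b') (k - 1) * gsq (embList b') K' := by
      rw [hM, real_inner_self_eq_norm_sq, gsq_coe]
    have hMk : (M K K : ℝ)
        = vol (embList b') (k - 1) * ‖proj (embList b') K' (embList b' K)‖ ^ 2 := by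
      rw [hM, real_inner_self_eq_norm_sq]
    have hpot : potential b' = potential b := by
      unfold potential
      refine Finset.prod_congr rfl fun l _ => vol_congr fun i _ => hg i
    by_cases hlt : 4 * M K K < 3 * M K' K'
    · refine ⟨swap b' K K', Or.inr ?_⟩
      have hlt' : 4 * ‖proj (embList b') K' (embList b' K)‖ ^ 2 < 3 * gsq (embList b') K' := by
        have h1 : 4 * (M K K : ℝ) < 3 * M K' K' := by exact_mod_cast hlt
        rw [hMk, hMk'] at h1
        refine lt_of_mul_lt_mul_left (a := vol (embList b') (k - 1)) ?_ hvol.le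
        linarith
      obtain ⟨h2, h3⟩ := Inv.exchange hKK hinv hlt'
      refine ⟨?_, h2, hpot ▸ h3⟩
      rw [hbody]
      simp only [bind_val, mul, ← hb', ← hMdef, lt, hlt, decide_true, if_true, pure_val, swap]
    · refine ⟨b', Or.inl ?_⟩
      have hle : 3 * gsq (embList b') K' ≤ 4 * ‖proj (embList b') K' (embList b' K)‖ ^ 2 := by
        have h1 : 3 * (M K' K' : ℝ) ≤ 4 * M K K := by exact_mod_cast not_lt.1 hlt
        rw [hMk, hMk'] at h1
        refine le_of_mul_le_mul_left (a := vol (embList b') (k - 1)) ?_ hvol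
        linarith
      have hμ := hx.abs_inner_le K' (by simp only [hK']; omega)
      have hbK : embList b' K = emb x := by
        rw [hval, embList, Function.update_self]
      have hbK' : embList b' K' = embList b K' := by
        rw [hval, embList, embList, Function.update_of_ne (fun h => by rw [h] at hKK; omega)]
      rw [← hp, ← hg, ← hbK, ← hbK'] at hμ
      refine ⟨?_, Inv.advance hKK hinv hμ hle, hpot⟩
      rw [hbody]
      simp only [bind_val, mul, ← hb', ← hMdef, lt, hlt, decide_false]
      rfl

/-- The loop ends, within a number of passes governed by the potential: if at most `t` exchanges
remain, the number `2 * t + (d - k)` decreases in every pass, as an exchange lowers `t` by one and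
moves `k` back by one, and any other pass advances `k`. -/
theorem loop_spec {b₀ : Fin d → Fin e → ℤ} {S X : ℕ}
    (hX : 2 * (S * d + (S + d + d * (S * d + (S + d) + 4))) + 16 ≤ X) (he : e ≤ X) (hd : 0 < d) :
    ∀ (fuel t k : ℕ) (b : Fin d → Fin e → ℤ), Inv b₀ b S k → k ≤ d →
      potential b ≤ (4 / 3) ^ t → 2 * t + (d - k) + 1 ≤ fuel →
      (loop body fuel (b, k)).cost ≤ fuel * (1 + X ^ 13) ∧
      ∃ b', (loop body fuel (b, k)).val = some b' ∧ Inv b₀ b' S d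
  | 0, t, k, b, _, _, _, hf => by omega
  | fuel + 1, t, k, b, h, hk, ht, hf => by
    have hstep : ∀ (b' : Fin d → Fin e → ℤ) (k' : ℕ), (body (b, k)).val = .inl (b', k') →
        (body (b, k)).cost ≤ X ^ 13 →
        ((loop body fuel (b', k')).cost ≤ fuel * (1 + X ^ 13) ∧
          ∃ b'', (loop body fuel (b', k')).val = some b'' ∧ Inv b₀ b'' S d) →
        (loop body (fuel + 1) (b, k)).cost ≤ (fuel + 1) * (1 + X ^ 13) ∧
          ∃ b'', (loop body (fuel + 1) (b, k)).val = some b'' ∧ Inv b₀ b'' S d := by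
      intro b' k' hv hc ⟨h1, b'', h2, h3⟩
      simp only [loop, bind_cost, bind_val, charge, hv]
      refine ⟨?_, b'', h2, h3⟩
      rw [add_mul]
      omega
    by_cases hkd : k = d
    · have hb : body (b, k) = pure (.inr b) := by simp [body, hkd]
      refine ⟨?_, b, ?_, hkd ▸ h⟩
      · simp only [loop, bind_cost, charge, hb, pure_val, pure_cost, add_zero]
        exact Nat.mul_pos (Nat.succ_pos _) (by omega)
      · simp only [loop, bind_val, hb, pure_val]
    have hkd : k < d := lt_of_le_of_ne hk hkd
    by_cases hk0 : k = 0
    · subst hk0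
      have hb : body (b, 0) = pure (.inl (b, 1)) := by simp [body, hd]
      refine hstep b 1 (by rw [hb]; rfl) (by rw [hb]; exact Nat.zero_le _) ?_
      exact loop_spec hX he hd fuel t 1 b ⟨h.size, h.closure_eq, fun i hi => by omega⟩ hd ht
        (by omega)
    obtain ⟨hc, b', ⟨hv, hinv, hpot⟩ | ⟨hv, hinv, hpot⟩⟩ := body_spec h hk0 hkd hX he
    · exact hstep b' _ hv hc
        (loop_spec hX he hd fuel t (k + 1) b' hinv hkd (hpot ▸ ht) (by omega))
    · have h1 := one_le_potential hinv.size.pos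
      cases t with
      | zero => rw [pow_zero] at ht; linarith
      | succ t =>
        refine hstep b' _ hv hc
          (loop_spec hX he hd fuel t (k - 1) b' hinv (by omega) ?_ (by omega))
        rw [pow_succ] at ht
        linarith

/-- The gain of the reduction: the first vector is nearly shortest. -/
theorem Inv.first_le {b₀ b : Fin d → Fin e → ℤ} {S : ℕ} (h : Inv b₀ b S d) (hd : 0 < d)
    {x : Fin e → ℤ} (hx : x ∈ AddSubgroup.closure (Set.range b₀)) (hx0 : x ≠ 0) :
    ‖embList b ⟨0, hd⟩‖ ^ 2 ≤ 2 ^ (d - 1) * ‖emb x‖ ^ 2 := by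
  rw [← h.closure_eq, ← Submodule.span_int_eq_addSubgroupClosure] at hx
  obtain ⟨c, hc⟩ := (Submodule.mem_span_range_iff_exists_fun ℤ).1
    (show x ∈ Submodule.span ℤ (Set.range b) from hx)
  have hemb : emb x = ∑ i, (c i : ℝ) • embList b i := by
    rw [← hc, map_sum]
    exact Finset.sum_congr rfl fun i _ => emb_zsmul _ _
  have hc0 : ∃ i, c i ≠ 0 := by
    by_contra hcon
    push Not at hcon
    exact hx0 (by rw [← hc]; simp [hcon])
  obtain ⟨i, hi⟩ := exists_gsq_le_of_combination (embList b) c hc0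
  rw [← hemb] at hi
  have key : ∀ j < d, gsq (embList b) 0 ≤ 2 ^ j * gsq (embList b) j := by
    intro j
    induction j with
    | zero => intro _; simp
    | succ j ih =>
      intro hj
      have h1 := ih (by omega)
      have h2 := h.lovasz j hj
      rw [pow_succ, mul_assoc]
      exact h1.trans (mul_le_mul_of_nonneg_left h2 (by positivity))
  have h0 : gsq (embList b) 0 = ‖embList b ⟨0, hd⟩‖ ^ 2 := by
    have := gsq_coe (embList b) ⟨0, hd⟩
    rwa [proj_zero] at this
  rw [← h0]
  calc gsq (embList b) 0 ≤ 2 ^ i.val * gsq (embList b) i := key i i.2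
    _ ≤ 2 ^ (d - 1) * ‖emb x‖ ^ 2 := by
      have : i.val ≤ d - 1 := by have := i.2; omega
      refine mul_le_mul (pow_le_pow_right₀ (by norm_num) this) hi (gsq_nonneg _ _) (by positivity)

/-- The LLL algorithm ends in polynomial time, with a basis of the same lattice whose first vector
is nearly shortest. -/
theorem lll_spec {b : Fin d → Fin e → ℤ} {S X : ℕ} (hli : LinearIndependent ℝ (embList b))
    (hS : ∀ i, ‖embList b i‖ ^ 2 ≤ 2 ^ S) (hd : 0 < d)
    (hX : 2 * (S * d + (S + d + d * (S * d + (S + d) + 4))) + 16 ≤ X) (he : e ≤ X) :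
    ∃ (fuel : ℕ) (b' : Fin d → Fin e → ℤ), (lll fuel b).cost ≤ X ^ 17 ∧
      (lll fuel b).val = some b' ∧ Inv b b' S d := by
  have hinv : Inv b b S 1 := by
    refine ⟨⟨gsq_pos_of_linearIndependent hli, fun i hi => ?_, fun i => ?_⟩, rfl,
      fun i hi => by omega⟩
    · exact (gsq_le_norm_sq (embList b) ⟨i, hi⟩).trans (hS _)
    · exact (hS i).trans (pow_le_pow_right₀ (by norm_num) (by omega))
  obtain ⟨h1, b', h2, h3⟩ := loop_spec hX he hd (2 * (3 * (S * d * d)) + (d - 1) + 1) _ 1 b hinv hd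
    (potential_le hinv.size) le_rfl
  refine ⟨_, b', h1.trans ?_, h2, h3⟩
  have hdX : d ≤ X := by omega
  have e1 : 2 * (3 * (S * d * d)) + (d - 1) + 1 ≤ X ^ 3 := by
    have h4 : S * d * d ≤ X * X := Nat.mul_le_mul (by omega) hdX
    have h5 : 16 * (X * X) ≤ X * (X * X) := Nat.mul_le_mul_right _ (by omega)
    have h6 : X ≤ X * X := Nat.le_mul_self X
    have h7 : X ^ 3 = X * (X * X) := by ring
    omega
  have e2 : 1 + X ^ 13 ≤ X ^ 14 := by
    have h4 : 2 * X ^ 13 ≤ X * X ^ 13 := Nat.mul_le_mul_right _ (by omega)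
    have h5 : 1 ≤ X ^ 13 := Nat.one_le_pow _ _ (by omega)
    have h6 : X ^ 14 = X * X ^ 13 := by ring
    omega
  calc _ ≤ X ^ 3 * X ^ 14 := Nat.mul_le_mul e1 e2
    _ = X ^ 17 := by ring

end LLL

/-! ### The auxiliary routines: Euclid's algorithm, square roots, powers of two -/

namespace Timed

theorem euclid_val (a b : ℕ) : (euclid a b).val = a.gcd b := by
  induction b using Nat.strong_induction_on generalizing a with
  | _ b ih =>
    rw [euclid]
    split_ifs with h
    · simp [h]
    · rw [bind_val, ih _ (Nat.mod_lt _ (Nat.pos_of_ne_zero h)), Nat.gcd_comm b, ← Nat.gcd_rec,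
        Nat.gcd_comm]

theorem size_mod_lt {a b : ℕ} (hb : 0 < b) (hab : b ≤ a) : (a % b).size < a.size := by
  have h1 := Nat.div_add_mod a b
  have h2 := Nat.mod_lt a hb
  have h3 : 1 ≤ a / b := (Nat.one_le_div_iff hb).2 hab
  have h4 : b * 1 ≤ b * (a / b) := Nat.mul_le_mul_left _ h3
  have h5 := Nat.lt_size_self a
  have h6 : 0 < a.size := Nat.size_pos.2 (by omega)
  obtain ⟨s, hs⟩ : ∃ s, a.size = s + 1 := ⟨a.size - 1, by omega⟩
  rw [hs, pow_succ] at h5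
  rw [hs, Nat.lt_succ_iff, Nat.size_le]
  omega

/-- Every division step shortens one of the two numbers. -/
theorem euclid_cost_le_of_le {s : ℕ} : ∀ {b a : ℕ}, b ≤ a → a.size ≤ s → b.size ≤ s →
    (euclid a b).cost ≤ (a.size + b.size) * ((1 + s) * (1 + s)) + 1 := by
  intro b
  induction b using Nat.strong_induction_on with
  | _ b ih =>
    intro a hab ha hb
    rw [euclid]
    split_ifs with h
    · simp [charge]
    · have hb0 := Nat.pos_of_ne_zero h
      have h1 := Nat.mod_lt a hb0
      have h2 := size_mod_lt hb0 hab
      have h3 := ih _ h1 h1.le hb (by omega)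
      have h4 : (1 + a.size) * (1 + b.size) ≤ (1 + s) * (1 + s) := by gcongr
      have h5 : (b.size + (a % b).size + 1) * ((1 + s) * (1 + s))
          ≤ (a.size + b.size) * ((1 + s) * (1 + s)) := Nat.mul_le_mul_right _ (by omega)
      rw [add_mul] at h5
      simp only [bind_cost, charge]
      omega

/-- Euclid's algorithm takes cubic time. -/
theorem euclid_cost_le {s a b : ℕ} (ha : a.size ≤ s) (hb : b.size ≤ s) :
    (euclid a b).cost ≤ (2 * s + 1) * ((1 + s) * (1 + s)) + 1 := by
  rcases Nat.lt_or_ge a b with h | h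
  · rw [euclid]
    split_ifs with h0
    · simp [charge]
    · rw [Nat.mod_eq_of_lt h]
      have h1 := euclid_cost_le_of_le h.le hb ha
      have h4 : (1 + a.size) * (1 + b.size) ≤ (1 + s) * (1 + s) := by gcongr
      have h5 : (b.size + a.size + 1) * ((1 + s) * (1 + s))
          ≤ (2 * s + 1) * ((1 + s) * (1 + s)) := Nat.mul_le_mul_right _ (by omega)
      rw [add_mul] at h5
      simp only [bind_cost, charge]
      omega
  · have h1 := euclid_cost_le_of_le h ha hb
    have h5 : (a.size + b.size) * ((1 + s) * (1 + s))
        ≤ (2 * s + 1) * ((1 + s) * (1 + s)) := Nat.mul_le_mul_right _ (by omega)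
    omega

theorem dvd_gcdVec_iff (k : ℕ) : ∀ {d : ℕ} (x : Fin d → ℤ),
    k ∣ (gcdVec x).val ↔ ∀ j, k ∣ (x j).natAbs
  | 0, x => by simp [gcdVec]
  | d + 1, x => by
    rw [gcdVec, bind_val, euclid_val, Nat.dvd_gcd_iff, dvd_gcdVec_iff k, Fin.forall_fin_succ']

theorem gcdVec_le {s : ℕ} : ∀ {d : ℕ} {x : Fin d → ℤ}, (∀ j, |x j| ≤ 2 ^ s) →
    (gcdVec x).val ≤ 2 ^ s
  | 0, x, _ => by simp [gcdVec]
  | d + 1, x, h => by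
    rw [gcdVec, bind_val, euclid_val]
    rcases Nat.eq_zero_or_pos (x (Fin.last d)).natAbs with h0 | h0
    · rw [h0, Nat.gcd_zero_right]
      exact gcdVec_le fun j => h _
    · refine (Nat.gcd_le_right _ h0).trans ?_
      have := h (Fin.last d)
      rw [Int.abs_eq_natAbs] at this
      exact_mod_cast this

theorem size_le_of_le_two_pow {a s : ℕ} (h : a ≤ 2 ^ s) : a.size ≤ s + 1 :=
  Nat.size_le.2 (lt_of_le_of_lt h (Nat.pow_lt_pow_right (by norm_num) (by omega)))

theorem gcdVec_cost_le {s : ℕ} : ∀ {d : ℕ} {x : Fin d → ℤ}, (∀ j, |x j| ≤ 2 ^ s) →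
    (gcdVec x).cost ≤ d * ((2 * s + 3) * ((s + 2) * (s + 2)) + 1)
  | 0, x, _ => by simp [gcdVec]
  | d + 1, x, h => by
    have h1 := gcdVec_cost_le (x := fun i : Fin d => x i.castSucc) fun j => h _
    have h2 := size_le_of_le_two_pow (gcdVec_le (x := fun i : Fin d => x i.castSucc) fun j => h _)
    have h3 : (x (Fin.last d)).natAbs.size ≤ s + 1 := bits_le (h _)
    have h4 := euclid_cost_le h2 h3
    have h5 : 1 + (s + 1) = s + 2 := by ring
    have h6 : 2 * (s + 1) + 1 = 2 * s + 3 := by ring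
    rw [h5, h6] at h4
    rw [gcdVec, bind_cost, add_mul, one_mul]
    omega

theorem twoPow_val : ∀ e : ℕ, (twoPow e).val = 2 ^ e
  | 0 => rfl
  | e + 1 => by rw [twoPow, bind_val, twoPow_val e, mul, pow_succ, mul_comm]

theorem twoPow_cost_le : ∀ e : ℕ, (twoPow e).cost ≤ e * (3 * (e + 2))
  | 0 => by simp [twoPow]
  | e + 1 => by
    have h1 := twoPow_cost_le e
    have h2 := mul_cost_le (a := 2) (b := 2 ^ e) (s := 1) (t := e) (by norm_num)
      (by rw [abs_of_pos (by positivity)])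
    rw [twoPow, bind_cost, twoPow_val]
    nlinarith

theorem sqrtSearch_spec {k : ℤ} {s : ℕ} (hk : |k| ≤ 2 ^ s) : ∀ {fuel : ℕ} {j : ℤ}, 0 ≤ j →
    j + fuel ≤ 2 ^ s → k ≤ (j + fuel) ^ 2 →
    j ≤ (sqrtSearch k fuel j).val ∧ (sqrtSearch k fuel j).val ≤ j + fuel ∧
      k ≤ (sqrtSearch k fuel j).val ^ 2 ∧
      (sqrtSearch k fuel j).cost ≤ fuel * ((s + 2) * (s + 2) + 4 * s + 6)
  | 0, j, hj, hs, hkj => by simpa [sqrtSearch] using hkj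
  | fuel + 1, j, hj, hs, hkj => by
    push_cast at hs hkj
    have hjs : |j| ≤ 2 ^ s := by rw [abs_of_nonneg hj]; linarith [Int.natCast_nonneg fuel]
    have hjj : |j * j| ≤ 2 ^ (s + s) := by
      rw [abs_mul, pow_add]
      exact mul_le_mul hjs hjs (abs_nonneg _) (by positivity)
    have c1 := mul_cost_le hjs hjs
    have c2 := lt_cost_le hjj hk
    have c3 := add_cost_le hjs (show |(1 : ℤ)| ≤ 2 ^ 0 by norm_num)
    by_cases hlt : j * j < k
    · obtain ⟨h1, h2, h3, h4⟩ := sqrtSearch_spec hk (fuel := fuel) (j := j + 1) (by linarith)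
        (by linarith) (by rwa [add_assoc, add_comm (1 : ℤ)])
      have hval : (sqrtSearch k (fuel + 1) j).val = (sqrtSearch k fuel (j + 1)).val := by
        simp [sqrtSearch, mul, lt, add, hlt]
      have hcost : (sqrtSearch k (fuel + 1) j).cost = (mul j j).cost + ((lt (j * j) k).cost
          + ((add j 1).cost + (sqrtSearch k fuel (j + 1)).cost)) := by
        simp [sqrtSearch, mul, lt, add, hlt]
      rw [hval, hcost]
      push_cast
      refine ⟨by linarith, by linarith, h3, ?_⟩
      rw [add_mul]
      omega
    · have hval : (sqrtSearch k (fuel + 1) j).val = j := by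
        simp [sqrtSearch, mul, lt, hlt]
      have hcost : (sqrtSearch k (fuel + 1) j).cost = (mul j j).cost + (lt (j * j) k).cost := by
        simp [sqrtSearch, mul, lt, hlt]
      rw [hval, hcost]
      push_cast
      refine ⟨le_rfl, by linarith [Int.natCast_nonneg fuel], by rw [sq]; exact not_lt.1 hlt, ?_⟩
      rw [add_mul]
      omega

theorem ceilSqrt_spec {k s : ℕ} (hk : (k : ℤ) ≤ 2 ^ s) :
    0 ≤ (ceilSqrt k).val ∧ (ceilSqrt k).val ≤ k ∧ (k : ℤ) ≤ (ceilSqrt k).val ^ 2 ∧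
      (ceilSqrt k).cost ≤ k * ((s + 2) * (s + 2) + 4 * s + 6) := by
  have h0 : (0 : ℤ) ≤ k := Int.natCast_nonneg k
  have := sqrtSearch_spec (k := k) (s := s) (by rwa [abs_of_nonneg h0]) (fuel := k) (j := 0) le_rfl
    (by rwa [zero_add]) (by
      rw [zero_add]
      exact_mod_cast Nat.le_self_pow two_ne_zero k)
  rwa [zero_add] at this

end Timed

/-! ### The lattice of the algorithm -/

namespace ELO

open Timed

variable {n p : ℕ}

/-- The shifted response `Y + X Z`. -/
def shifted (Y : Fin n → ℤ) (X : Matrix (Fin n) (Fin p) ℤ) (Z : Fin p → ℤ) (i : Fin n) : ℤ :=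
  Y i + ∑ j, X i j * Z j

/-- Replacement of integers of absolute value below `3` by `3`. -/
def lifted (y : ℤ) : ℤ := if |y| < 3 then 3 else y

/-- The columns of the block matrix. -/
def columns (m : ℤ) (X : Matrix (Fin n) (Fin p) ℤ) (Y₂ : Fin n → ℤ) :
    Fin (p + (n + n)) → Fin (n + (p + n)) → ℤ :=
  fun c r => (entry m X Y₂ (block r) (block c)).val

theorem lifted_ne_zero (y : ℤ) : lifted y ≠ 0 := by
  unfold lifted
  split_ifs with h
  · norm_num
  · rintro rfl
    simp at h

theorem lifted_of_le {y : ℤ} (h : 3 ≤ |y|) : lifted y = y := if_neg (not_lt.2 h)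

theorem abs_lifted_le {y : ℤ} {s : ℕ} (h : |y| ≤ 2 ^ s) : |lifted y| ≤ 2 ^ (s + 2) := by
  unfold lifted
  have h1 : (1 : ℤ) ≤ 2 ^ s := one_le_pow₀ (by norm_num)
  split_ifs
  · rw [pow_add, abs_of_pos (by norm_num)]
    linarith
  · rw [pow_add]
    linarith

@[simp] theorem block_castAdd {a b c : ℕ} (i : Fin a) :
    (block (Fin.castAdd (b + c) i) : Fin a ⊕ Fin b ⊕ Fin c) = .inl i := by
  simp [block]

@[simp] theorem block_natAdd_castAdd {a b c : ℕ} (i : Fin b) :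
    (block (Fin.natAdd a (Fin.castAdd c i)) : Fin a ⊕ Fin b ⊕ Fin c) = .inr (.inl i) := by
  simp [block]

@[simp] theorem block_natAdd_natAdd {a b c : ℕ} (i : Fin c) :
    (block (Fin.natAdd a (Fin.natAdd b i)) : Fin a ⊕ Fin b ⊕ Fin c) = .inr (.inr i) := by
  simp [block]

theorem sum_blocks {R : Type*} [AddCommMonoid R] {a b c : ℕ} (f : Fin (a + (b + c)) → R) :
    ∑ i, f i = (∑ i, f (Fin.castAdd (b + c) i)) + ((∑ i, f (Fin.natAdd a (Fin.castAdd c i)))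
      + ∑ i, f (Fin.natAdd a (Fin.natAdd b i))) := by
  rw [Fin.sum_univ_add, Fin.sum_univ_add]

section combination

variable {R : Type*} [CommRing R] (m : ℤ) (X : Matrix (Fin n) (Fin p) ℤ) (Y₂ : Fin n → ℤ)
  (t : Fin (p + (n + n)) → R)

theorem combination_top (i : Fin n) :
    ∑ c, t c * (columns m X Y₂ c (Fin.castAdd (p + n) i) : R)
      = m * ((∑ j, X i j * t (Fin.castAdd (n + n) j))
        - Y₂ i * t (Fin.natAdd p (Fin.castAdd n i)) + t (Fin.natAdd p (Fin.natAdd n i))) := by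
  rw [sum_blocks]
  simp only [columns, block_castAdd, block_natAdd_castAdd, block_natAdd_natAdd, entry, mul, copy]
  have h1 : ∑ k, t (Fin.natAdd p (Fin.castAdd n k)) * (((if i = k then (do
      let t ← mul m (Y₂ i)
      sub 0 t) else pure 0 : Timed ℤ).val : ℤ) : R)
      = -(m * Y₂ i * t (Fin.natAdd p (Fin.castAdd n i))) := by
    rw [Finset.sum_eq_single i]
    · simp [mul, sub]
      ring
    · intro k _ hk
      simp [hk.symm]
    · simp
  have h2 : ∑ k, t (Fin.natAdd p (Fin.natAdd n k)) * (((if i = k then m else 0 : ℤ)) : R)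
      = m * t (Fin.natAdd p (Fin.natAdd n i)) := by
    rw [Finset.sum_eq_single i]
    · simp [mul_comm]
    · intro k _ hk
      simp [hk.symm]
    · simp
  have h3 : ∑ j, t (Fin.castAdd (n + n) j) * ((m * X i j : ℤ) : R)
      = m * ∑ j, X i j * t (Fin.castAdd (n + n) j) := by
    rw [Finset.mul_sum]
    refine Finset.sum_congr rfl fun j _ => ?_
    push_cast
    ring
  simp only [mul] at h1
  rw [h1, h2, h3]
  ring

theorem combination_middle (j : Fin p) :
    ∑ c, t c * (columns m X Y₂ c (Fin.natAdd n (Fin.castAdd n j)) : R)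
      = t (Fin.castAdd (n + n) j) := by
  have h : ∑ k, t (Fin.castAdd (n + n) k) * (((if j = k then 1 else 0 : ℤ)) : R)
      = t (Fin.castAdd (n + n) j) := by
    rw [Finset.sum_eq_single j]
    · simp
    · intro k _ hk
      simp [hk.symm]
    · simp
  rw [sum_blocks]
  simp only [columns, block_castAdd, block_natAdd_castAdd, block_natAdd_natAdd, entry]
  simp only [pure_val, h]
  simp

theorem combination_bottom (i : Fin n) :
    ∑ c, t c * (columns m X Y₂ c (Fin.natAdd n (Fin.natAdd p i)) : R)
      = t (Fin.natAdd p (Fin.natAdd n i)) := by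
  have h : ∑ k, t (Fin.natAdd p (Fin.natAdd n k)) * (((if i = k then 1 else 0 : ℤ)) : R)
      = t (Fin.natAdd p (Fin.natAdd n i)) := by
    rw [Finset.sum_eq_single i]
    · simp
    · intro k _ hk
      simp [hk.symm]
    · simp
  rw [sum_blocks]
  simp only [columns, block_castAdd, block_natAdd_castAdd, block_natAdd_natAdd, entry]
  simp only [pure_val, h]
  simp

end combination

/-- The columns of the block matrix are linearly independent: the matrix is block triangular up to
a permutation, with diagonal entries `1` and `- m Y₂ i`. -/
theorem linearIndependent_columns {m : ℤ} (hm : m ≠ 0) (X : Matrix (Fin n) (Fin p) ℤ)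
    {Y₂ : Fin n → ℤ} (hY : ∀ i, Y₂ i ≠ 0) :
    LinearIndependent ℝ (LLL.embList (columns m X Y₂)) := by
  rw [Fintype.linearIndependent_iff]
  intro t ht
  have hcoord (r : Fin (n + (p + n))) : ∑ c, t c * (columns m X Y₂ c r : ℝ) = 0 := by
    have := congrArg (fun x : EuclideanSpace ℝ (Fin (n + (p + n))) => x r) ht
    simpa [LLL.embList, LLL.emb_apply] using this
  have h1 (j : Fin p) : t (Fin.castAdd (n + n) j) = 0 := by
    rw [← combination_middle m X Y₂ t j, hcoord]
  have h3 (i : Fin n) : t (Fin.natAdd p (Fin.natAdd n i)) = 0 := by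
    rw [← combination_bottom m X Y₂ t i, hcoord]
  have h2 (i : Fin n) : t (Fin.natAdd p (Fin.castAdd n i)) = 0 := by
    have h := combination_top m X Y₂ t i
    rw [hcoord, h3] at h
    simp only [h1, mul_zero, Finset.sum_const_zero, zero_sub, add_zero] at h
    have hm' : (m : ℝ) ≠ 0 := by exact_mod_cast hm
    have hY' : (Y₂ i : ℝ) ≠ 0 := by exact_mod_cast hY i
    simpa [hm', hY'] using h.symm
  intro c
  refine Fin.addCases h1 (fun c => Fin.addCases h2 h3 c) c

theorem entry_abs_le {m : ℤ} {X : Matrix (Fin n) (Fin p) ℤ} {Y₂ : Fin n → ℤ} {s t : ℕ}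
    (hm : |m| ≤ 2 ^ s) (hX : ∀ i j, |X i j| ≤ 2 ^ t) (hY : ∀ i, |Y₂ i| ≤ 2 ^ t)
    (r : Fin n ⊕ Fin p ⊕ Fin n) (c : Fin p ⊕ Fin n ⊕ Fin n) :
    |(entry m X Y₂ r c).val| ≤ 2 ^ (s + t) := by
  have h1 : (1 : ℤ) ≤ 2 ^ s := one_le_pow₀ (by norm_num)
  have h2 : (1 : ℤ) ≤ 2 ^ t := one_le_pow₀ (by norm_num)
  have h3 : (1 : ℤ) ≤ 2 ^ (s + t) := one_le_pow₀ (by norm_num)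
  have hmul (x : ℤ) (hx : |x| ≤ 2 ^ t) : |m * x| ≤ 2 ^ (s + t) := by
    rw [abs_mul, pow_add]
    exact mul_le_mul hm hx (abs_nonneg _) (by positivity)
  have hm' : |m| ≤ 2 ^ (s + t) := by
    have := hmul 1 (by simpa using h2)
    rwa [mul_one] at this
  rcases r with i | i | i <;> rcases c with j | j | j <;>
    simp only [entry, mul, copy, pure_val]
  · exact hmul _ (hX i j)
  · split_ifs
    · simp only [bind_val, sub, zero_sub, abs_neg]
      exact hmul _ (hY i)
    · simp
  · split_ifs
    · exact hm'
    · simp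
  · split_ifs <;> simp [h3]
  · simp
  · simp
  · simp
  · simp
  · split_ifs <;> simp [h3]

theorem entry_cost_le {m : ℤ} {X : Matrix (Fin n) (Fin p) ℤ} {Y₂ : Fin n → ℤ} {s t : ℕ}
    (hm : |m| ≤ 2 ^ s) (hX : ∀ i j, |X i j| ≤ 2 ^ t) (hY : ∀ i, |Y₂ i| ≤ 2 ^ t)
    (r : Fin n ⊕ Fin p ⊕ Fin n) (c : Fin p ⊕ Fin n ⊕ Fin n) :
    (entry m X Y₂ r c).cost ≤ (s + 2) * (t + 2) + (s + t) + 3 := by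
  rcases r with i | i | i <;> rcases c with j | j | j <;>
    simp only [entry, pure_cost, Nat.zero_le, apply_ite Timed.cost]
  · have := mul_cost_le hm (hX i j)
    omega
  · split_ifs
    · have h1 := mul_cost_le hm (hY i)
      have h2 : |m * Y₂ i| ≤ 2 ^ (s + t) := by
        rw [abs_mul, pow_add]
        exact mul_le_mul hm (hY i) (abs_nonneg _) (by positivity)
      have h3 := bits_le h2
      simp only [bind_cost, sub]
      simp only [mul, bits, Int.natAbs_zero, Nat.size_zero] at *
      omega
    · omega
  · have h1 : |if i = j then m else 0| ≤ 2 ^ s := by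
      split_ifs
      · exact hm
      · simp
    have := bits_le h1
    simp only [copy]
    nlinarith

end ELO

/-! ### The run of the algorithm -/

namespace ELO

open Timed

variable {n p : ℕ}

/-- The block of the first vector of a basis that carries the regression coefficients. -/
def firstBlock (b : Fin (p + (n + n)) → Fin (n + (p + n)) → ℤ) (j : Fin p) : ℤ :=
  if h : 0 < p + (n + n) then b ⟨0, h⟩ (Fin.natAdd n (Fin.castAdd n j)) else 0

/-- The greatest common divisor of a vector, with the sign of the sum of its entries. -/
def signedGcd (x : Fin p → ℤ) : ℤ :=
  if ∑ j, x j < 0 then -((gcdVec x).val : ℤ) else (gcdVec x).val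

/-- The output of the algorithm when `x` is read off from the reduced basis. -/
def output (x Z : Fin p → ℤ) : Fin p → ℤ :=
  if signedGcd x = 0 then 0 else fun j => x j / signedGcd x - Z j

/-- The part of the algorithm that follows the lattice reduction. -/
def finish (b : Fin (p + (n + n)) → Fin (n + (p + n)) → ℤ) (Z : Fin p → ℤ) :
    Timed (Option (Fin p → ℤ)) := do
  let x ← vec fun j : Fin p => copy
    (if h : 0 < p + (n + n) then b ⟨0, h⟩ (Fin.natAdd n (Fin.castAdd n j)) else 0)
  let g₀ ← gcdVec x
  let s ← Timed.sum fun j => pure (x j)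
  let g ← if ← lt s 0 then sub 0 g₀ else pure (g₀ : ℤ)
  if g = 0 then pure (some 0)
  else do
    let out ← vec fun j => do
      let q ← div (x j) g
      sub q (Z j)
    pure (some out)

theorem run_eq (fuel : ℕ) (Y : Fin n → ℤ) (X : Matrix (Fin n) (Fin p) ℤ) (Rhat What : ℕ)
    (Z : Fin p → ℤ) : run fuel Y X Rhat What Z = (do
      let (lo, hi) ← shiftRange p Rhat
      let Z ← vec fun j => draw lo hi (Z j)
      let Y₁ ← vec fun i => do
        let s ← Timed.sum fun j => mul (X i j) (Z j)
        add (Y i) s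
      let Y₂ ← vec fun i => do
        let a ← Timed.abs (Y₁ i)
        if ← lt a 3 then copy 3 else copy (Y₁ i)
      let m ← scale n p Rhat What
      let A ← basis m X Y₂
      match ← LLL.lll fuel A with
      | none => pure none
      | some b => finish b Z) := rfl

theorem finish_val (b : Fin (p + (n + n)) → Fin (n + (p + n)) → ℤ) (Z : Fin p → ℤ) :
    (finish b Z).val = some (output (firstBlock b) Z) := by
  have hx : (vec fun j : Fin p => copy
    (if h : 0 < p + (n + n) then b ⟨0, h⟩ (Fin.natAdd n (Fin.castAdd n j)) else 0)).val
      = firstBlock b := rfl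
  have tail (g : ℤ) : (if g = 0 then pure (some 0)
      else (do
        let out ← vec fun j => do
          let q ← div (firstBlock b j) g
          sub q (Z j)
        pure (some out)) : Timed (Option (Fin p → ℤ))).val
      = some (if g = 0 then 0 else fun j => firstBlock b j / g - Z j) := by
    split_ifs
    · rfl
    · rfl
  simp only [finish, bind_val, hx, sum_val, pure_val, lt, decide_eq_true_eq, output, signedGcd]
  by_cases h : ∑ j, firstBlock b j < 0
  · simp only [h, if_true]
    refine (tail _).trans ?_
    simp only [sub, zero_sub]
  · simp only [h, if_false]
    exact tail _

theorem bits_natCast_le {g s : ℕ} (h : g ≤ 2 ^ s) : bits (g : ℤ) ≤ s + 1 :=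
  bits_le (by rw [abs_of_nonneg (Int.natCast_nonneg g)]; exact_mod_cast h)

theorem finish_cost_le {b : Fin (p + (n + n)) → Fin (n + (p + n)) → ℤ} {Z : Fin p → ℤ} {L V : ℕ}
    (hL : 16 ≤ L) (hp : p ≤ L) (hV : V ≤ 17 * L) (hb : ∀ j, |firstBlock b j| ≤ 2 ^ V)
    (hZ : ∀ j, |Z j| ≤ 2 ^ (L + 2)) : (finish b Z).cost ≤ L ^ 10 := by
  have hVL : V + 2 * L ≤ 2 * (L * L) := by nlinarith
  set x := firstBlock b with hxdef
  have hx : (vec fun j : Fin p => copy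
    (if h : 0 < p + (n + n) then b ⟨0, h⟩ (Fin.natAdd n (Fin.castAdd n j)) else 0)).val
      = x := rfl
  have hg0 := gcdVec_le hb
  have hsum : |∑ j, x j| ≤ 2 ^ (V + L) := by
    calc |∑ j, x j| ≤ ∑ j, |x j| := Finset.abs_sum_le_sum_abs _ _
      _ ≤ ∑ _j : Fin p, (2 : ℤ) ^ V := Finset.sum_le_sum fun j _ => hb j
      _ = p * 2 ^ V := by simp
      _ ≤ 2 ^ L * 2 ^ V := by
        gcongr
        exact_mod_cast hp.trans Nat.lt_two_pow_self.le
      _ = 2 ^ (V + L) := by rw [pow_add, mul_comm]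
  have c1 : (vec fun j : Fin p => copy
      (if h : 0 < p + (n + n) then b ⟨0, h⟩ (Fin.natAdd n (Fin.castAdd n j)) else 0)).cost
      ≤ L ^ 5 := by
    refine vec_cost_le_pow (k := 3) (by omega) hp _ fun j => ?_
    have h1 : (copy (x j)).cost ≤ V + 2 := by
      have := bits_le (hb j)
      simp only [copy]
      omega
    refine h1.trans ?_
    calc V + 2 ≤ 2 * (L * L) := by omega
      _ ≤ L * (L * L) := by gcongr; omega
      _ = L ^ 3 := by ring
  have c2 : (gcdVec x).cost ≤ L ^ 9 := by
    refine (gcdVec_cost_le hb).trans ?_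
    have h1 : 2 * V + 3 ≤ 4 * (L * L) := by omega
    have h2 : V + 2 ≤ 2 * (L * L) := by omega
    calc p * ((2 * V + 3) * ((V + 2) * (V + 2)) + 1)
        ≤ L * ((4 * (L * L)) * ((2 * (L * L)) * (2 * (L * L))) + L ^ 6) := by
          gcongr
          exact Nat.one_le_pow _ _ (by omega)
      _ = 17 * L ^ 7 := by ring
      _ ≤ (L * L) * L ^ 7 := by gcongr; nlinarith
      _ = L ^ 9 := by ring
  have c3 : (Timed.sum fun j => pure (x j)).cost ≤ L ^ 5 := by
    refine (sum_cost_le (c := 0) _ (fun j => le_rfl) hb).trans ?_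
    calc p * (0 + 2 * V + p + 3) ≤ L * (4 * (L * L)) := by gcongr; omega
      _ = 4 * L ^ 3 := by ring
      _ ≤ (L * L) * L ^ 3 := by gcongr; nlinarith
      _ = L ^ 5 := by ring
  have hL3 : 8 * (L * L) ≤ L ^ 3 := by
    calc 8 * (L * L) ≤ L * (L * L) := by gcongr; omega
      _ = L ^ 3 := by ring
  have c4 : (lt (∑ j, x j) 0).cost ≤ L ^ 3 := by
    refine (lt_cost_le hsum (t := 0) (by simp)).trans ?_
    omega
  have c5 : (sub 0 ((gcdVec x).val : ℤ)).cost ≤ L ^ 3 := by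
    have h1 := bits_natCast_le hg0
    simp only [sub]
    simp only [bits, Int.natAbs_zero, Nat.size_zero] at *
    omega
  have hdiv (g : ℤ) (j : Fin p) : |x j / g| ≤ 2 ^ V :=
    (Int.abs_ediv_le_abs _ _).trans (hb j)
  have c6 (g : ℤ) (hg : |g| ≤ 2 ^ V) : (vec fun j => do
      let q ← div (x j) g
      sub q (Z j)).cost ≤ L ^ 8 := by
    refine vec_cost_le_pow (k := 6) (by omega) hp _ fun j => ?_
    have h1 := div_cost_le (hb j) hg
    have h2 := sub_cost_le (hdiv g j) (hZ j)
    have h3 : (V + 2) * (V + 2) ≤ (2 * (L * L)) * (2 * (L * L)) := by gcongr <;> omega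
    have h4 : (2 * (L * L)) * (2 * (L * L)) + L ^ 3 ≤ L ^ 6 := by
      have h5 : L ^ 3 ≤ L ^ 4 := Nat.pow_le_pow_right (by omega) (by norm_num)
      have h6 : 5 * L ^ 4 ≤ (L * L) * L ^ 4 := by gcongr; nlinarith
      calc (2 * (L * L)) * (2 * (L * L)) + L ^ 3 = 4 * L ^ 4 + L ^ 3 := by ring
        _ ≤ (L * L) * L ^ 4 := by omega
        _ = L ^ 6 := by ring
    simp only [bind_cost]
    simp only [div, sub] at *
    omega
  have hgabs : |((gcdVec x).val : ℤ)| ≤ 2 ^ V := by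
    rw [abs_of_nonneg (Int.natCast_nonneg _)]
    exact_mod_cast hg0
  have e3 : L ^ 3 ≤ L ^ 9 := Nat.pow_le_pow_right (by omega) (by norm_num)
  have e5 : L ^ 5 ≤ L ^ 9 := Nat.pow_le_pow_right (by omega) (by norm_num)
  have e8 : L ^ 8 ≤ L ^ 9 := Nat.pow_le_pow_right (by omega) (by norm_num)
  have e10 : 16 * L ^ 9 ≤ L ^ 10 := by
    calc 16 * L ^ 9 ≤ L * L ^ 9 := by gcongr
      _ = L ^ 10 := by ring
  have tail (g : ℤ) (hg : |g| ≤ 2 ^ V) : (if g = 0 then pure (some 0)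
      else (do
        let out ← vec fun j => do
          let q ← div (x j) g
          sub q (Z j)
        pure (some out)) : Timed (Option (Fin p → ℤ))).cost ≤ L ^ 8 := by
    split_ifs
    · exact Nat.zero_le _
    · simp only [bind_cost, pure_cost, add_zero]
      exact c6 g hg
  simp only [finish, bind_cost, hx, sum_val, pure_val]
  have hs0 : (sub 0 ((gcdVec x).val : ℤ)).val = -((gcdVec x).val : ℤ) := by simp [sub]
  by_cases h : (lt (∑ j, x j) 0).val = true
  · have h1 := tail (sub 0 ((gcdVec x).val : ℤ)).val (by rwa [hs0, abs_neg])
    rw [if_pos h, bind_cost]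
    omega
  · have h1 := tail (pure ((gcdVec x).val : ℤ) : Timed ℤ).val hgabs
    rw [if_neg h, bind_cost, pure_cost]
    omega

theorem scale_val (n p Rhat What : ℕ) : (scale n p Rhat What).val
    = 2 ^ (n + (p + 1) / 2 + 3) * p * (Rhat * (ceilSqrt p).val + What * (ceilSqrt n).val) := by
  simp [scale, mul, add, twoPow_val]

theorem scale_cost_arith {n p L : ℕ} (hL : 2 * n + p + 16 ≤ L) :
    p * ((L + 2) * (L + 2) + 4 * L + 6) + n * ((L + 2) * (L + 2) + 4 * L + 6)
      + (n + (p + 1) / 2 + 3) * (3 * ((n + (p + 1) / 2 + 3) + 2)) + 3 * ((L + 2) * (L + 2))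
      + (L + L + 2) * (L + L + 1 + 2) + (L + L + (L + L) + 3) ≤ L ^ 5 := by
  have h16 : 16 ≤ L := by omega
  have e1 : (L + 2) * (L + 2) + 4 * L + 6 ≤ L * (L * L) := by
    have : 16 * (L * L) ≤ L * (L * L) := Nat.mul_le_mul_right _ h16
    nlinarith
  have e2 : p * ((L + 2) * (L + 2) + 4 * L + 6) ≤ L * (L * (L * L)) :=
    Nat.mul_le_mul (by omega) e1
  have e2' : n * ((L + 2) * (L + 2) + 4 * L + 6) ≤ L * (L * (L * L)) :=
    Nat.mul_le_mul (by omega) e1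
  have e3 : (n + (p + 1) / 2 + 3) * (3 * ((n + (p + 1) / 2 + 3) + 2)) ≤ L * (3 * L) :=
    Nat.mul_le_mul (by omega) (by omega)
  have e4 : (L + 2) * (L + 2) ≤ 2 * (L * L) := by nlinarith
  have e5 : (L + L + 2) * (L + L + 1 + 2) ≤ 9 * (L * L) := by nlinarith
  have e6 : L + L + (L + L) + 3 ≤ L * L := by nlinarith
  have e7 : 16 * 16 * (L * L) ≤ L * L * (L * L) :=
    Nat.mul_le_mul_right _ (Nat.mul_le_mul h16 h16)
  have e8 : 16 * L ^ 4 ≤ L * L ^ 4 := Nat.mul_le_mul_right _ h16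
  have e9 : L ^ 4 = L * (L * (L * L)) := by ring
  have e10 : L * L * (L * L) = L * (L * (L * L)) := by ring
  have e11 : L ^ 5 = L * L ^ 4 := by ring
  have e12 : L * (3 * L) = 3 * (L * L) := by ring
  omega

theorem scale_spec {Rhat What L : ℕ} (hL : 2 * n + p + 16 ≤ L) (hR : Rhat ≤ 2 ^ L)
    (hW : What ≤ 2 ^ L) : |(scale n p Rhat What).val| ≤ 2 ^ (4 * L + 1) ∧
      (scale n p Rhat What).cost ≤ L ^ 5 := by
  have hLL : (L : ℤ) ≤ 2 ^ L := by exact_mod_cast Nat.lt_two_pow_self.le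
  have hpL : (p : ℤ) ≤ 2 ^ L := le_trans (by exact_mod_cast (by omega : p ≤ L)) hLL
  have hnL : (n : ℤ) ≤ 2 ^ L := le_trans (by exact_mod_cast (by omega : n ≤ L)) hLL
  obtain ⟨a0, a1, -, ac⟩ := ceilSqrt_spec hpL
  obtain ⟨b0, b1, -, bc⟩ := ceilSqrt_spec hnL
  have tc := twoPow_cost_le (n + (p + 1) / 2 + 3)
  have hR' : |(Rhat : ℤ)| ≤ 2 ^ L := by
    rw [abs_of_nonneg (Int.natCast_nonneg _)]; exact_mod_cast hR
  have hW' : |(What : ℤ)| ≤ 2 ^ L := by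
    rw [abs_of_nonneg (Int.natCast_nonneg _)]; exact_mod_cast hW
  have hp' : |(p : ℤ)| ≤ 2 ^ L := by rwa [abs_of_nonneg (Int.natCast_nonneg _)]
  have ha : |(ceilSqrt p).val| ≤ 2 ^ L := by rw [abs_of_nonneg a0]; exact a1.trans hpL
  have hb : |(ceilSqrt n).val| ≤ 2 ^ L := by rw [abs_of_nonneg b0]; exact b1.trans hnL
  have hs : |(Rhat : ℤ) * (ceilSqrt p).val| ≤ 2 ^ (L + L) := by
    rw [abs_mul, pow_add]
    exact mul_le_mul hR' ha (abs_nonneg _) (by positivity)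
  have ht : |(What : ℤ) * (ceilSqrt n).val| ≤ 2 ^ (L + L) := by
    rw [abs_mul, pow_add]
    exact mul_le_mul hW' hb (abs_nonneg _) (by positivity)
  have hu : |(Rhat : ℤ) * (ceilSqrt p).val + What * (ceilSqrt n).val| ≤ 2 ^ (L + L + 1) := by
    refine (abs_add_le _ _).trans ?_
    rw [pow_succ]
    linarith
  have hw : |(2 : ℤ) ^ (n + (p + 1) / 2 + 3)| ≤ 2 ^ L := by
    rw [abs_of_pos (by positivity)]
    exact pow_le_pow_right₀ (by norm_num) (by omega)
  have hv : |(2 : ℤ) ^ (n + (p + 1) / 2 + 3) * p| ≤ 2 ^ (L + L) := by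
    rw [abs_mul, pow_add 2 L L]
    exact mul_le_mul hw hp' (abs_nonneg _) (by positivity)
  constructor
  · rw [scale_val, abs_mul, show 4 * L + 1 = (L + L) + (L + L + 1) by ring,
      pow_add 2 (L + L) (L + L + 1)]
    exact mul_le_mul hv hu (abs_nonneg _) (by positivity)
  · have c1 := mul_cost_le hR' ha
    have c2 := mul_cost_le hW' hb
    have c3 := add_cost_le hs ht
    have c4 := mul_cost_le hw hp'
    have c5 := mul_cost_le hv hu
    have e := scale_cost_arith hL
    have hcost : (scale n p Rhat What).cost = (ceilSqrt p).cost + ((ceilSqrt n).cost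
        + ((mul Rhat (ceilSqrt p).val).cost + ((mul What (ceilSqrt n).val).cost
        + ((add (Rhat * (ceilSqrt p).val) (What * (ceilSqrt n).val)).cost
        + ((twoPow (n + (p + 1) / 2 + 3)).cost
        + ((mul (twoPow (n + (p + 1) / 2 + 3)).val p).cost
        + (mul ((twoPow (n + (p + 1) / 2 + 3)).val * p)
          (Rhat * (ceilSqrt p).val + What * (ceilSqrt n).val)).cost)))))) := rfl
    rw [hcost, twoPow_val]
    omega

theorem abs_le_of_mem_shiftSet {Rhat L : ℕ} (hL : p + 16 ≤ L) (hR : Rhat < 2 ^ L) {z : ℤ}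
    (hz : z ∈ shiftSet p Rhat) : |z| ≤ 2 ^ (L + 2) := by
  obtain ⟨h1, h2⟩ := hz
  have h3 : Nat.log 2 p ≤ 2 ^ L :=
    (Nat.log_le_self 2 p).trans ((by omega : p ≤ L).trans Nat.lt_two_pow_self.le)
  have h3' : ((Nat.log 2 p : ℕ) : ℤ) ≤ 2 ^ L := by exact_mod_cast h3
  have hR' : (Rhat : ℤ) ≤ 2 ^ L := by exact_mod_cast hR.le
  have h0 : (0 : ℤ) ≤ Rhat := Int.natCast_nonneg _
  rw [abs_of_nonneg (by linarith), pow_add]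
  linarith

theorem shiftRange_spec {Rhat L : ℕ} (hL : p + 16 ≤ L) (hR : Rhat < 2 ^ L) :
    |(shiftRange p Rhat).val.1| ≤ 2 ^ L ∧ |(shiftRange p Rhat).val.2| ≤ 2 ^ (L + 2) ∧
      (shiftRange p Rhat).cost ≤ L ^ 3 := by
  have h0 : (0 : ℤ) ≤ Rhat := Int.natCast_nonneg _
  have h3 : Nat.log 2 p ≤ 2 ^ L :=
    (Nat.log_le_self 2 p).trans ((by omega : p ≤ L).trans Nat.lt_two_pow_self.le)
  have h3' : |((Nat.log 2 p : ℕ) : ℤ)| ≤ 2 ^ L := by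
    rw [abs_of_nonneg (Int.natCast_nonneg _)]; exact_mod_cast h3
  have hR' : |(Rhat : ℤ)| ≤ 2 ^ L := by rw [abs_of_nonneg h0]; exact_mod_cast hR.le
  have hR2 : |2 * (Rhat : ℤ)| ≤ 2 ^ (L + 1) := by
    rw [abs_mul, pow_succ, mul_comm]
    exact mul_le_mul hR' (by norm_num) (abs_nonneg _) (by positivity)
  have c1 := add_cost_le hR' (show |(1 : ℤ)| ≤ 2 ^ 0 by norm_num)
  have c2 := mul_cost_le (show |(2 : ℤ)| ≤ 2 ^ 1 by norm_num) hR'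
  have c3 := add_cost_le hR2 h3'
  have c4 : p.size ≤ L + 1 :=
    size_le_of_le_two_pow ((by omega : p ≤ L).trans Nat.lt_two_pow_self.le)
  refine ⟨?_, ?_, ?_⟩
  · change |(Rhat : ℤ) + 1| ≤ 2 ^ L
    rw [abs_of_nonneg (by linarith)]
    exact_mod_cast hR
  · change |2 * (Rhat : ℤ) + (Nat.log 2 p : ℤ)| ≤ 2 ^ (L + 2)
    refine (abs_add_le _ _).trans ?_
    have h1 : (0 : ℤ) < 2 ^ L := by positivity
    rw [pow_succ] at hR2
    rw [pow_add]
    linarith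
  · have e1 : 16 * L ≤ L * L := by gcongr; omega
    have e2 : L * L ≤ L ^ 3 := by
      rw [← sq]
      exact Nat.pow_le_pow_right (by omega) (by norm_num)
    simp only [shiftRange, bind_cost, pure_cost, floorLog]
    simp only [mul, add] at *
    nlinarith

theorem abs_shifted_le {Y : Fin n → ℤ} {X : Matrix (Fin n) (Fin p) ℤ} {Z : Fin p → ℤ} {L : ℕ}
    (hL : 2 * n + p + 16 ≤ L) (hY : ∀ i, |Y i| ≤ 2 ^ L) (hX : ∀ i j, |X i j| ≤ 2 ^ L)
    (hZ : ∀ j, |Z j| ≤ 2 ^ (L + 2)) (i : Fin n) :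
    |∑ j, X i j * Z j| ≤ 2 ^ (3 * L + 2) ∧ |shifted Y X Z i| ≤ 2 ^ (3 * L + 3) := by
  have h1 : |∑ j, X i j * Z j| ≤ 2 ^ (3 * L + 2) := by
    calc |∑ j, X i j * Z j| ≤ ∑ j, |X i j * Z j| := Finset.abs_sum_le_sum_abs _ _
      _ ≤ ∑ _j : Fin p, (2 : ℤ) ^ L * 2 ^ (L + 2) := Finset.sum_le_sum fun j _ => by
        rw [abs_mul]
        exact mul_le_mul (hX i j) (hZ j) (abs_nonneg _) (by positivity)
      _ = p * (2 ^ L * 2 ^ (L + 2)) := by simp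
      _ ≤ 2 ^ L * (2 ^ L * 2 ^ (L + 2)) := by
        gcongr
        exact_mod_cast (by omega : p ≤ L).trans Nat.lt_two_pow_self.le
      _ = 2 ^ (3 * L + 2) := by
        rw [← pow_add, ← pow_add]
        congr 1
        ring
  refine ⟨h1, (abs_add_le _ _).trans ?_⟩
  have h2 : (2 : ℤ) ^ L ≤ 2 ^ (3 * L + 2) := pow_le_pow_right₀ (by norm_num) (by omega)
  rw [pow_succ 2 (3 * L + 2)]
  linarith [hY i]

/-- The algorithm ends in polynomial time; its output is read off from an LLL-reduced basis.  The
lattice reduction costs at most `(L ^ 5) ^ 17`, and dominates the other steps. -/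
theorem run_spec {Y : Fin n → ℤ} {X : Matrix (Fin n) (Fin p) ℤ} {Rhat What L : ℕ} {Z : Fin p → ℤ}
    (hn : 0 < n) (hp : 0 < p) (hR0 : 0 < Rhat)
    (hL : 2 * n + p + 16 ≤ L) (hR : Rhat < 2 ^ L) (hW : What < 2 ^ L)
    (hY : ∀ i, |Y i| ≤ 2 ^ L) (hX : ∀ i j, |X i j| ≤ 2 ^ L) (hZ : ∀ j, Z j ∈ shiftSet p Rhat) :
    ∃ (b : Fin (p + (n + n)) → Fin (n + (p + n)) → ℤ) (S t : ℕ), t ≤ L ^ 86 ∧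
      Returns Y X Rhat What Z (output (firstBlock b) Z) t ∧
      LLL.Inv (columns (scale n p Rhat What).val X fun i => lifted (shifted Y X Z i)) b S
        (p + (n + n)) := by
  obtain ⟨lo1, hi1, rc⟩ := shiftRange_spec (p := p) (L := L) (by omega) hR
  have hZ' : ∀ j, |Z j| ≤ 2 ^ (L + 2) := fun j => abs_le_of_mem_shiftSet (by omega) hR (hZ j)
  have hY1 := abs_shifted_le hL hY hX hZ'
  have hY2 : ∀ i, |lifted (shifted Y X Z i)| ≤ 2 ^ (3 * L + 5) := fun i => abs_lifted_le (hY1 i).2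
  obtain ⟨hm, mc⟩ := scale_spec (n := n) (p := p) hL hR.le hW.le
  have hX' : ∀ i j, |X i j| ≤ 2 ^ (3 * L + 5) := fun i j =>
    (hX i j).trans (pow_le_pow_right₀ (by norm_num) (by omega))
  set m := (scale n p Rhat What).val with hmdef
  set Y₂ : Fin n → ℤ := fun i => lifted (shifted Y X Z i) with hY₂
  set A := columns m X Y₂ with hA
  have hm0 : m ≠ 0 := by
    obtain ⟨a0, -, a2, -⟩ := ceilSqrt_spec (k := p) (s := p)
      (by exact_mod_cast Nat.lt_two_pow_self.le)
    obtain ⟨b0, -, -, -⟩ := ceilSqrt_spec (k := n) (s := n)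
      (by exact_mod_cast Nat.lt_two_pow_self.le)
    have ha : 0 < (ceilSqrt p).val := by
      rcases a0.eq_or_lt with h | h
      · rw [← h] at a2
        have : (0 : ℤ) < p := by exact_mod_cast hp
        simp at a2
        omega
      · exact h
    rw [hmdef, scale_val]
    positivity
  have hli : LinearIndependent ℝ (LLL.embList A) :=
    linearIndependent_columns hm0 X (Y₂ := Y₂) fun i => lifted_ne_zero _
  have hS : ∀ c, ‖LLL.embList A c‖ ^ 2 ≤ 2 ^ (15 * L + 12) := by
    intro c
    rw [LLL.embList, LLL.norm_sq_emb]
    have h1 : ∑ r, A c r ^ 2 ≤ 2 ^ (15 * L + 12) := by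
      calc ∑ r, A c r ^ 2 ≤ ∑ _r : Fin (n + (p + n)), ((2 : ℤ) ^ (4 * L + 1 + (3 * L + 5))) ^ 2 :=
            Finset.sum_le_sum fun r _ => by
              rw [← sq_abs]
              exact pow_le_pow_left₀ (abs_nonneg _) (entry_abs_le hm hX' hY2 _ _) 2
        _ = ((n + (p + n) : ℕ) : ℤ) * ((2 : ℤ) ^ (4 * L + 1 + (3 * L + 5))) ^ 2 := by simp
        _ ≤ 2 ^ L * ((2 : ℤ) ^ (4 * L + 1 + (3 * L + 5))) ^ 2 := by
          gcongr
          exact_mod_cast (by omega : n + (p + n) ≤ L).trans Nat.lt_two_pow_self.le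
        _ = 2 ^ (15 * L + 12) := by
          rw [← pow_mul, ← pow_add]
          congr 1
          ring
    exact_mod_cast h1
  have hXL : 2 * ((15 * L + 12) * (p + (n + n)) + ((15 * L + 12) + (p + (n + n)) + (p + (n + n))
      * ((15 * L + 12) * (p + (n + n)) + ((15 * L + 12) + (p + (n + n))) + 4))) + 16 ≤ L ^ 5 := by
    have h1 : p + (n + n) ≤ L := by omega
    have h2 : (15 * L + 12) * (p + (n + n)) ≤ 16 * L * L := by gcongr; omega
    have h3 : 16 * L ≤ L * L := by gcongr; omega
    have h4 : (15 * L + 12) * (p + (n + n)) + ((15 * L + 12) + (p + (n + n))) + 4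
        ≤ 18 * (L * L) := by
      nlinarith
    have h5 : (p + (n + n)) * ((15 * L + 12) * (p + (n + n)) + ((15 * L + 12) + (p + (n + n))) + 4)
        ≤ L * (18 * (L * L)) := Nat.mul_le_mul h1 h4
    have h6 : 256 * L ^ 3 ≤ L ^ 5 := by
      calc 256 * L ^ 3 ≤ (L * L) * L ^ 3 := by gcongr; nlinarith
        _ = L ^ 5 := by ring
    have h7 : L * L ≤ L ^ 3 := by
      rw [← sq]
      exact Nat.pow_le_pow_right (by omega) (by norm_num)
    have h8 : L * (18 * (L * L)) = 18 * L ^ 3 := by ring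
    nlinarith
  obtain ⟨fuel, b, lc, lv, hinv⟩ := LLL.lll_spec hli hS (by omega) hXL
    (le_trans (by omega : n + (p + n) ≤ L) (Nat.le_self_pow (by norm_num) L))
  have hb : ∀ j, |firstBlock b j| ≤ 2 ^ (15 * L + 12 + (p + (n + n))) := by
    intro j
    rw [firstBlock, dif_pos (by omega)]
    exact LLL.abs_apply_le (hinv.size.norm_le _) _
  have fc := finish_cost_le (Z := Z) (L := L) (by omega) (by omega) (by omega) hb hZ'
  have hpow {a b : ℕ} (h : a ≤ b) : L ^ a ≤ L ^ b := Nat.pow_le_pow_right (by omega) h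
  have e1 : 16 * L ≤ L * L := by gcongr; omega
  have e2 : 16 * (L * L) ≤ L ^ 3 := by
    calc 16 * (L * L) ≤ L * (L * L) := by gcongr; omega
      _ = L ^ 3 := by ring
  -- the cost of the single steps
  have c2 : (vec fun j => draw (shiftRange p Rhat).val.1 (shiftRange p Rhat).val.2 (Z j)).cost
      ≤ L ^ 5 := by
    refine vec_cost_le_pow (k := 3) (by omega) (by omega) _ fun j => ?_
    have h1 := bits_le lo1
    have h2 := bits_le hi1
    simp only [draw, bind_cost, charge, pure_cost]
    omega
  have c3 : (vec fun i => do
      let s ← Timed.sum fun j => mul (X i j) (Z j)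
      add (Y i) s).cost ≤ L ^ 7 := by
    refine vec_cost_le_pow (k := 5) (by omega) (by omega) _ fun i => ?_
    have h1 := sum_cost_le (s := L + (L + 2)) (c := (L + 2) * (L + 2 + 2))
      (fun j => mul (X i j) (Z j)) (fun j => mul_cost_le (hX i j) (hZ' j)) fun j => by
        simp only [mul]
        rw [abs_mul, pow_add]
        exact mul_le_mul (hX i j) (hZ' j) (abs_nonneg _) (by positivity)
    have h2 := add_cost_le (hY i) (hY1 i).1
    have h3 : p * ((L + 2) * (L + 2 + 2) + 2 * (L + (L + 2)) + p + 3) ≤ L * (L ^ 3) := by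
      have : p ≤ L := by omega
      refine Nat.mul_le_mul this ?_
      nlinarith
    have h4 : L * L ^ 3 + L ^ 3 ≤ L ^ 5 := by
      have := hpow (show 3 ≤ 4 by norm_num)
      have h6 : 2 * L ^ 4 ≤ L * L ^ 4 := by gcongr; omega
      have h7 : L * L ^ 3 = L ^ 4 := by ring
      have h8 : L * L ^ 4 = L ^ 5 := by ring
      omega
    simp only [bind_cost, sum_val]
    simp only [mul, add] at *
    omega
  have c4 : (vec fun i => do
      let a ← Timed.abs (shifted Y X Z i)
      if ← lt a 3 then copy 3 else copy (shifted Y X Z i)).cost ≤ L ^ 5 := by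
    refine vec_cost_le_pow (k := 3) (by omega) (by omega) _ fun i => ?_
    have h1 := bits_le (hY1 i).2
    have h2 := lt_cost_le (a := |shifted Y X Z i|) (by rw [abs_abs]; exact (hY1 i).2)
      (show |(3 : ℤ)| ≤ 2 ^ 2 by norm_num)
    have h3 := bits_le (show |(3 : ℤ)| ≤ 2 ^ 2 by norm_num)
    simp only [bind_cost, Timed.abs]
    split
    · simp only [copy]
      omega
    · simp only [copy]
      omega
  have c6 : (basis m X Y₂).cost ≤ L ^ 8 := by
    refine vec_cost_le_pow (k := 6) (by omega) (by omega) _ fun c =>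
      vec_cost_le_pow (k := 4) (by omega) (by omega) _ fun r => ?_
    refine (entry_cost_le hm hX' hY2 _ _).trans ?_
    have h1 : (4 * L + 1 + 2) * (3 * L + 5 + 2) ≤ (5 * L) * (4 * L) := by gcongr <;> omega
    have h2 : (5 * L) * (4 * L) = 20 * (L * L) := by ring
    have h3 := hpow (show 3 ≤ 4 by norm_num)
    have h4 : 16 * L ^ 3 ≤ L ^ 4 := by
      calc 16 * L ^ 3 ≤ L * L ^ 3 := by gcongr; omega
        _ = L ^ 4 := by ring
    omega
  have hZval : (vec fun j => draw (shiftRange p Rhat).val.1 (shiftRange p Rhat).val.2 (Z j)).val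
      = Z := rfl
  have hY1val : (vec fun i => do
      let s ← Timed.sum fun j => mul (X i j) (Z j)
      add (Y i) s).val = shifted Y X Z := by
    funext i
    simp only [vec_val, bind_val, sum_val, mul, add, shifted]
  have hY2val : (vec fun i => do
      let a ← Timed.abs (shifted Y X Z i)
      if ← lt a 3 then copy 3 else copy (shifted Y X Z i)).val = Y₂ := by
    funext i
    simp only [vec_val, bind_val, Timed.abs, lt, hY₂, lifted, decide_eq_true_eq]
    split_ifs <;> rfl
  have hAval : (basis m X Y₂).val = A := rfl
  refine ⟨b, 15 * L + 12, (run fuel Y X Rhat What Z).cost, ?_, ⟨fuel, ?_⟩, hinv⟩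
  · rw [run_eq]
    simp only [bind_cost, hZval, hY1val, hY2val, hAval, lv, ← hmdef]
    have h85 : (LLL.lll fuel A).cost ≤ L ^ 85 := by
      refine lc.trans (le_of_eq ?_)
      rw [← pow_mul]
    have h3 := hpow (show 3 ≤ 85 by norm_num)
    have h5 := hpow (show 5 ≤ 85 by norm_num)
    have h7 := hpow (show 7 ≤ 85 by norm_num)
    have h8 := hpow (show 8 ≤ 85 by norm_num)
    have h10 := hpow (show 10 ≤ 85 by norm_num)
    have h86 : 16 * L ^ 85 ≤ L ^ 86 := by
      calc 16 * L ^ 85 ≤ L * L ^ 85 := by gcongr; omega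
        _ = L ^ 86 := by ring
    omega
  · have hval : (run fuel Y X Rhat What Z).val = some (output (firstBlock b) Z) := by
      rw [run_eq]
      simp only [bind_val, hZval, hY1val, hY2val, hAval, lv, ← hmdef]
      exact finish_val b Z
    rw [← hval]

end ELO

/-! ### Recovery outside of the exceptional events -/

namespace ELO

open Timed

variable {n p : ℕ}

/-- The algorithm divides a nonzero multiple of a positive primitive vector by the multiplier. -/
theorem signedGcd_mul {y : Fin p → ℤ} (hp : 0 < p) (hy : ∀ j, 0 < y j)
    (hprim : ∀ q : ℕ, 2 ≤ q → ∃ j, ¬ (q : ℤ) ∣ y j) {t : ℤ} (ht : t ≠ 0) :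
    signedGcd (fun j => t * y j) = t := by
  have hgcd : (gcdVec fun j => t * y j).val = t.natAbs := by
    obtain ⟨s, hs⟩ := (dvd_gcdVec_iff t.natAbs fun j => t * y j).2 fun j => by
      rw [Int.natAbs_mul]
      exact dvd_mul_right _ _
    have h1 := (dvd_gcdVec_iff (gcdVec fun j => t * y j).val fun j => t * y j).1 dvd_rfl
    have hs1 (j : Fin p) : (s : ℤ) ∣ y j := by
      have h2 := h1 j
      rw [hs, Int.natAbs_mul] at h2
      exact Int.natCast_dvd.2 (Nat.dvd_of_mul_dvd_mul_left (Int.natAbs_pos.2 ht) h2)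
    have hs2 : s < 2 := by
      by_contra hcon
      obtain ⟨j, hj⟩ := hprim s (not_lt.1 hcon)
      exact hj (hs1 j)
    have hs3 : s ≠ 0 := by
      rintro rfl
      have := hs1 ⟨0, hp⟩
      simp only [Nat.cast_zero, zero_dvd_iff] at this
      exact (hy _).ne' this
    rw [hs, show s = 1 by omega, mul_one]
  have hpos : 0 < ∑ j, y j := Finset.sum_pos (fun j _ => hy j) ⟨⟨0, hp⟩, Finset.mem_univ _⟩
  rw [signedGcd, ← Finset.mul_sum, hgcd]
  rcases lt_or_gt_of_ne ht with h | h
  · rw [if_pos (mul_neg_of_neg_of_pos h hpos), Int.natCast_natAbs, abs_of_neg h, neg_neg]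
  · rw [if_neg (not_lt.2 (mul_pos h hpos).le), Int.natCast_natAbs, abs_of_pos h]

theorem output_mul {β Z : Fin p → ℤ} (hp : 0 < p) (hy : ∀ j, 0 < β j + Z j)
    (hprim : ∀ q : ℕ, 2 ≤ q → ∃ j, ¬ (q : ℤ) ∣ β j + Z j) {t : ℤ} (ht : t ≠ 0) :
    output (fun j => t * (β j + Z j)) Z = β := by
  rw [output, signedGcd_mul hp hy hprim ht, if_neg ht]
  funext j
  rw [Int.mul_ediv_cancel_left _ ht, add_sub_cancel_right]

/-- Coordinates of a vector of the lattice. -/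
theorem exists_coefficients {m : ℤ} {X : Matrix (Fin n) (Fin p) ℤ} {Y₂ : Fin n → ℤ}
    {x : Fin (n + (p + n)) → ℤ}
    (hx : x ∈ AddSubgroup.closure (Set.range (columns m X Y₂))) :
    ∃ (β : Fin p → ℤ) (e w : Fin n → ℤ),
      (∀ i, x (Fin.castAdd (p + n) i) = m * ((∑ j, X i j * β j) - Y₂ i * e i + w i)) ∧
      (∀ j, x (Fin.natAdd n (Fin.castAdd n j)) = β j) ∧
      ∀ i, x (Fin.natAdd n (Fin.natAdd p i)) = w i := by
  rw [← Submodule.span_int_eq_addSubgroupClosure] at hx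
  obtain ⟨t, rfl⟩ := (Submodule.mem_span_range_iff_exists_fun ℤ).1
    (show x ∈ Submodule.span ℤ (Set.range (columns m X Y₂)) from hx)
  refine ⟨fun j => t (Fin.castAdd (n + n) j), fun i => t (Fin.natAdd p (Fin.castAdd n i)),
    fun i => t (Fin.natAdd p (Fin.natAdd n i)), fun i => ?_, fun j => ?_, fun i => ?_⟩
  · have := combination_top m X Y₂ t i
    simpa using this
  · have := combination_middle m X Y₂ t j
    simpa using this
  · have := combination_bottom m X Y₂ t i
    simpa using this

theorem mem_closure_columns {m : ℤ} {X : Matrix (Fin n) (Fin p) ℤ} {Y₂ : Fin n → ℤ}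
    (t : Fin (p + (n + n)) → ℤ) :
    (fun r => ∑ c, t c * columns m X Y₂ c r) ∈
      AddSubgroup.closure (Set.range (columns m X Y₂)) := by
  have h : (fun r => ∑ c, t c * columns m X Y₂ c r) = ∑ c, t c • columns m X Y₂ c := by
    funext r
    simp
  rw [h]
  exact sum_mem fun c _ => zsmul_mem (AddSubgroup.subset_closure (Set.mem_range_self c)) _

/-- The vector `(0, β, w)` belongs to the lattice if `X β + w = Y₂`. -/
theorem exists_mem_closure {m : ℤ} {X : Matrix (Fin n) (Fin p) ℤ} {Y₂ w : Fin n → ℤ}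
    {β : Fin p → ℤ} (h : ∀ i, (∑ j, X i j * β j) + w i = Y₂ i) :
    ∃ x ∈ AddSubgroup.closure (Set.range (columns m X Y₂)),
      (∀ j, x (Fin.natAdd n (Fin.castAdd n j)) = β j) ∧
      ∑ r, x r ^ 2 = ∑ j, β j ^ 2 + ∑ i, w i ^ 2 := by
  set t : Fin (p + (n + n)) → ℤ := Fin.append β (Fin.append (fun _ => 1) w) with ht
  have t1 (j : Fin p) : t (Fin.castAdd (n + n) j) = β j := by simp [ht]
  have t2 (i : Fin n) : t (Fin.natAdd p (Fin.castAdd n i)) = 1 := by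
    rw [ht, Fin.append_right, Fin.append_left]
  have t3 (i : Fin n) : t (Fin.natAdd p (Fin.natAdd n i)) = w i := by
    rw [ht, Fin.append_right, Fin.append_right]
  have x1 (i : Fin n) : ∑ c, t c * columns m X Y₂ c (Fin.castAdd (p + n) i) = 0 := by
    have h1 := combination_top m X Y₂ t i
    simp only [Int.cast_id, t1, t2, t3] at h1
    rw [h1, ← h i]
    ring
  have x2 (j : Fin p) : ∑ c, t c * columns m X Y₂ c (Fin.natAdd n (Fin.castAdd n j)) = β j := by
    have h1 := combination_middle m X Y₂ t j
    simpa only [Int.cast_id, t1] using h1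
  have x3 (i : Fin n) : ∑ c, t c * columns m X Y₂ c (Fin.natAdd n (Fin.natAdd p i)) = w i := by
    have h1 := combination_bottom m X Y₂ t i
    simpa only [Int.cast_id, t3] using h1
  refine ⟨_, mem_closure_columns t, x2, ?_⟩
  rw [sum_blocks]
  simp [x1, x2, x3]

/-- The algorithm recovers `β` if the shifted response is large and the relations of small height
between the rows of `X` are trivial. -/
theorem output_eq {X : Matrix (Fin n) (Fin p) ℤ} {β Z : Fin p → ℤ} {W : Fin n → ℤ} {m : ℤ}
    {b : Fin (p + (n + n)) → Fin (n + (p + n)) → ℤ} {S M E : ℕ} {T τ : ℝ}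
    (hn : 0 < n) (hp : 0 < p) (hm : 0 < m)
    (hy : ∀ i, 3 ≤ |(∑ j, X i j * (β j + Z j)) + W i|)
    (hτ : ∀ i, τ ≤ |(((∑ j, X i j * (β j + Z j)) + W i : ℤ) : ℝ)|)
    (hinv : LLL.Inv (columns m X fun i => lifted ((∑ j, X i j * (β j + Z j)) + W i)) b S
      (p + (n + n)))
    (hpos : ∀ j, 0 < β j + Z j)
    (hprim : ∀ q : ℕ, 2 ≤ q → ∃ j, ¬ (q : ℤ) ∣ β j + Z j)
    (hM : (2 : ℝ) ^ (p + (n + n) - 1) * ((∑ j, (β j + Z j) ^ 2 + ∑ i, W i ^ 2 : ℤ) : ℝ)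
      < ((M : ℝ) + 1) ^ 2)
    (hMm : (M : ℤ) < m)
    (hT : ∀ i j, |(X i j : ℝ)| ≤ T)
    (hE : p * (T * M) + M ≤ E * τ) (hτ0 : 0 < τ)
    (hW : ∀ i, (M : ℝ) * (|(W i : ℝ)| + 1) < τ)
    (hrel : ∀ (x : Fin p → ℤ) (e w : Fin n → ℤ), (∀ j, |x j| ≤ M) → (∀ i, |e i| ≤ E) →
      (∀ i, |w i| ≤ M) → ∃ i, (∀ j, x j = e i * (β j + Z j)) ∨
        ∑ j, X i j * (x j - e i * (β j + Z j)) ≠ e i * W i - w i) :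
    output (firstBlock b) Z = β := by
  set y : Fin n → ℤ := fun i => (∑ j, X i j * (β j + Z j)) + W i with hydef
  have hlift : (fun i => lifted (y i)) = y := funext fun i => lifted_of_le (hy i)
  rw [show (fun i => lifted ((∑ j, X i j * (β j + Z j)) + W i)) = y from hlift] at hinv
  have hd : 0 < p + (n + n) := by omega
  -- the first basis vector is short
  obtain ⟨x, hx, hxβ, hxnorm⟩ := exists_mem_closure (m := m) (X := X) (Y₂ := y) (w := W)
    (β := fun j => β j + Z j) fun i => rfl
  have hx0 : x ≠ 0 := by
    rintro rfl
    have := hxβ ⟨0, hp⟩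
    simp only [Pi.zero_apply] at this
    exact (hpos ⟨0, hp⟩).ne this
  have hshort := hinv.first_le hd hx hx0
  rw [LLL.norm_sq_emb, hxnorm] at hshort
  -- an integer whose square is below `(M + 1) ^ 2` is at most `M`
  have hcoord (r) : |b ⟨0, hd⟩ r| ≤ M := by
    have h1 := hshort.trans_lt hM
    rw [LLL.embList, LLL.norm_sq_emb] at h1
    have h2 : ∑ c, b ⟨0, hd⟩ c ^ 2 < ((M : ℤ) + 1) ^ 2 := by exact_mod_cast h1
    have h3 : b ⟨0, hd⟩ r ^ 2 ≤ ∑ c, b ⟨0, hd⟩ c ^ 2 :=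
      Finset.single_le_sum (f := fun c => b ⟨0, hd⟩ c ^ 2) (fun _ _ => sq_nonneg _)
        (Finset.mem_univ r)
    have h4 := abs_lt_of_sq_lt_sq (h3.trans_lt h2) (by positivity)
    exact Int.lt_add_one_iff.1 h4
  have hmem : b ⟨0, hd⟩ ∈ AddSubgroup.closure (Set.range (columns m X y)) := by
    rw [← hinv.closure_eq]
    exact AddSubgroup.subset_closure (Set.mem_range_self _)
  obtain ⟨x', e, w, h1, h2, h3⟩ := exists_coefficients hmem
  have hx' (j) : |x' j| ≤ M := h2 j ▸ hcoord _
  have hw (i) : |w i| ≤ M := h3 i ▸ hcoord _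
  -- the first block vanishes, since its entries are multiples of `m > M`
  have htop (i) : (∑ j, X i j * x' j) + w i = y i * e i := by
    have h4 := (hcoord (Fin.castAdd (p + n) i)).trans_lt hMm
    rw [h1, abs_mul, abs_of_pos hm] at h4
    have h5 : |∑ j, X i j * x' j - y i * e i + w i| < 1 := by
      by_contra hcon
      nlinarith [not_lt.1 hcon]
    have h6 := Int.abs_lt_one_iff.1 h5
    linarith
  have he (i) : |e i| ≤ E := by
    have h4 : |(y i * e i : ℝ)| ≤ p * (T * M) + M := by
      have h5 : (y i * e i : ℝ) = (∑ j, (X i j : ℝ) * x' j) + w i := by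
        have := htop i
        rw [← Int.cast_mul, ← this]
        push_cast
        rfl
      rw [h5]
      refine (abs_add_le _ _).trans (add_le_add ?_ (by exact_mod_cast hw i))
      calc |∑ j, (X i j : ℝ) * x' j| ≤ ∑ j, |(X i j : ℝ) * x' j| := Finset.abs_sum_le_sum_abs _ _
        _ ≤ ∑ _j : Fin p, T * M := Finset.sum_le_sum fun j _ => by
          rw [abs_mul]
          have : |(x' j : ℝ)| ≤ M := by exact_mod_cast hx' j
          exact mul_le_mul (hT i j) this (abs_nonneg _) ((abs_nonneg _).trans (hT i j))
        _ = p * (T * M) := by simp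
    have h6 : |(e i : ℝ)| * τ ≤ E * τ := by
      calc |(e i : ℝ)| * τ ≤ |(e i : ℝ)| * |(y i : ℝ)| :=
            mul_le_mul_of_nonneg_left (hτ i) (abs_nonneg _)
        _ = |(y i * e i : ℝ)| := by rw [abs_mul, mul_comm]
        _ ≤ E * τ := h4.trans hE
    have h7 := le_of_mul_le_mul_right h6 hτ0
    exact_mod_cast h7
  obtain ⟨i₀, hi₀⟩ := hrel x' e w hx' he hw
  have hrow (i) (t : ℤ) : ∑ j, X i j * (x' j - t * (β j + Z j))
      = (y i * e i - w i) - t * (y i - W i) := by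
    have h4 : y i - W i = ∑ j, X i j * (β j + Z j) := by rw [hydef]; ring
    rw [h4, ← htop i, Finset.mul_sum, add_sub_cancel_right, ← Finset.sum_sub_distrib]
    exact Finset.sum_congr rfl fun j _ => by ring
  have hmul : ∀ j, x' j = e i₀ * (β j + Z j) := by
    refine hi₀.resolve_right fun hcon => hcon ?_
    rw [hrow]
    ring
  set t := e i₀ with ht
  have htM : |t| ≤ M := by
    refine le_trans ?_ (hx' ⟨0, hp⟩)
    rw [hmul, abs_mul]
    exact le_mul_of_one_le_right (abs_nonneg _) (Int.one_le_abs (hpos _).ne')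
  -- the other rows have the same multiplier, since the shifted response is large
  have het (i) : e i = t := by
    by_contra hne
    have h4 : (e i - t) * y i = w i - t * W i := by
      have h5 := hrow i t
      have h6 : ∑ j, X i j * (x' j - t * (β j + Z j)) = 0 :=
        Finset.sum_eq_zero fun j _ => by rw [hmul j, sub_self, mul_zero]
      rw [h6] at h5
      linarith
    have h5 : |y i| ≤ M * (|W i| + 1) := by
      calc |y i| ≤ |e i - t| * |y i| :=
            le_mul_of_one_le_left (abs_nonneg _) (Int.one_le_abs (sub_ne_zero.2 hne))
        _ = |w i - t * W i| := by rw [← abs_mul, h4]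
        _ ≤ |w i| + |t| * |W i| := by
          rw [← abs_mul]
          exact abs_sub _ _
        _ ≤ M + M * |W i| :=
          add_le_add (hw i) (mul_le_mul_of_nonneg_right htM (abs_nonneg _))
        _ = M * (|W i| + 1) := by ring
    have h6 : |(y i : ℝ)| ≤ M * (|(W i : ℝ)| + 1) := by exact_mod_cast h5
    exact absurd (hτ i) (not_le.2 (h6.trans_lt (hW i)))
  -- a vanishing multiplier would make the first basis vector zero
  have ht0 : t ≠ 0 := by
    intro h0
    have hw0 (i) : w i = 0 := by
      have h5 := hrow i t
      have h6 : ∑ j, X i j * (x' j - t * (β j + Z j)) = 0 :=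
        Finset.sum_eq_zero fun j _ => by rw [hmul j, sub_self, mul_zero]
      rw [h6, het i, h0] at h5
      linarith
    have hb0 : b ⟨0, hd⟩ = 0 := by
      funext r
      refine Fin.addCases (fun i => ?_) (fun r => Fin.addCases (fun j => ?_) (fun i => ?_) r) r
      · have h4 : ∑ j, X i j * x' j - y i * e i + w i = 0 := by linarith [htop i]
        rw [h1, h4, mul_zero, Pi.zero_apply]
      · rw [h2, hmul j, h0]
        simp
      · rw [h3, hw0]
        simp
    have h4 := hinv.size.pos 0
    have h5 := GS.gsq_le_norm_sq (LLL.embList b) ⟨0, hd⟩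
    rw [LLL.embList, hb0, map_zero, norm_zero] at h5
    simp only at h5
    norm_num at h5
    linarith
  have hfirst : firstBlock b = fun j => t * (β j + Z j) := by
    funext j
    rw [firstBlock, dif_pos hd, h2, hmul]
  rw [hfirst]
  exact output_mul hp hpos hprim ht0

end ELO

/-! ### Probability estimates for the design matrix -/

namespace ELO

variable {n p : ℕ}

/-- The law of the design matrix: independent entries with distribution `D`. -/
noncomputable def designLaw (n p : ℕ) (D : Measure ℤ) : Measure (Fin n → Fin p → ℤ) :=
  Measure.pi fun _ => Measure.pi fun _ => D

instance (D : Measure ℤ) [IsProbabilityMeasure D] : IsProbabilityMeasure (designLaw n p D) := by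
  unfold designLaw
  infer_instance

theorem aemeasurable_joint {Ω : Type*} {_ : MeasurableSpace Ω} {P : Measure Ω}
    {X : Ω → Matrix (Fin n) (Fin p) ℤ} {Z : Ω → Fin p → ℤ} {D U : Measure ℤ}
    (hX : ∀ i j, HasLaw (fun ω => X ω i j) D P) (hZ : ∀ j, HasLaw (fun ω => Z ω j) U P) :
    AEMeasurable (fun ω => ((fun i j => X ω i j, Z ω) : (Fin n → Fin p → ℤ) × (Fin p → ℤ))) P :=
  (aemeasurable_pi_lambda _ fun i => aemeasurable_pi_lambda _ fun j => (hX i j).aemeasurable).prodMk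
    (aemeasurable_pi_lambda _ fun j => (hZ j).aemeasurable)

/-- Independence determines the joint law of the design matrix and the random shift. -/
theorem joint_law {Ω : Type*} {_ : MeasurableSpace Ω} {P : Measure Ω} [IsProbabilityMeasure P]
    {X : Ω → Matrix (Fin n) (Fin p) ℤ} {Z : Ω → Fin p → ℤ} {D U : Measure ℤ}
    [IsProbabilityMeasure D] [IsProbabilityMeasure U]
    (hX : ∀ i j, HasLaw (fun ω => X ω i j) D P) (hZ : ∀ j, HasLaw (fun ω => Z ω j) U P)
    (hind : iIndepFun
      (Sum.elim (fun (ij : Fin n × Fin p) ω => X ω ij.1 ij.2) (fun j ω => Z ω j)) P) :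
    P.map (fun ω => ((fun i j => X ω i j, Z ω) : (Fin n → Fin p → ℤ) × (Fin p → ℤ)))
      = (designLaw n p D).prod (Measure.pi fun _ => U) := by
  -- both measures live on a countable discrete space
  refine Measure.ext_of_singleton fun ⟨x, z⟩ => ?_
  rw [Measure.map_apply_of_aemeasurable (aemeasurable_joint hX hZ) (measurableSet_singleton _),
    ← Set.singleton_prod_singleton, Measure.prod_prod, designLaw, Measure.pi_singleton,
    Measure.pi_singleton]
  simp only [Measure.pi_singleton]
  have h := hind.measure_inter_preimage_eq_mul Finset.univ
    (sets := Sum.elim (fun ij : Fin n × Fin p => {x ij.1 ij.2}) fun j => {z j})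
    (by rintro (i | i) _ <;> exact measurableSet_singleton _)
  rw [Fintype.prod_sum_type, Fintype.prod_prod_type] at h
  simp only [Sum.elim_inl, Sum.elim_inr] at h
  have hset : (fun ω => ((fun i j => X ω i j, Z ω) : (Fin n → Fin p → ℤ) × (Fin p → ℤ))) ⁻¹'
      ({x} ×ˢ {z}) = ⋂ i ∈ (Finset.univ : Finset ((Fin n × Fin p) ⊕ Fin p)),
      (Sum.elim (fun (ij : Fin n × Fin p) ω => X ω ij.1 ij.2) (fun j ω => Z ω j) i) ⁻¹'
        (Sum.elim (fun ij : Fin n × Fin p => {x ij.1 ij.2}) (fun j => {z j}) i) := by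
    ext ω
    simp [funext_iff]
  rw [hset, h]
  congr 1
  · refine Finset.prod_congr rfl fun i _ => Finset.prod_congr rfl fun j _ => ?_
    rw [← (hX i j).map_eq, Measure.map_apply_of_aemeasurable (hX i j).aemeasurable
      (measurableSet_singleton _)]
  · refine Finset.prod_congr rfl fun j _ => ?_
    rw [← (hZ j).map_eq, Measure.map_apply_of_aemeasurable (hZ j).aemeasurable
      (measurableSet_singleton _)]

/-- A bound for all sections gives a bound for the product measure. -/
theorem prod_real_le_of_section {α β : Type*} [MeasurableSpace α] [MeasurableSpace β]
    (μ : Measure α) (ν : Measure β) [IsProbabilityMeasure μ] [IsProbabilityMeasure ν]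
    {s : Set (α × β)} (hs : MeasurableSet s) {ε : ℝ} (hε : 0 ≤ ε)
    (h : ∀ y, μ.real {x | (x, y) ∈ s} ≤ ε) : (μ.prod ν).real s ≤ ε := by
  rw [measureReal_def, Measure.prod_apply_symm hs]
  refine ENNReal.toReal_le_of_le_ofReal hε ?_
  calc ∫⁻ y, μ ((fun x => (x, y)) ⁻¹' s) ∂ν ≤ ∫⁻ _y, ENNReal.ofReal ε ∂ν := by
        refine lintegral_mono fun y => ?_
        rw [← ofReal_measureReal]
        exact ENNReal.ofReal_le_ofReal (h y)
    _ = ENNReal.ofReal ε := by simp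

/-- A nontrivial linear form of independent variables has no heavier atoms than the variables: for
fixed values of the other variables, at most one value of a variable with nonzero coefficient gives
the value `t`. -/
theorem row_real_le {D : Measure ℤ} [IsProbabilityMeasure D] {δ : ℝ} (hδ : ∀ v, D.real {v} ≤ δ)
    {a : Fin p → ℤ} (ha : ∃ j, a j ≠ 0) (t : ℤ) :
    (Measure.pi fun _ : Fin p => D).real {x | ∑ j, x j * a j = t} ≤ δ := by
  obtain ⟨j, hj⟩ := ha
  obtain ⟨p, rfl⟩ : ∃ q, p = q + 1 := ⟨p - 1, by have := j.2; omega⟩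
  have hδ0 : 0 ≤ δ := measureReal_nonneg.trans (hδ 0)
  have hmp := measurePreserving_piFinSuccAbove (fun _ : Fin (p + 1) => D) j
  have hset : {x : Fin (p + 1) → ℤ | ∑ i, x i * a i = t}
      = (MeasurableEquiv.piFinSuccAbove (fun _ => ℤ) j) ⁻¹'
        {y : ℤ × (Fin p → ℤ) | y.1 * a j + ∑ i, y.2 i * a (j.succAbove i) = t} := by
    ext x
    simp only [Set.mem_ofPred_eq, Set.mem_preimage, Fin.sum_univ_succAbove _ j]
    rfl
  rw [hset, measureReal_def, hmp.measure_preimage MeasurableSet.of_discrete.nullMeasurableSet]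
  refine prod_real_le_of_section D _ MeasurableSet.of_discrete hδ0 fun y => ?_
  refine le_trans (measureReal_mono (s₂ := {(t - ∑ i, y i * a (j.succAbove i)) / a j}) ?_) (hδ _)
  intro v hv
  simp only [Set.mem_ofPred_eq] at hv
  have : t - ∑ i, y i * a (j.succAbove i) = v * a j := by rw [← hv]; ring
  rw [Set.mem_singleton_iff, this, Int.mul_ediv_cancel _ hj]

theorem design_row_real {D : Measure ℤ} [IsProbabilityMeasure D] (i : Fin n)
    (s : Set (Fin p → ℤ)) :
    (designLaw n p D).real {x | x i ∈ s} = (Measure.pi fun _ : Fin p => D).real s := by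
  have := measurePreserving_eval (fun _ : Fin n => Measure.pi fun _ : Fin p => D) i
  rw [measureReal_def, measureReal_def, designLaw,
    ← this.measure_preimage (s := s) MeasurableSet.of_discrete.nullMeasurableSet]
  rfl

theorem design_entry_real {D : Measure ℤ} [IsProbabilityMeasure D] (i : Fin n) (j : Fin p)
    (s : Set ℤ) : (designLaw n p D).real {x | x i j ∈ s} = D.real s := by
  have := measurePreserving_eval (fun _ : Fin p => D) j
  rw [show {x : Fin n → Fin p → ℤ | x i j ∈ s} = {x | x i ∈ {y : Fin p → ℤ | y j ∈ s}} from rfl,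
    design_row_real, measureReal_def, measureReal_def,
    ← this.measure_preimage (s := s) MeasurableSet.of_discrete.nullMeasurableSet]
  rfl

theorem measureReal_exists_le {α ι : Type*} [MeasurableSpace α] (μ : Measure α)
    [IsFiniteMeasure μ] (F : Finset ι) (s : ι → Set α) {ε : ι → ℝ}
    (h : ∀ i ∈ F, μ.real (s i) ≤ ε i) :
    μ.real {x | ∃ i ∈ F, x ∈ s i} ≤ ∑ i ∈ F, ε i := by
  have hset : {x | ∃ i ∈ F, x ∈ s i} = ⋃ i ∈ F, s i := by
    ext x
    simp
  rw [hset]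
  exact (measureReal_biUnion_finset_le F s).trans (Finset.sum_le_sum h)

/-- Markov's inequality for all entries. -/
theorem design_large_real_le {D : Measure ℤ} [IsProbabilityMeasure D]
    (hint : Integrable (fun v : ℤ => |(v : ℝ)|) D) {m T : ℝ} (hm : ∫ v : ℤ, |(v : ℝ)| ∂D ≤ m)
    (hT : 0 < T) :
    (designLaw n p D).real {x | ∃ i j, T < |(x i j : ℝ)|} ≤ n * p * (m / T) := by
  have h1 : D.real {v : ℤ | T ≤ |(v : ℝ)|} ≤ m / T := by
    rw [le_div_iff₀ hT, mul_comm]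
    exact (mul_meas_ge_le_integral_of_nonneg (ae_of_all _ fun v => abs_nonneg _) hint T).trans hm
  have h2 := measureReal_exists_le (designLaw n p D) (Finset.univ : Finset (Fin n × Fin p))
    (fun ij => {x | x ij.1 ij.2 ∈ {v : ℤ | T ≤ |(v : ℝ)|}}) (ε := fun _ => m / T)
    fun ij _ => by rw [design_entry_real]; exact h1
  refine (measureReal_mono ?_).trans (h2.trans (by simp))
  rintro x ⟨i, j, hx⟩
  exact ⟨(i, j), Finset.mem_univ _, hx.le⟩

/-- The linear forms of the rows are unlikely to be close to given integers. -/
theorem design_small_real_le {D : Measure ℤ} [IsProbabilityMeasure D] {δ : ℝ}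
    (hδ : ∀ v, D.real {v} ≤ δ) {a : Fin p → ℤ} (ha : ∃ j, a j ≠ 0) (W : Fin n → ℤ) {τ : ℝ}
    (hτ : 0 ≤ τ) :
    (designLaw n p D).real {x | ∃ i, |(((∑ j, x i j * a j) + W i : ℤ) : ℝ)| < τ}
      ≤ n * ((2 * τ + 1) * δ) := by
  have hδ0 : 0 ≤ δ := measureReal_nonneg.trans (hδ 0)
  have h1 (i : Fin n) : (Measure.pi fun _ : Fin p => D).real
      {y | |(((∑ j, y j * a j) + W i : ℤ) : ℝ)| < τ} ≤ (2 * τ + 1) * δ := by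
    have h2 := measureReal_exists_le (Measure.pi fun _ : Fin p => D)
      (Finset.Icc (-⌊τ⌋) ⌊τ⌋) (fun v => {y | ∑ j, y j * a j = v - W i}) (ε := fun _ => δ)
      fun v _ => row_real_le hδ ha _
    refine (measureReal_mono ?_).trans (h2.trans ?_)
    · intro y hy
      refine ⟨(∑ j, y j * a j) + W i, ?_, (add_sub_cancel_right _ _).symm⟩
      rw [Set.mem_ofPred_eq, ← Int.cast_abs] at hy
      have h3 : |(∑ j, y j * a j) + W i| ≤ ⌊τ⌋ := Int.le_floor.2 hy.le
      rw [Finset.mem_Icc]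
      exact abs_le.1 h3
    · rw [Finset.sum_const, Int.card_Icc, nsmul_eq_mul]
      refine mul_le_mul_of_nonneg_right ?_ hδ0
      have h4 : (0 : ℤ) ≤ ⌊τ⌋ := Int.floor_nonneg.2 hτ
      have h5 : (((⌊τ⌋ + 1 - -⌊τ⌋).toNat : ℤ) : ℝ) = ((⌊τ⌋ + 1 - -⌊τ⌋ : ℤ) : ℝ) := by
        rw [Int.toNat_of_nonneg (by omega)]
      have h6 := Int.floor_le τ
      rw [Int.cast_natCast] at h5
      rw [h5]
      push_cast
      linarith
  have h2 := measureReal_exists_le (designLaw n p D) (Finset.univ : Finset (Fin n))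
    (fun i => {x | x i ∈ {y : Fin p → ℤ | |(((∑ j, y j * a j) + W i : ℤ) : ℝ)| < τ}})
    (ε := fun _ => (2 * τ + 1) * δ) fun i _ => by rw [design_row_real]; exact h1 i
  refine (measureReal_mono ?_).trans (h2.trans (by simp))
  rintro x ⟨i, hx⟩
  exact ⟨i, Finset.mem_univ _, hx⟩

/-- Nontrivial relations of bounded height between the rows are unlikely.  The coefficients `u` are
common to all rows, hence the union bound over `(2 M + 1) ^ p` of them; for fixed `u` the
rows are independent, and each has its own pair `(e i, w i)`. -/
theorem design_relation_real_le {D : Measure ℤ} [IsProbabilityMeasure D] {δ : ℝ}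
    (hδ : ∀ v, D.real {v} ≤ δ) (a : Fin p → ℤ) (W : Fin n → ℤ) (M E : ℕ) :
    (designLaw n p D).real {x | ∃ (u : Fin p → ℤ) (e w : Fin n → ℤ), (∀ j, |u j| ≤ M) ∧
      (∀ i, |e i| ≤ E) ∧ (∀ i, |w i| ≤ M) ∧ ∀ i, (∃ j, u j ≠ e i * a j) ∧
        ∑ j, x i j * (u j - e i * a j) = e i * W i - w i}
      ≤ (2 * M + 1) ^ p * ((2 * E + 1) * (2 * M + 1) * δ) ^ n := by
  classical
  have hδ0 : 0 ≤ δ := measureReal_nonneg.trans (hδ 0)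
  set box : Finset (Fin p → ℤ) := Fintype.piFinset fun _ => Finset.Icc (-(M : ℤ)) M with hbox
  set pairs : Finset (ℤ × ℤ) := Finset.Icc (-(E : ℤ)) E ×ˢ Finset.Icc (-(M : ℤ)) M with hpairs
  have card_Icc (K : ℕ) : (Finset.Icc (-(K : ℤ)) K).card = 2 * K + 1 := by
    rw [Int.card_Icc]
    omega
  have hrow (u : Fin p → ℤ) (i : Fin n) : (Measure.pi fun _ : Fin p => D).real
      {y | ∃ q ∈ pairs, (∃ j, u j ≠ q.1 * a j) ∧ ∑ j, y j * (u j - q.1 * a j) = q.1 * W i - q.2}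
      ≤ (2 * E + 1) * (2 * M + 1) * δ := by
    have h1 := measureReal_exists_le (Measure.pi fun _ : Fin p => D) pairs
      (fun q => {y | (∃ j, u j ≠ q.1 * a j) ∧ ∑ j, y j * (u j - q.1 * a j) = q.1 * W i - q.2})
      (ε := fun _ => δ) fun q _ => by
        by_cases hq : ∃ j, u j ≠ q.1 * a j
        · have hq' : ∃ j, u j - q.1 * a j ≠ 0 := hq.imp fun j hj => sub_ne_zero.2 hj
          simp only [hq, true_and]
          exact row_real_le hδ hq' _
        · simp only [hq, false_and]
          simpa using hδ0
    refine h1.trans (le_of_eq ?_)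
    rw [Finset.sum_const, hpairs, Finset.card_product, card_Icc, card_Icc, nsmul_eq_mul]
    push_cast
    ring
  have hall (u : Fin p → ℤ) : (designLaw n p D).real {x | ∀ i, x i ∈
      {y : Fin p → ℤ | ∃ q ∈ pairs, (∃ j, u j ≠ q.1 * a j) ∧
        ∑ j, y j * (u j - q.1 * a j) = q.1 * W i - q.2}}
      ≤ ((2 * E + 1) * (2 * M + 1) * δ) ^ n := by
    set s : Fin n → Set (Fin p → ℤ) := fun i => {y : Fin p → ℤ | ∃ q ∈ pairs,
      (∃ j, u j ≠ q.1 * a j) ∧ ∑ j, y j * (u j - q.1 * a j) = q.1 * W i - q.2} with hs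
    have h1 : {x : Fin n → Fin p → ℤ | ∀ i, x i ∈ s i} = Set.univ.pi s := by
      ext x
      simp
    rw [h1, designLaw, measureReal_def, Measure.pi_pi, ENNReal.toReal_prod]
    calc ∏ i, ((Measure.pi fun _ : Fin p => D) (s i)).toReal
        ≤ ∏ _i : Fin n, ((2 * E + 1) * (2 * M + 1) * δ) :=
          Finset.prod_le_prod (fun i _ => ENNReal.toReal_nonneg) fun i _ => hrow u i
      _ = _ := by simp
  have h2 := measureReal_exists_le (designLaw n p D) box
    (fun u => {x | ∀ i, x i ∈ {y : Fin p → ℤ | ∃ q ∈ pairs, (∃ j, u j ≠ q.1 * a j) ∧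
        ∑ j, y j * (u j - q.1 * a j) = q.1 * W i - q.2}}) fun u _ => hall u
  refine (measureReal_mono ?_).trans (h2.trans (le_of_eq ?_))
  · rintro x ⟨u, e, w, hu, he, hw, h⟩
    refine ⟨u, ?_, fun i => ⟨(e i, w i), ?_, h i⟩⟩
    · rw [hbox, Fintype.mem_piFinset]
      exact fun j => Finset.mem_Icc.2 (abs_le.1 (hu j))
    · rw [hpairs, Finset.mem_product]
      exact ⟨Finset.mem_Icc.2 (abs_le.1 (he i)), Finset.mem_Icc.2 (abs_le.1 (hw i))⟩
  · rw [Finset.sum_const, hbox, Fintype.card_piFinset, nsmul_eq_mul]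
    simp [card_Icc]

end ELO

/-! ### Common divisors of the shifted coefficients -/

namespace ELO

variable {n p : ℕ}

theorem isProbabilityMeasure_shift {Rhat : ℕ} (hR : 0 < Rhat) :
    IsProbabilityMeasure (uniformOn (shiftSet p Rhat)) := by
  refine isProbabilityMeasure_uniformOn (Set.finite_Icc _ _) (Set.nonempty_Icc.2 ?_)
  have : (0 : ℤ) < Rhat := by exact_mod_cast hR
  have : (0 : ℤ) ≤ Nat.log 2 p := by positivity
  linarith

/-- Among `R̂ + ⌊log₂ p⌋` consecutive integers, the number of those in a residue class modulo `q`
exceeds the expected one by at most `1`. -/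
theorem shift_dvd_real_le {Rhat : ℕ} (hR : 0 < Rhat) {q : ℕ} (hq : 0 < q) (b : ℤ) :
    (uniformOn (shiftSet p Rhat)).real {z | (q : ℤ) ∣ b + z}
      ≤ 1 / q + 1 / ((Rhat : ℝ) + Nat.log 2 p) := by
  classical
  set ℓ := Nat.log 2 p with hℓ
  have hq' : (0 : ℤ) < q := by exact_mod_cast hq
  have hq0 : (0 : ℝ) < q := by exact_mod_cast hq
  have hR0 : (0 : ℝ) < Rhat := by exact_mod_cast hR
  set S : Finset ℤ := Finset.Ioc (Rhat : ℤ) (2 * Rhat + ℓ) with hS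
  have hset : shiftSet p Rhat = (S : Set ℤ) := by
    ext z
    simp only [shiftSet, hS, Finset.coe_Ioc, Set.mem_Icc, Set.mem_Ioc, Int.add_one_le_iff, hℓ]
  set F : Finset ℤ := S.filter (fun z => z ≡ -b [ZMOD q]) with hF
  have hinter : uniformOn (shiftSet p Rhat) {z | (q : ℤ) ∣ b + z}
      = uniformOn (S : Set ℤ) (F : Set ℤ) := by
    rw [hset, ← uniformOn_inter_self S.finite_toSet]
    congr 1
    ext z
    simp only [hF, Finset.coe_filter, Set.mem_inter_iff, Finset.mem_coe, Set.mem_ofPred_eq,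
      Int.modEq_iff_dvd, ← neg_add', dvd_neg]
  have hFS : S ∩ F = F := Finset.inter_eq_right.2 (Finset.filter_subset _ _)
  have hcS : (S.card : ℝ) = Rhat + ℓ := by
    rw [hS, Int.card_Ioc]
    have : ((2 * (Rhat : ℤ) + ℓ - Rhat).toNat) = Rhat + ℓ := by omega
    rw [this]
    push_cast
    rfl
  have hcF : (F.card : ℝ) ≤ (Rhat + ℓ) / q + 1 := by
    have h1 : (F.card : ℤ) = _ := Int.Ioc_filter_modEq_card (Rhat : ℤ) (2 * Rhat + ℓ) hq' (-b)
    have h2 : ((F.card : ℤ) : ℚ) ≤ ((Rhat : ℚ) + ℓ) / q + 1 := by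
      rw [h1, Int.cast_max, Int.cast_zero]
      refine max_le ?_ (by positivity)
      push_cast
      have h3 := Int.floor_le ((2 * (Rhat : ℚ) + ℓ - -(b : ℚ)) / q)
      have h4 := Int.lt_floor_add_one (((Rhat : ℚ) - -(b : ℚ)) / q)
      have h5 : (2 * (Rhat : ℚ) + ℓ - -(b : ℚ)) / q - ((Rhat : ℚ) - -(b : ℚ)) / q
          = ((Rhat : ℚ) + ℓ) / q := by ring
      linarith
    have h6 : (((F.card : ℤ) : ℚ) : ℝ) ≤ ((((Rhat : ℚ) + ℓ) / q + 1 : ℚ) : ℝ) := by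
      exact_mod_cast h2
    push_cast at h6
    exact h6
  rw [measureReal_def, hinter, uniformOn_apply_finset, hFS, ENNReal.toReal_div,
    ENNReal.toReal_natCast, ENNReal.toReal_natCast, hcS]
  have hpos : (0 : ℝ) < Rhat + ℓ := by positivity
  rw [div_le_iff₀ hpos]
  refine hcF.trans (le_of_eq ?_)
  field_simp

theorem shift_not_mem_real {Rhat : ℕ} (hR : 0 < Rhat) :
    (Measure.pi fun _ : Fin p => uniformOn (shiftSet p Rhat)).real
      {z | ∃ j, z j ∉ shiftSet p Rhat} = 0 := by
  have := isProbabilityMeasure_shift (p := p) hR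
  have h1 (j : Fin p) : (Measure.pi fun _ : Fin p => uniformOn (shiftSet p Rhat)).real
      {z | z j ∉ shiftSet p Rhat} ≤ 0 := by
    have h := measurePreserving_eval (fun _ : Fin p => uniformOn (shiftSet p Rhat)) j
    have h2 : (Measure.pi fun _ : Fin p => uniformOn (shiftSet p Rhat))
        (Function.eval j ⁻¹' (shiftSet p Rhat)ᶜ) = 0 := by
      rw [h.measure_preimage MeasurableSet.of_discrete.nullMeasurableSet]
      refine (uniformOn_eq_zero_iff (Set.finite_Icc _ _)).2 ?_
      exact Set.inter_compl_self _
    rw [measureReal_def]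
    exact le_of_eq (by rw [show {z : Fin p → ℤ | z j ∉ shiftSet p Rhat}
      = Function.eval j ⁻¹' (shiftSet p Rhat)ᶜ from rfl, h2, ENNReal.toReal_zero])
  refine le_antisymm ?_ measureReal_nonneg
  have h2 := measureReal_exists_le (Measure.pi fun _ : Fin p => uniformOn (shiftSet p Rhat))
    Finset.univ (fun j => {z | z j ∉ shiftSet p Rhat}) fun j _ => h1 j
  refine le_trans (measureReal_mono ?_) (h2.trans (by simp))
  rintro z ⟨j, hz⟩
  exact ⟨j, Finset.mem_univ _, hz⟩

/-- The shifted coefficients are unlikely to have a common divisor.  The divisor `2` gives the first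
term, and the divisors above it, which are at most `3 (R̂ + ⌊log₂ p⌋)`, the second one. -/
theorem shift_gcd_real_le {Rhat : ℕ} (hR : 0 < Rhat) (hp : 2 ≤ p) {L : ℕ}
    (hL : L = Rhat + Nat.log 2 p) (hL6 : 6 ≤ L) {b : Fin p → ℤ} (hb : ∀ j, |b j| ≤ Rhat) :
    (Measure.pi fun _ : Fin p => uniformOn (shiftSet p Rhat)).real
      {z | (∃ j, z j ∉ shiftSet p Rhat) ∨ ∃ q : ℕ, 2 ≤ q ∧ ∀ j, (q : ℤ) ∣ b j + z j}
      ≤ (1 / 2 + 1 / (L : ℝ)) ^ p + 32 * (1 / 2) ^ p := by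
  have := isProbabilityMeasure_shift (p := p) hR
  set U := uniformOn (shiftSet p Rhat) with hU
  have hLr : (L : ℝ) = Rhat + Nat.log 2 p := by rw [hL]; push_cast; rfl
  have hL6r : (6 : ℝ) ≤ L := by exact_mod_cast hL6
  have hq (q : ℕ) (hq : 0 < q) : (Measure.pi fun _ : Fin p => U).real
      {z | ∀ j, (q : ℤ) ∣ b j + z j} ≤ (1 / q + 1 / (L : ℝ)) ^ p := by
    have h1 : {z : Fin p → ℤ | ∀ j, (q : ℤ) ∣ b j + z j}
        = Set.univ.pi fun j => {z | (q : ℤ) ∣ b j + z} := by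
      ext z
      simp
    rw [h1, measureReal_def, Measure.pi_pi, ENNReal.toReal_prod]
    calc ∏ j, (U {z | (q : ℤ) ∣ b j + z}).toReal ≤ ∏ _j : Fin p, (1 / (q : ℝ) + 1 / (L : ℝ)) :=
          Finset.prod_le_prod (fun _ _ => ENNReal.toReal_nonneg) fun j _ => by
            rw [hLr]
            exact shift_dvd_real_le hR hq (b j)
      _ = _ := by simp
  have h1 := measureReal_exists_le (Measure.pi fun _ : Fin p => U) (Finset.Icc 2 (3 * L))
    (fun q => {z | ∀ j, (q : ℤ) ∣ b j + z j}) (ε := fun q : ℕ => (1 / q + 1 / (L : ℝ)) ^ p)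
    fun q h => hq q (by have := (Finset.mem_Icc.1 h).1; omega)
  have hsub : {z : Fin p → ℤ | (∃ j, z j ∉ shiftSet p Rhat) ∨
        ∃ q : ℕ, 2 ≤ q ∧ ∀ j, (q : ℤ) ∣ b j + z j}
      ⊆ {z | ∃ j, z j ∉ shiftSet p Rhat} ∪
        {z | ∃ q ∈ Finset.Icc 2 (3 * L), z ∈ {z | ∀ j, (q : ℤ) ∣ b j + z j}} := by
    intro z hz
    by_cases hmem : ∃ j, z j ∉ shiftSet p Rhat
    · exact Or.inl hmem
    · obtain ⟨q, hq2, hdvd⟩ := hz.resolve_left hmem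
      refine Or.inr ⟨q, Finset.mem_Icc.2 ⟨hq2, ?_⟩, hdvd⟩
      push Not at hmem
      have h2 := hmem ⟨0, by omega⟩
      have h3 := abs_le.1 (hb ⟨0, by omega⟩)
      have h4 := hdvd ⟨0, by omega⟩
      simp only [shiftSet, Set.mem_Icc] at h2
      have h5 := Int.le_of_dvd (by omega) h4
      omega
  refine (measureReal_mono hsub).trans ((measureReal_union_le _ _).trans ?_)
  rw [shift_not_mem_real hR, zero_add]
  refine h1.trans ?_
  have h2 : Finset.Icc 2 (3 * L) = insert 2 (Finset.Ioc 2 (3 * L)) := by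
    rw [Finset.Ioc_insert_left (by omega)]
  rw [h2, Finset.sum_insert (by simp)]
  refine add_le_add (by norm_num) ?_
  have h3 : ∀ q ∈ Finset.Ioc 2 (3 * L),
      (1 / (q : ℝ) + 1 / (L : ℝ)) ^ p ≤ 64 * (1 / 2) ^ p * ((q : ℝ) ^ 2)⁻¹ := by
    intro q hqm
    obtain ⟨hq3, hqL⟩ := Finset.mem_Ioc.1 hqm
    have hq3r : (3 : ℝ) ≤ q := by exact_mod_cast hq3
    have hqLr : (q : ℝ) ≤ 3 * L := by exact_mod_cast hqL
    have h4 : 1 / (q : ℝ) + 1 / (L : ℝ) ≤ 4 / q := by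
      have : 1 / (L : ℝ) ≤ 3 / q := by
        rw [div_le_div_iff₀ (by linarith) (by linarith)]
        linarith
      calc 1 / (q : ℝ) + 1 / (L : ℝ) ≤ 1 / q + 3 / q := by linarith
        _ = 4 / q := by ring
    have h5 : 1 / (q : ℝ) + 1 / (L : ℝ) ≤ 1 / 2 := by
      have h6 : 1 / (q : ℝ) ≤ 1 / 3 := one_div_le_one_div_of_le (by norm_num) hq3r
      have h7 : 1 / (L : ℝ) ≤ 1 / 6 := one_div_le_one_div_of_le (by norm_num) hL6r
      linarith
    have h0 : 0 ≤ 1 / (q : ℝ) + 1 / (L : ℝ) := by positivity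
    -- two factors make the sum over `q` converge, the other ones are at most `1 / 2`
    calc (1 / (q : ℝ) + 1 / (L : ℝ)) ^ p
        = (1 / (q : ℝ) + 1 / (L : ℝ)) ^ 2 * (1 / (q : ℝ) + 1 / (L : ℝ)) ^ (p - 2) := by
          rw [← pow_add]; congr 1; omega
      _ ≤ (4 / q) ^ 2 * (1 / 2) ^ (p - 2) := by gcongr
      _ = 64 * (1 / 2) ^ p * ((q : ℝ) ^ 2)⁻¹ := by
          have : ((1 : ℝ) / 2) ^ p = (1 / 2) ^ (p - 2) * (1 / 2) ^ 2 := by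
            rw [← pow_add]; congr 1; omega
          rw [this]
          field_simp
          ring
  refine (Finset.sum_le_sum h3).trans ?_
  rw [← Finset.mul_sum]
  have h4 : ∑ q ∈ Finset.Ioc 2 (3 * L), ((q : ℝ) ^ 2)⁻¹ ≤ 1 / 2 := by
    refine (sum_Ioc_inv_sq_le_sub (by norm_num) (by omega)).trans ?_
    have : (0 : ℝ) ≤ ((3 * L : ℕ) : ℝ)⁻¹ := by positivity
    norm_num at this ⊢
  calc 64 * ((1 : ℝ) / 2) ^ p * ∑ q ∈ Finset.Ioc 2 (3 * L), ((q : ℝ) ^ 2)⁻¹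
      ≤ 64 * ((1 : ℝ) / 2) ^ p * (1 / 2) := by gcongr
    _ = 32 * (1 / 2) ^ p := by ring

end ELO

/-! ### The exceptional event -/

namespace ELO

variable {n p : ℕ}

/-- An event that contains all `ω` with moderate entries of `X`, large shifted responses, coprime
shifted coefficients, and no short relation that comes from a vector other than a multiple of the
hidden one, has large probability. -/
theorem one_sub_le_measureReal_of_generic {Ω : Type*} {_ : MeasurableSpace Ω} {P : Measure Ω}
    [IsProbabilityMeasure P] {X : Ω → Matrix (Fin n) (Fin p) ℤ} {Z : Ω → Fin p → ℤ} {D : Measure ℤ}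
    [IsProbabilityMeasure D] {Rhat : ℕ} (hR : 0 < Rhat) (hp : 2 ≤ p)
    (hX : ∀ i j, HasLaw (fun ω => X ω i j) D P)
    (hZ : ∀ j, HasLaw (fun ω => Z ω j) (uniformOn (shiftSet p Rhat)) P)
    (hind : iIndepFun
      (Sum.elim (fun (ij : Fin n × Fin p) ω => X ω ij.1 ij.2) (fun j ω => Z ω j)) P)
    (hint : Integrable (fun v : ℤ => |(v : ℝ)|) D) {μ T : ℝ} (hμ : ∫ v : ℤ, |(v : ℝ)| ∂D ≤ μ)
    (hT : 0 < T) {δ : ℝ} (hδ : ∀ v, D.real {v} ≤ δ) {τ : ℝ} (hτ : 0 ≤ τ) {L : ℕ}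
    (hL : L = Rhat + Nat.log 2 p) (hL6 : 6 ≤ L) {β : Fin p → ℤ} (hβ : ∀ j, |β j| ≤ Rhat)
    (W : Fin n → ℤ) (M E : ℕ) {A : Set Ω}
    (hA : ∀ ω, (∀ i j, |(X ω i j : ℝ)| ≤ T) →
      (∀ i, τ ≤ |(((∑ j, X ω i j * (β j + Z ω j)) + W i : ℤ) : ℝ)|) →
      (∀ j, Z ω j ∈ shiftSet p Rhat) → (∀ q : ℕ, 2 ≤ q → ∃ j, ¬ (q : ℤ) ∣ β j + Z ω j) →
      (∀ (x : Fin p → ℤ) (e w : Fin n → ℤ), (∀ j, |x j| ≤ M) → (∀ i, |e i| ≤ E) →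
        (∀ i, |w i| ≤ M) → ∃ i, (∀ j, x j = e i * (β j + Z ω j)) ∨
          ∑ j, X ω i j * (x j - e i * (β j + Z ω j)) ≠ e i * W i - w i) → ω ∈ A) :
    1 - (n * p * (μ / T) + n * ((2 * τ + 1) * δ)
        + (2 * M + 1) ^ p * ((2 * E + 1) * (2 * M + 1) * δ) ^ n
        + ((1 / 2 + 1 / (L : ℝ)) ^ p + 32 * (1 / 2) ^ p)) ≤ P.real A := by
  have := isProbabilityMeasure_shift (p := p) hR
  set U := uniformOn (shiftSet p Rhat) with hU
  set ν := (designLaw n p D).prod (Measure.pi fun _ : Fin p => U) with hν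
  have hδ0 : 0 ≤ δ := measureReal_nonneg.trans (hδ 0)
  have hμ0 : 0 ≤ μ := (integral_nonneg fun v => abs_nonneg _).trans hμ
  set B₁ : Set ((Fin n → Fin p → ℤ) × (Fin p → ℤ)) :=
    {y | ∃ i j, T < |(y.1 i j : ℝ)|} with hB₁
  set B₂ : Set ((Fin n → Fin p → ℤ) × (Fin p → ℤ)) :=
    {y | (∃ j, β j + y.2 j ≠ 0) ∧
      ∃ i, |(((∑ j, y.1 i j * (β j + y.2 j)) + W i : ℤ) : ℝ)| < τ} with hB₂
  set B₃ : Set ((Fin n → Fin p → ℤ) × (Fin p → ℤ)) :=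
    {y | ∃ (u : Fin p → ℤ) (e w : Fin n → ℤ), (∀ j, |u j| ≤ M) ∧
      (∀ i, |e i| ≤ E) ∧ (∀ i, |w i| ≤ M) ∧ ∀ i, (∃ j, u j ≠ e i * (β j + y.2 j)) ∧
        ∑ j, y.1 i j * (u j - e i * (β j + y.2 j)) = e i * W i - w i} with hB₃
  set B₄ : Set ((Fin n → Fin p → ℤ) × (Fin p → ℤ)) :=
    {y | (∃ j, y.2 j ∉ shiftSet p Rhat) ∨ ∃ q : ℕ, 2 ≤ q ∧ ∀ j, (q : ℤ) ∣ β j + y.2 j} with hB₄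
  have h1 : ν.real B₁ ≤ n * p * (μ / T) :=
    prod_real_le_of_section _ _ MeasurableSet.of_discrete (by positivity) fun _ =>
      design_large_real_le hint hμ hT
  have h2 : ν.real B₂ ≤ n * ((2 * τ + 1) * δ) := by
    refine prod_real_le_of_section _ _ MeasurableSet.of_discrete (by positivity) fun z => ?_
    by_cases hz : ∃ j, β j + z j ≠ 0
    · refine le_trans (measureReal_mono ?_) (design_small_real_le hδ hz W hτ)
      exact fun x hx => hx.2
    · have : {x : Fin n → Fin p → ℤ | (x, z) ∈ B₂} = ∅ :=
        Set.eq_empty_of_forall_notMem fun x hx => hz hx.1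
      rw [this, measureReal_empty]
      positivity
  have h3 : ν.real B₃ ≤ (2 * M + 1) ^ p * ((2 * E + 1) * (2 * M + 1) * δ) ^ n :=
    prod_real_le_of_section _ _ MeasurableSet.of_discrete (by positivity) fun z =>
      design_relation_real_le hδ (fun j => β j + z j) W M E
  have h4 : ν.real B₄ ≤ (1 / 2 + 1 / (L : ℝ)) ^ p + 32 * (1 / 2) ^ p := by
    have hB₄' : B₄ = Prod.snd ⁻¹' {z : Fin p → ℤ | (∃ j, z j ∉ shiftSet p Rhat) ∨
      ∃ q : ℕ, 2 ≤ q ∧ ∀ j, (q : ℤ) ∣ β j + z j} := rfl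
    rw [hB₄', measureReal_def, measurePreserving_snd.measure_preimage
      MeasurableSet.of_discrete.nullMeasurableSet]
    exact shift_gcd_real_le hR hp hL hL6 hβ
  have hbad : ν.real (B₁ ∪ B₂ ∪ B₃ ∪ B₄) ≤ n * p * (μ / T) + n * ((2 * τ + 1) * δ)
        + (2 * M + 1) ^ p * ((2 * E + 1) * (2 * M + 1) * δ) ^ n
        + ((1 / 2 + 1 / (L : ℝ)) ^ p + 32 * (1 / 2) ^ p) := by
    refine (measureReal_union_le _ _).trans (add_le_add ?_ h4)
    refine (measureReal_union_le _ _).trans (add_le_add ?_ h3)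
    exact (measureReal_union_le _ _).trans (add_le_add h1 h2)
  have hgood : 1 - ν.real (B₁ ∪ B₂ ∪ B₃ ∪ B₄) = ν.real (B₁ ∪ B₂ ∪ B₃ ∪ B₄)ᶜ := by
    rw [probReal_compl_eq_one_sub MeasurableSet.of_discrete]
  have htransfer : ν.real (B₁ ∪ B₂ ∪ B₃ ∪ B₄)ᶜ ≤ P.real A := by
    rw [hν, ← joint_law hX hZ hind, measureReal_def, Measure.map_apply_of_aemeasurable
      (aemeasurable_joint hX hZ) MeasurableSet.of_discrete]
    refine measureReal_mono (μ := P) fun ω hω => ?_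
    simp only [Set.mem_preimage, Set.mem_compl_iff, Set.mem_union, not_or] at hω
    obtain ⟨⟨⟨g1, g2⟩, g3⟩, g4⟩ := hω
    simp only [hB₄, Set.mem_ofPred_eq, not_or, not_exists, not_and, not_not, not_forall] at g4
    have hne : ∃ j, β j + Z ω j ≠ 0 := by
      refine ⟨⟨0, by omega⟩, ?_⟩
      have h5 := g4.1 ⟨0, by omega⟩
      have h6 := abs_le.1 (hβ ⟨0, by omega⟩)
      simp only [shiftSet, Set.mem_Icc] at h5
      omega
    refine hA ω ?_ ?_ g4.1 g4.2 ?_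
    · intro i j
      by_contra hlt
      exact g1 ⟨i, j, not_le.1 hlt⟩
    · intro i
      by_contra hlt
      exact g2 ⟨hne, i, not_le.1 hlt⟩
    · intro x e w hx he hw
      by_contra hcon
      push Not at hcon
      exact g3 ⟨x, e, w, hx, he, hw, hcon⟩
  linarith

end ELO

/-! ### Choice of the parameters -/

namespace ELO

/-- The two consequences of the lower bound for `N`, in multiplicative form: the first one keeps
only the first factor `2 n + p` over `2 n`, the second one is the `n`-th power. -/
theorem pow_le_of_logb_le {n p N : ℕ} (hn : 0 < n) {c₁ Q : ℝ} (hQ : 1 ≤ Q)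
    (hcA : 1 ≤ c₁ * n * p)
    (hN : 1 / (2 * n) * (2 * n + p) * (2 * n + p + 10 * Real.logb 2 Q)
      + 6 * Real.logb 2 (c₁ * n * p) ≤ (N : ℝ)) :
    (2 : ℝ) ^ (2 * n + p) * Q ^ 10 * (c₁ * n * p) ^ 6 ≤ 2 ^ N ∧
    √((2 : ℝ) ^ (2 * n + p)) ^ (2 * n + p) * Q ^ (5 * (2 * n + p)) * (c₁ * n * p) ^ (6 * n)
      ≤ ((2 : ℝ) ^ N) ^ n := by
  set B := c₁ * n * p with hB
  have hn0 : (0 : ℝ) < n := by exact_mod_cast hn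
  have hn1 : (1 : ℝ) ≤ n := by exact_mod_cast hn
  have hp0 : (0 : ℝ) ≤ p := by positivity
  have hQ0 : 0 < Q := by linarith
  have hB0 : 0 < B := by linarith
  have hlQ : 0 ≤ Real.logb 2 Q := Real.logb_nonneg (by norm_num) hQ
  have hlB : 0 ≤ Real.logb 2 B := Real.logb_nonneg (by norm_num) hcA
  have hH : Real.logb 2 (√((2 : ℝ) ^ (2 * n + p))) = (2 * n + p) / 2 := by
    have h1 : Real.logb 2 (√((2 : ℝ) ^ (2 * n + p)) ^ 2) = 2 * n + p := by
      rw [Real.sq_sqrt (by positivity), Real.logb_pow, Real.logb_self_eq_one (by norm_num)]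
      push_cast
      ring
    rw [Real.logb_pow] at h1
    push_cast at h1
    linarith
  have hl2 : Real.logb 2 (2 : ℝ) = 1 := Real.logb_self_eq_one (by norm_num)
  constructor
  · rw [← Real.rpow_natCast 2 N, ← Real.logb_le_iff_le_rpow (by norm_num) (by positivity),
      Real.logb_mul (by positivity) (by positivity), Real.logb_mul (by positivity) (by positivity),
      Real.logb_pow, Real.logb_pow, Real.logb_pow, hl2]
    push_cast
    have h1 : 1 ≤ 1 / (2 * n) * (2 * (n : ℝ) + p) := by
      rw [one_div, inv_mul_eq_div, le_div_iff₀ (by positivity)]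
      linarith
    have h2 : 0 ≤ 2 * (n : ℝ) + p + 10 * Real.logb 2 Q := by positivity
    nlinarith [mul_le_mul_of_nonneg_right h1 h2]
  · have h1 : ((2 : ℝ) ^ N) ^ n = (2 : ℝ) ^ ((N * n : ℕ) : ℝ) := by
      rw [Real.rpow_natCast, pow_mul]
    rw [h1, ← Real.logb_le_iff_le_rpow (by norm_num) (by positivity),
      Real.logb_mul (by positivity) (by positivity), Real.logb_mul (by positivity) (by positivity),
      Real.logb_pow, Real.logb_pow, Real.logb_pow, hH]
    push_cast
    have h2 := mul_le_mul_of_nonneg_right hN hn0.le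
    have h3 : (1 / (2 * (n : ℝ)) * (2 * n + p) * (2 * n + p + 10 * Real.logb 2 Q)
        + 6 * Real.logb 2 B) * n = (2 * n + p) * (2 * n + p) / 2
          + 5 * (2 * n + p) * Real.logb 2 Q + 6 * n * Real.logb 2 B := by
      field_simp
      ring
    linarith

/-- Bounds for the radius `Q = R̂ √p + (w + 1) √n`. -/
theorem radius_bounds {n p Rhat : ℕ} (hn : 0 < n) (hp : 0 < p) (hR : 0 < Rhat) {w Q : ℝ}
    (hw : 0 ≤ w) (hQ : Q = Rhat * √p + (w + 1) * √n) :
    2 ≤ Q ∧ 4 * (n * p : ℝ) ≤ Q ^ 4 ∧ 3 + (Nat.log 2 p : ℝ) ≤ Q ^ 2 ∧ w + 1 ≤ Q ∧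
      p * (Rhat : ℝ) ^ 2 + n * w ^ 2 ≤ Q ^ 2 := by
  have hR1 : (1 : ℝ) ≤ Rhat := by exact_mod_cast hR
  have hn1 : (1 : ℝ) ≤ n := by exact_mod_cast hn
  have hp1 : (1 : ℝ) ≤ p := by exact_mod_cast hp
  have hsn : 1 ≤ √(n : ℝ) := Real.one_le_sqrt.2 hn1
  have hsp : 1 ≤ √(p : ℝ) := Real.one_le_sqrt.2 hp1
  have hsn2 : √(n : ℝ) ^ 2 = n := Real.sq_sqrt (by positivity)
  have hsp2 : √(p : ℝ) ^ 2 = p := Real.sq_sqrt (by positivity)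
  have h1 : √(p : ℝ) ≤ Rhat * √p := le_mul_of_one_le_left (by positivity) hR1
  have h2 : √(n : ℝ) ≤ (w + 1) * √n := le_mul_of_one_le_left (by positivity) (by linarith)
  have h3 : √(p : ℝ) + √n ≤ Q := by rw [hQ]; exact add_le_add h1 h2
  have h4 : (√(p : ℝ) + √n) ^ 2 ≤ Q ^ 2 := pow_le_pow_left₀ (by positivity) h3 2
  have h5 : (√(p : ℝ) + √n) ^ 2 = p + n + 2 * (√p * √n) := by
    rw [add_sq, hsn2, hsp2]
    ring
  have h6 : 1 ≤ √(p : ℝ) * √n := one_le_mul_of_one_le_of_one_le hsp hsn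
  refine ⟨by linarith, ?_, ?_, ?_, ?_⟩
  · have h7 : (p : ℝ) + n ≤ Q ^ 2 := by linarith
    calc 4 * (n * p : ℝ) ≤ (p + n) ^ 2 := by nlinarith [sq_nonneg ((p : ℝ) - n)]
      _ ≤ (Q ^ 2) ^ 2 := pow_le_pow_left₀ (by positivity) h7 2
      _ = Q ^ 4 := by ring
  · have h7 : (Nat.log 2 p : ℝ) + 1 ≤ p := by
      exact_mod_cast Nat.log_lt_self 2 hp.ne'
    linarith
  · have h7 : w + 1 ≤ (w + 1) * √n := le_mul_of_one_le_right (by linarith) hsn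
    have h8 : 0 ≤ Rhat * √(p : ℝ) := by positivity
    linarith
  · have h7 : w ^ 2 ≤ (w + 1) ^ 2 := pow_le_pow_left₀ hw (by linarith) 2
    have h8 : n * w ^ 2 ≤ ((w + 1) * √(n : ℝ)) ^ 2 := by
      rw [mul_pow, hsn2, mul_comm]
      exact mul_le_mul_of_nonneg_right h7 (by positivity)
    have h9 : (Rhat * √(p : ℝ)) ^ 2 = p * (Rhat : ℝ) ^ 2 := by rw [mul_pow, hsp2, mul_comm]
    have h10 : 0 ≤ Rhat * √(p : ℝ) * ((w + 1) * √n) := by positivity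
    rw [hQ, ← h9]
    nlinarith

set_option maxHeartbeats 400000 in
/-- Heights `M` and `E`, an upper bound `T` for the entries and a lower bound `τ` for the responses
that make short vectors come from the hidden one outside an event of probability `O (1 / (n p))`. -/
theorem exists_parameters {n p N Rhat What : ℕ} (hn : 0 < n) (hp : 0 < p) (hR : 0 < Rhat)
    (hW : 0 < What) {c C w : ℝ} (hc : 0 < c) (hw : 0 ≤ w) (hwW : w ≤ What)
    (hA : 8 * max C 1 ≤ n * p)
    (hN : 1 / (2 * n) * (2 * n + p) *
        (2 * n + p + 10 * Real.logb 2 (Rhat * √p + (w + 1) * √n))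
      + 6 * Real.logb 2 ((1 + c) * n * p) ≤ (N : ℝ))
    {a b : ℤ} (ha : √(p : ℝ) ≤ a) (hb : √(n : ℝ) ≤ b) :
    ∃ (M E : ℕ) (T τ : ℝ), 0 < T ∧ T ≤ 2 ^ N * (n * p) ^ 3 ∧ 3 ≤ τ ∧
      (M : ℤ) < 2 ^ (n + (p + 1) / 2 + 3) * p * (Rhat * a + What * b) ∧
      (2 : ℝ) ^ (p + (n + n) - 1) * ((3 + Nat.log 2 p) ^ 2 * (p * (Rhat : ℝ) ^ 2 + n * w ^ 2))
        < (M + 1) ^ 2 ∧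
      p * (T * M) + M ≤ E * τ ∧ M * (w + 1) < τ ∧
      n * p * (C * 2 ^ N / T) + n * ((2 * τ + 1) * (c / 2 ^ N))
        + (2 * M + 1) ^ p * ((2 * E + 1) * (2 * M + 1) * (c / 2 ^ N)) ^ n ≤ 5 / (n * p) := by
  set Q := Rhat * √(p : ℝ) + (w + 1) * √n with hQ
  obtain ⟨hQ2, hQ4, hQℓ, hwQ, hQsum⟩ := radius_bounds hn hp hR hw hQ
  set d := 2 * n + p with hd
  set ℓ := Nat.log 2 p with hℓ
  set H := √((2 : ℝ) ^ d) with hH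
  set C₁ := max C 1 with hC₁
  set A : ℝ := n * p with hAdef
  set V : ℝ := 2 ^ N with hV
  have hn1 : (1 : ℝ) ≤ n := by exact_mod_cast hn
  have hp1 : (1 : ℝ) ≤ p := by exact_mod_cast hp
  have hR1 : (1 : ℝ) ≤ Rhat := by exact_mod_cast hR
  have hW1 : (1 : ℝ) ≤ What := by exact_mod_cast hW
  have hC1 : 1 ≤ C₁ := le_max_right _ _
  have hCC : C ≤ C₁ := le_max_left _ _
  have hA8 : 8 ≤ A := by linarith
  have hA1 : 1 ≤ A := by linarith
  have hpA : (p : ℝ) ≤ A := le_mul_of_one_le_left (by positivity) hn1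
  have hnA : (n : ℝ) ≤ A := le_mul_of_one_le_right (by positivity) hp1
  have hcA : (1 + c) * n * p = (1 + c) * A := by rw [hAdef]; ring
  have hcA1 : 1 ≤ (1 + c) * A := one_le_mul_of_one_le_of_one_le (by linarith) hA1
  obtain ⟨hV1, hV2⟩ := pow_le_of_logb_le hn (by linarith : (1 : ℝ) ≤ Q)
    (by rw [hcA]; exact hcA1) hN
  rw [hcA, ← hd, ← hV] at hV1 hV2
  rw [← hH] at hV2
  have hV0 : 0 < V := by positivity
  have hVone : 1 ≤ V := one_le_pow₀ (by norm_num)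
  have hQ1 : 1 ≤ Q := by linarith
  have hQ0 : 0 < Q := by linarith
  have hHsq : H ^ 2 = 2 ^ d := Real.sq_sqrt (by positivity)
  have hH1 : 1 ≤ H := Real.one_le_sqrt.2 (one_le_pow₀ (by norm_num))
  have hH0 : 0 < H := by linarith
  have hHd : H ≤ 2 ^ d := by rw [← hHsq]; exact le_self_pow₀ hH1 (by norm_num)
  -- the LLL bound for the first vector, as the hidden vector has length at most `(3 + ℓ) Q`
  set M' := H * (3 + ℓ) * Q with hM'
  have hℓ0 : (0 : ℝ) ≤ ℓ := by positivity
  have hM'1 : 1 ≤ M' := one_le_mul_of_one_le_of_one_le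
    (one_le_mul_of_one_le_of_one_le hH1 (by linarith)) hQ1
  have hM'Q : M' ≤ H * Q ^ 3 := by
    calc M' ≤ H * Q ^ 2 * Q := by rw [hM']; gcongr
      _ = H * Q ^ 3 := by ring
  set M := ⌊M'⌋₊ with hM
  have hMle : (M : ℝ) ≤ M' := Nat.floor_le (by linarith)
  have hMlt : M' < M + 1 := Nat.lt_floor_add_one M'
  -- twice `p T M' / τ` for the values of `T` and `τ` below
  set E' := 2 * p * C₁ * A ^ 4 * (1 + c) * M' with hE'
  have hE'1 : 1 ≤ E' := by
    have h1 : 1 ≤ A ^ 4 := one_le_pow₀ hA1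
    have h2 : 1 ≤ 2 * (p : ℝ) := by linarith
    exact one_le_mul_of_one_le_of_one_le (one_le_mul_of_one_le_of_one_le
      (one_le_mul_of_one_le_of_one_le (one_le_mul_of_one_le_of_one_le h2 hC1) h1)
      (by linarith)) hM'1
  set E := ⌈E'⌉₊ with hE
  have hEge : E' ≤ E := Nat.le_ceil _
  have hEle : (E : ℝ) < E' + 1 := Nat.ceil_lt_add_one (by linarith)
  -- the responses fall below `τ` with probability `O (c τ / 2 ^ N) = O (1 / A ^ 2)` each
  set τ := V / ((1 + c) * A ^ 2) with hτ
  have hc1 : 1 ≤ 1 + c := by linarith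
  have hτV : 2 ^ d * Q ^ 10 ≤ τ := by
    rw [hτ, le_div_iff₀ (by positivity)]
    refine le_trans ?_ hV1
    refine mul_le_mul_of_nonneg_left ?_ (by positivity)
    calc (1 + c) * A ^ 2 ≤ (1 + c) ^ 6 * A ^ 6 := by
          gcongr
          · exact le_self_pow₀ hc1 (by norm_num)
          · norm_num
      _ = ((1 + c) * A) ^ 6 := by ring
  clear_value Q d ℓ H C₁ A V M' M E' E τ
  -- Markov's inequality at `T = C₁ 2 ^ N A ^ 2` leaves `1 / A` for all `A` entries together
  refine ⟨M, E, C₁ * V * A ^ 2, τ, by positivity, ?_, ?_, ?_, ?_, ?_, ?_, ?_⟩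
  · have : C₁ ≤ A := by linarith
    calc C₁ * V * A ^ 2 ≤ A * V * A ^ 2 := by gcongr
      _ = V * A ^ 3 := by ring
  · have h1 : (1 : ℝ) ≤ 2 ^ d := one_le_pow₀ (by norm_num)
    have h2 : (2 : ℝ) ^ 10 ≤ Q ^ 10 := pow_le_pow_left₀ (by norm_num) hQ2 10
    calc (3 : ℝ) ≤ 1 * 2 ^ 10 := by norm_num
      _ ≤ 2 ^ d * Q ^ 10 := by gcongr
      _ ≤ τ := hτV
  · have ha0 : (0 : ℝ) ≤ a := le_trans (Real.sqrt_nonneg _) ha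
    have hb0 : (0 : ℝ) ≤ b := le_trans (Real.sqrt_nonneg _) hb
    have hp0' : 0 < √(p : ℝ) := Real.sqrt_pos.2 (by linarith)
    have hQs : Q ≤ 2 * (Rhat * a + What * b) := by
      have h1 : Rhat * √(p : ℝ) ≤ Rhat * a := by gcongr
      have h2 : (w + 1) * √n ≤ (2 * What) * b := by
        apply mul_le_mul _ hb (by positivity) (by positivity)
        linarith
      have h3 : 0 ≤ (Rhat : ℝ) * a := by positivity
      rw [hQ]
      linarith
    have hS0 : 0 < (Rhat : ℝ) * a + What * b := by linarith
    have hHm : H ≤ 2 ^ (n + (p + 1) / 2) := by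
      rw [hH, Real.sqrt_le_left (by positivity), ← pow_mul]
      exact pow_le_pow_right₀ (by norm_num) (by omega)
    have hℓp : 3 + (ℓ : ℝ) ≤ 3 * p := by
      have h7 : (Nat.log 2 p : ℝ) + 1 ≤ p := by
        exact_mod_cast Nat.log_lt_self 2 hp.ne'
      rw [← hℓ] at h7
      linarith
    have h1 : (M : ℝ) < 2 ^ (n + (p + 1) / 2 + 3) * p * (Rhat * a + What * b) := by
      calc (M : ℝ) ≤ H * (3 + ℓ) * Q := by rw [← hM']; exact hMle
        _ ≤ 2 ^ (n + (p + 1) / 2) * (3 * p) * (2 * (Rhat * a + What * b)) := by gcongr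
        _ = 2 ^ (n + (p + 1) / 2) * p * (Rhat * a + What * b) * 6 := by ring
        _ < 2 ^ (n + (p + 1) / 2) * p * (Rhat * a + What * b) * 8 := by
          refine mul_lt_mul_of_pos_left (by norm_num) ?_
          positivity
        _ = _ := by rw [pow_add _ (n + (p + 1) / 2) 3]; ring
    exact_mod_cast h1
  · have h1 : (2 : ℝ) ^ (p + (n + n) - 1) ≤ 2 ^ d :=
      pow_le_pow_right₀ (by norm_num) (by omega)
    calc (2 : ℝ) ^ (p + (n + n) - 1) * ((3 + ℓ) ^ 2 * (p * (Rhat : ℝ) ^ 2 + n * w ^ 2))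
        ≤ 2 ^ d * ((3 + ℓ) ^ 2 * Q ^ 2) := by gcongr
      _ = M' ^ 2 := by rw [← hHsq, hM']; ring
      _ < (M + 1) ^ 2 := pow_lt_pow_left₀ hMlt (by linarith) (by norm_num)
  · have h1 : E' * τ = 2 * (p * (C₁ * V * A ^ 2 * M')) := by
      rw [hE', hτ]
      field_simp
    have h2 : 1 ≤ p * (C₁ * V * A ^ 2) := one_le_mul_of_one_le_of_one_le hp1
      (one_le_mul_of_one_le_of_one_le (one_le_mul_of_one_le_of_one_le hC1 hVone)
        (one_le_pow₀ hA1))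
    have hτ0 : 0 ≤ τ := by rw [hτ]; positivity
    calc p * (C₁ * V * A ^ 2 * M) + M ≤ p * (C₁ * V * A ^ 2 * M') + M' := by gcongr
      _ ≤ p * (C₁ * V * A ^ 2 * M') + p * (C₁ * V * A ^ 2 * M') := by
          gcongr
          calc M' = 1 * M' := (one_mul _).symm
            _ ≤ p * (C₁ * V * A ^ 2) * M' := by gcongr
            _ = _ := by ring
      _ = E' * τ := by rw [h1]; ring
      _ ≤ E * τ := by gcongr
  · calc M * (w + 1) ≤ H * Q ^ 3 * Q := by gcongr; exact hMle.trans hM'Q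
      _ = H * Q ^ 4 := by ring
      _ ≤ 2 ^ d * Q ^ 4 := by gcongr
      _ < 2 ^ d * Q ^ 10 := by
          refine mul_lt_mul_of_pos_left ?_ (by positivity)
          exact pow_lt_pow_right₀ (by linarith) (by norm_num)
      _ ≤ τ := hτV
  · have t1 : A * (C * V / (C₁ * V * A ^ 2)) ≤ 1 / A := by
      have : A * (C * V / (C₁ * V * A ^ 2)) = (C / C₁) * (1 / A) := by field_simp
      rw [this]
      refine mul_le_of_le_one_left (by positivity) ?_
      rw [div_le_one (by linarith)]
      exact hCC
    have t2 : n * ((2 * τ + 1) * (c / V)) ≤ 3 / A := by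
      have h1 : n * ((2 * τ + 1) * (c / V)) = n / A ^ 2 * (c / (1 + c)) * 2 + n * c / V := by
        rw [hτ]
        field_simp
      have h2 : n / A ^ 2 * (c / (1 + c)) ≤ 1 / A := by
        have h3 : n / A ^ 2 ≤ 1 / A := by
          rw [div_le_div_iff₀ (by positivity) (by positivity), one_mul, pow_two]
          gcongr
        have h4 : c / (1 + c) ≤ 1 := by rw [div_le_one (by linarith)]; linarith
        calc n / A ^ 2 * (c / (1 + c)) ≤ n / A ^ 2 * 1 := by gcongr
          _ ≤ 1 / A := by rw [mul_one]; exact h3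
      have h5 : n * c / V ≤ 1 / A := by
        rw [div_le_div_iff₀ hV0 (by linarith), one_mul]
        refine le_trans ?_ hV1
        have h6 : 1 ≤ (2 : ℝ) ^ d * Q ^ 10 :=
          one_le_mul_of_one_le_of_one_le (one_le_pow₀ (by norm_num)) (one_le_pow₀ hQ1)
        calc n * c * A ≤ A * (1 + c) * A := by gcongr; linarith
          _ = (1 + c) * A ^ 2 := by ring
          _ ≤ (1 + c) ^ 6 * A ^ 6 := by
            gcongr
            · exact le_self_pow₀ hc1 (by norm_num)
            · norm_num
          _ = 1 * ((1 + c) * A) ^ 6 := by ring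
          _ ≤ 2 ^ d * Q ^ 10 * ((1 + c) * A) ^ 6 := by gcongr
      rw [h1]
      have : 3 / A = 1 / A * 2 + 1 / A := by ring
      rw [this]
      gcongr
    have t3 : (2 * M + 1) ^ p * ((2 * E + 1) * (2 * M + 1) * (c / V)) ^ n ≤ 1 / A := by
      have hM3 : 2 * (M : ℝ) + 1 ≤ 3 * M' := by linarith
      have hE5 : 2 * (E : ℝ) + 1 ≤ 5 * E' := by linarith
      have h1 : (2 * (E : ℝ) + 1) * (2 * M + 1) * (c / V)
          ≤ 30 * C₁ * A ^ 5 * (1 + c) ^ 2 * M' ^ 2 / V := by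
        calc (2 * (E : ℝ) + 1) * (2 * M + 1) * (c / V) ≤ 5 * E' * (3 * M') * ((1 + c) / V) := by
              gcongr
              linarith
          _ = 30 * C₁ * A ^ 4 * p * (1 + c) ^ 2 * M' ^ 2 / V := by rw [hE']; ring
          _ ≤ 30 * C₁ * A ^ 4 * A * (1 + c) ^ 2 * M' ^ 2 / V := by gcongr
          _ = _ := by ring
      have h2 : (2 * (M : ℝ) + 1) ^ p * ((2 * E + 1) * (2 * M + 1) * (c / V)) ^ n
          ≤ (3 * M') ^ p * (30 * C₁ * A ^ 5 * (1 + c) ^ 2 * M' ^ 2 / V) ^ n := by gcongr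
      refine h2.trans ?_
      have h3 : (3 * M') ^ p * (30 * C₁ * A ^ 5 * (1 + c) ^ 2 * M' ^ 2 / V) ^ n
          = 3 ^ p * (30 * C₁) ^ n * (A ^ 5 * (1 + c) ^ 2) ^ n * M' ^ d / V ^ n := by
        have h4 (x y z v : ℝ) : (3 * z) ^ p * (x * y * z ^ 2 / v) ^ n
            = 3 ^ p * x ^ n * y ^ n * z ^ d / v ^ n := by
          rw [hd, div_pow, mul_pow, mul_pow, mul_pow, pow_add, pow_mul z 2 n]
          ring
        rw [mul_assoc (30 * C₁), h4]
      rw [h3, div_le_div_iff₀ (by positivity) (by linarith), one_mul]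
      refine le_trans ?_ hV2
      have h4 : M' ^ d ≤ H ^ d * Q ^ (3 * d) := by
        rw [pow_mul, ← mul_pow]
        exact pow_le_pow_left₀ (by linarith) hM'Q d
      have h5 : (3 : ℝ) ^ p ≤ (Q ^ 2) ^ p := by
        refine pow_le_pow_left₀ (by norm_num) ?_ p
        exact le_trans (by norm_num) (pow_le_pow_left₀ (by norm_num) hQ2 2)
      have h6 : (30 * C₁) ^ n ≤ (Q ^ 4) ^ n := by
        refine pow_le_pow_left₀ (by positivity) ?_ n
        linarith
      have h7 : (A ^ 5 * (1 + c) ^ 2) ^ n * A ≤ ((1 + c) * A) ^ (6 * n) := by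
        calc (A ^ 5 * (1 + c) ^ 2) ^ n * A ≤ (A ^ 5 * (1 + c) ^ 6) ^ n * A ^ n := by
              gcongr
              · norm_num
              · exact le_self_pow₀ hA1 hn.ne'
          _ = ((1 + c) * A) ^ (6 * n) := by
              rw [← mul_pow, pow_mul]
              congr 1
              ring
      calc 3 ^ p * (30 * C₁) ^ n * (A ^ 5 * (1 + c) ^ 2) ^ n * M' ^ d * A
          = 3 ^ p * (30 * C₁) ^ n * M' ^ d * ((A ^ 5 * (1 + c) ^ 2) ^ n * A) := by ring
        _ ≤ (Q ^ 2) ^ p * (Q ^ 4) ^ n * (H ^ d * Q ^ (3 * d)) * ((1 + c) * A) ^ (6 * n) := by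
            gcongr
        _ = H ^ d * Q ^ (5 * d) * ((1 + c) * A) ^ (6 * n) := by
            rw [← pow_mul, ← pow_mul, show 5 * d = 2 * p + 4 * n + 3 * d by omega, pow_add,
              pow_add]
            ring
    calc _ ≤ 1 / A + 3 / A + 1 / A := add_le_add (add_le_add t1 t2) t3
      _ = 5 / A := by ring

/-- The bound for the probability of a common divisor beats `2 ^ (-κ p)` by a factor `p`, since
`1 / 2 + ε < 2 ^ (-κ)` for small `ε`. -/
theorem exists_gcd_bound {κ : ℝ} (hκ : κ < 1) :
    ∃ (p₀ : ℕ) (K : ℝ), 2 ≤ p₀ ∧ 0 < K ∧ ∀ p L : ℕ, p₀ ≤ p → Nat.log 2 p ≤ L →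
      6 ≤ L ∧ p * ((1 / 2 + 1 / (L : ℝ)) ^ p + 32 * (1 / 2) ^ p) ≤ K * 2 ^ (-(κ * p)) := by
  set r : ℝ := 2 ^ (-κ) with hr
  have hr2 : 1 / 2 < r := by
    have : (2 : ℝ) ^ (-1 : ℝ) < 2 ^ (-κ) := Real.rpow_lt_rpow_of_exponent_lt (by norm_num)
      (by linarith)
    rwa [Real.rpow_neg_one, ← one_div] at this
  have hr0 : 0 < r := by linarith
  set ε := (r - 1 / 2) / 2 with hε
  have hε0 : 0 < ε := by rw [hε]; linarith
  set s := (1 / 2 + ε) / r with hs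
  have hs0 : 0 ≤ s := by positivity
  have hs1 : s < 1 := by rw [hs, div_lt_one hr0, hε]; linarith
  obtain ⟨K, hK⟩ := (tendsto_self_mul_const_pow_of_lt_one hs0 hs1).bddAbove_range
  obtain ⟨L₀, hL₀⟩ := exists_nat_gt (1 / ε)
  refine ⟨2 ^ (L₀ + 6), 33 * max K 1, ?_, by positivity, fun p L hp hL => ?_⟩
  · calc 2 = 2 ^ 1 := rfl
      _ ≤ 2 ^ (L₀ + 6) := Nat.pow_le_pow_right (by norm_num) (by omega)
  have hlog : L₀ + 6 ≤ L := by
    refine le_trans ?_ hL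
    calc L₀ + 6 = Nat.log 2 (2 ^ (L₀ + 6)) := (Nat.log_pow (by norm_num) _).symm
      _ ≤ Nat.log 2 p := Nat.log_mono_right hp
  have hL0r : (L₀ : ℝ) ≤ L := by exact_mod_cast (by omega : L₀ ≤ L)
  have hLε : 1 / (L : ℝ) ≤ ε := by
    rw [one_div_le (by have := one_div_pos.2 hε0; linarith) hε0]
    linarith
  refine ⟨by omega, ?_⟩
  have h1 : (1 / 2 + 1 / (L : ℝ)) ^ p ≤ (1 / 2 + ε) ^ p := by gcongr
  have h2 : ((1 : ℝ) / 2) ^ p ≤ (1 / 2 + ε) ^ p := by gcongr; linarith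
  have h3 : (p : ℝ) * s ^ p ≤ max K 1 := le_trans (hK ⟨p, rfl⟩) (le_max_left _ _)
  have h4 : (2 : ℝ) ^ (-(κ * p)) = r ^ p := by
    rw [hr, ← Real.rpow_natCast, ← Real.rpow_mul (by norm_num)]
    congr 1
    ring
  have h5 : (1 / 2 + ε) ^ p = s ^ p * r ^ p := by
    rw [← mul_pow, hs, div_mul_cancel₀ _ hr0.ne']
  rw [h4]
  calc (p : ℝ) * ((1 / 2 + 1 / (L : ℝ)) ^ p + 32 * (1 / 2) ^ p)
      ≤ p * ((1 / 2 + ε) ^ p + 32 * (1 / 2 + ε) ^ p) := by gcongr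
    _ = 33 * (p * s ^ p) * r ^ p := by rw [h5]; ring
    _ ≤ 33 * max K 1 * r ^ p := by gcongr

end ELO

/-! ### Running time and recovery -/

namespace ELO

variable {n p : ℕ}

theorem cast_log_succ_le {x : ℕ} : ((Nat.log 2 x + 1 : ℕ) : ℝ) ≤ Real.logb 2 x + 1 := by
  have h := Real.natLog_le_logb x 2
  push_cast at h ⊢
  linarith

theorem logb_natCast_nonneg {x : ℕ} (hx : 0 < x) : 0 ≤ Real.logb 2 x :=
  Real.logb_nonneg (by norm_num) (by exact_mod_cast hx)

/-- Constants for the running time.  They are kept abstract so that powers with exponent `86` are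
never computed. -/
theorem exists_time_bound (k₀ : ℕ) : ∃ a k : ℕ, ∀ (t L : ℕ) (y : ℝ), t ≤ L ^ k₀ →
    (L : ℝ) ≤ 17 * y → (t : ℝ) ≤ a * y ^ k := by
  refine ⟨17 ^ k₀, k₀, fun t L y ht hL => ?_⟩
  calc (t : ℝ) ≤ (L : ℝ) ^ k₀ := by exact_mod_cast ht
    _ ≤ (17 * y) ^ k₀ := pow_le_pow_left₀ (by positivity) hL k₀
    _ = ((17 ^ k₀ : ℕ) : ℝ) * y ^ k₀ := by rw [mul_pow, Nat.cast_pow, Nat.cast_ofNat]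

/-- Polynomial running time on every input. -/
theorem exists_returnsWithin {a k B Rhat What : ℕ} {Y : Fin n → ℤ} {X : Matrix (Fin n) (Fin p) ℤ}
    {Z : Fin p → ℤ} (hn : 0 < n) (hp : 0 < p) (hR : 0 < Rhat) (hW : 0 < What)
    (hak : ∀ (t L : ℕ) (y : ℝ), t ≤ L ^ 86 → (L : ℝ) ≤ 17 * y → (t : ℝ) ≤ a * y ^ k)
    (hY : ∀ i, |Y i| ≤ 2 ^ B) (hX : ∀ i j, |X i j| ≤ 2 ^ B) (hZ : ∀ j, Z j ∈ shiftSet p Rhat) :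
    ∃ out : Fin p → ℤ, ReturnsWithin Y X Rhat What Z out
      (a * (n + p + B + Real.logb 2 Rhat + Real.logb 2 What) ^ k) := by
  set sR := Nat.log 2 Rhat + 1 with hsR
  set sW := Nat.log 2 What + 1 with hsW
  set L := 2 * n + p + B + sR + sW + 16 with hL
  have hpow (k : ℕ) (hk : k ≤ L) : (2 : ℤ) ^ k ≤ 2 ^ L := pow_le_pow_right₀ (by norm_num) hk
  have hR2 : Rhat < 2 ^ L := (Nat.lt_pow_succ_log_self (by norm_num) Rhat).trans_le
    (Nat.pow_le_pow_right (by norm_num) (by omega))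
  have hW2 : What < 2 ^ L := (Nat.lt_pow_succ_log_self (by norm_num) What).trans_le
    (Nat.pow_le_pow_right (by norm_num) (by omega))
  obtain ⟨b, S, t, ht, hret, -⟩ := run_spec hn hp hR (L := L) (by omega) hR2 hW2
    (fun i => (hY i).trans (hpow B (by omega))) (fun i j => (hX i j).trans (hpow B (by omega))) hZ
  refine ⟨_, t, hret, hak t L _ ht ?_⟩
  have h1 : (sR : ℝ) ≤ Real.logb 2 Rhat + 1 := cast_log_succ_le
  have h2 : (sW : ℝ) ≤ Real.logb 2 What + 1 := cast_log_succ_le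
  have h3 := logb_natCast_nonneg hR
  have h4 := logb_natCast_nonneg hW
  have h5 : (1 : ℝ) ≤ n := by exact_mod_cast hn
  have h6 : (1 : ℝ) ≤ p := by exact_mod_cast hp
  have h7 : (0 : ℝ) ≤ B := Nat.cast_nonneg B
  rw [hL]
  push_cast
  linarith

theorem shifted_eq (X : Matrix (Fin n) (Fin p) ℤ) (β Z : Fin p → ℤ) (W : Fin n → ℤ) (i : Fin n) :
    shifted (X *ᵥ β + W) X Z i = (∑ j, X i j * (β j + Z j)) + W i := by
  simp only [shifted, Pi.add_apply, Matrix.mulVec, dotProduct, mul_add, Finset.sum_add_distrib]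
  ring

theorem abs_apply_le_norm {ι : Type*} [Fintype ι] (W : ι → ℤ) (i : ι) :
    |(W i : ℝ)| ≤ ‖W‖ := by
  rw [← Int.norm_eq_abs]
  exact norm_le_pi_norm W i

/-- The hidden shifted vector is short: its entries are at most `3 R̂ + ⌊log₂ p⌋`. -/
theorem sum_sq_shift_le {Rhat : ℕ} (hR : 0 < Rhat) {β Z : Fin p → ℤ} {W : Fin n → ℤ}
    (hβ : ∀ j, |β j| ≤ Rhat) (hZ : ∀ j, Z j ∈ shiftSet p Rhat) :
    ((∑ j, (β j + Z j) ^ 2 + ∑ i, W i ^ 2 : ℤ) : ℝ)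
      ≤ (3 + Nat.log 2 p) ^ 2 * (p * (Rhat : ℝ) ^ 2 + n * ‖W‖ ^ 2) := by
  set ℓ := Nat.log 2 p with hℓ
  have hR1 : (1 : ℝ) ≤ Rhat := by exact_mod_cast hR
  have hℓ0 : (0 : ℝ) ≤ ℓ := by positivity
  have h1 (j : Fin p) : ((β j : ℝ) + Z j) ^ 2 ≤ ((3 + ℓ) * Rhat) ^ 2 := by
    have h2 := abs_le.1 (hβ j)
    have h3 := hZ j
    simp only [shiftSet, Set.mem_Icc] at h3
    have h4 : (0 : ℝ) ≤ (β j : ℝ) + Z j := by exact_mod_cast (by omega : (0 : ℤ) ≤ β j + Z j)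
    have h5 : (β j : ℝ) + Z j ≤ 3 * Rhat + ℓ := by
      exact_mod_cast (by omega : β j + Z j ≤ 3 * (Rhat : ℤ) + ℓ)
    have h6 : (ℓ : ℝ) ≤ ℓ * Rhat := le_mul_of_one_le_right hℓ0 hR1
    exact pow_le_pow_left₀ h4 (by linarith) 2
  have h2 (i : Fin n) : (W i : ℝ) ^ 2 ≤ ‖W‖ ^ 2 := by
    rw [← sq_abs]
    exact pow_le_pow_left₀ (abs_nonneg _) (abs_apply_le_norm W i) 2
  have h3 : (1 : ℝ) ≤ (3 + ℓ) ^ 2 := one_le_pow₀ (by linarith)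
  push_cast
  calc ∑ j, ((β j : ℝ) + Z j) ^ 2 + ∑ i, (W i : ℝ) ^ 2
      ≤ ∑ _j : Fin p, ((3 + ℓ) * (Rhat : ℝ)) ^ 2 + ∑ _i : Fin n, ‖W‖ ^ 2 :=
        add_le_add (Finset.sum_le_sum fun j _ => h1 j) (Finset.sum_le_sum fun i _ => h2 i)
    _ = (3 + ℓ) ^ 2 * (p * (Rhat : ℝ) ^ 2) + 1 * (n * ‖W‖ ^ 2) := by
        simp only [Finset.sum_const, Finset.card_univ, Fintype.card_fin, nsmul_eq_mul]
        ring
    _ ≤ (3 + ℓ) ^ 2 * (p * (Rhat : ℝ) ^ 2) + (3 + ℓ) ^ 2 * (n * ‖W‖ ^ 2) := by gcongr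
    _ = _ := by ring

/-- Recovery of the hidden vector outside the exceptional event. -/
theorem returnsWithin_of_generic {a k N Rhat What : ℕ} {X : Matrix (Fin n) (Fin p) ℤ}
    {β Z : Fin p → ℤ} {W : Fin n → ℤ} {M E : ℕ} {T τ : ℝ}
    (hak : ∀ (t L : ℕ) (y : ℝ), t ≤ L ^ 86 → (L : ℝ) ≤ 17 * y → (t : ℝ) ≤ a * y ^ k)
    (hn : 0 < n) (hp : 0 < p) (hR : 0 < Rhat) (hW : 0 < What)
    (hβ : ∀ j, |β j| ≤ Rhat) (hWW : ‖W‖ ≤ What) (hT3 : T ≤ 2 ^ N * (n * p) ^ 3) (hτ3 : 3 ≤ τ)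
    (hMm : (M : ℤ) < (scale n p Rhat What).val)
    (hM : (2 : ℝ) ^ (p + (n + n) - 1) *
      ((3 + Nat.log 2 p) ^ 2 * (p * (Rhat : ℝ) ^ 2 + n * ‖W‖ ^ 2)) < (M + 1) ^ 2)
    (hE : p * (T * M) + M ≤ E * τ) (hMW : M * (‖W‖ + 1) < τ)
    (hT : ∀ i j, |(X i j : ℝ)| ≤ T)
    (hτ : ∀ i, τ ≤ |(((∑ j, X i j * (β j + Z j)) + W i : ℤ) : ℝ)|)
    (hZ : ∀ j, Z j ∈ shiftSet p Rhat) (hprim : ∀ q : ℕ, 2 ≤ q → ∃ j, ¬ (q : ℤ) ∣ β j + Z j)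
    (hrel : ∀ (x : Fin p → ℤ) (e w : Fin n → ℤ), (∀ j, |x j| ≤ M) → (∀ i, |e i| ≤ E) →
      (∀ i, |w i| ≤ M) → ∃ i, (∀ j, x j = e i * (β j + Z j)) ∨
        ∑ j, X i j * (x j - e i * (β j + Z j)) ≠ e i * W i - w i) :
    ReturnsWithin (X *ᵥ β + W) X Rhat What Z β
      (a * (n + p + N + Real.logb 2 Rhat + Real.logb 2 What) ^ k) := by
  set sR := Nat.log 2 Rhat + 1 with hsR
  set sW := Nat.log 2 What + 1 with hsW
  set L := 5 * n + 5 * p + N + sR + sW + 20 with hL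
  have hpow {k l : ℕ} (hk : k ≤ l) : (2 : ℤ) ^ k ≤ 2 ^ l := pow_le_pow_right₀ (by norm_num) hk
  have hR1 : (Rhat : ℤ) ≤ 2 ^ sR := by
    exact_mod_cast (Nat.lt_pow_succ_log_self (by norm_num : 1 < 2) Rhat).le
  have hW1 : (What : ℤ) ≤ 2 ^ sW := by
    exact_mod_cast (Nat.lt_pow_succ_log_self (by norm_num : 1 < 2) What).le
  have hR2 : Rhat < 2 ^ L := (Nat.lt_pow_succ_log_self (by norm_num) Rhat).trans_le
    (Nat.pow_le_pow_right (by norm_num) (by omega))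
  have hW2 : What < 2 ^ L := (Nat.lt_pow_succ_log_self (by norm_num) What).trans_le
    (Nat.pow_le_pow_right (by norm_num) (by omega))
  -- `T` adds only `3 (n + p)` to the bit length of the entries, as `n p ≤ 2 ^ (n + p)`
  have hX0 (i : Fin n) (j : Fin p) : |X i j| ≤ 2 ^ (N + 3 * (n + p)) := by
    have h1 : ((n : ℝ) * p) ≤ 2 ^ (n + p) := by
      rw [pow_add]
      have h2 : (n : ℝ) ≤ 2 ^ n := by exact_mod_cast Nat.lt_two_pow_self.le
      have h3 : (p : ℝ) ≤ 2 ^ p := by exact_mod_cast Nat.lt_two_pow_self.le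
      gcongr
    have h2 : |(X i j : ℝ)| ≤ 2 ^ (N + 3 * (n + p)) := by
      calc |(X i j : ℝ)| ≤ 2 ^ N * (n * p) ^ 3 := (hT i j).trans hT3
        _ ≤ 2 ^ N * (2 ^ (n + p)) ^ 3 := by gcongr
        _ = 2 ^ (N + 3 * (n + p)) := by rw [pow_add _ N, mul_comm 3, pow_mul _ (n + p) 3]
    rw [← Int.cast_abs] at h2
    exact_mod_cast h2
  have hWi (i : Fin n) : |W i| ≤ What := by
    have := (abs_apply_le_norm W i).trans hWW
    rw [← Int.cast_abs] at this
    exact_mod_cast this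
  have hY (i : Fin n) : |(X *ᵥ β + W) i| ≤ 2 ^ L := by
    have h1 : |∑ j, X i j * β j| ≤ 2 ^ (p + (N + 3 * (n + p)) + sR) := by
      calc |∑ j, X i j * β j| ≤ ∑ j, |X i j * β j| := Finset.abs_sum_le_sum_abs _ _
        _ ≤ ∑ _j : Fin p, 2 ^ (N + 3 * (n + p)) * 2 ^ sR := by
            refine Finset.sum_le_sum fun j _ => ?_
            rw [abs_mul]
            exact mul_le_mul (hX0 i j) ((hβ j).trans hR1) (abs_nonneg _) (by positivity)
        _ = p * (2 ^ (N + 3 * (n + p)) * 2 ^ sR) := by simp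
        _ ≤ 2 ^ p * (2 ^ (N + 3 * (n + p)) * 2 ^ sR) := by
            have h3 : (p : ℤ) ≤ 2 ^ p := by exact_mod_cast Nat.lt_two_pow_self.le
            gcongr
        _ = 2 ^ (p + (N + 3 * (n + p)) + sR) := by ring
    have h2 : |(X *ᵥ β + W) i| ≤ |∑ j, X i j * β j| + |W i| := abs_add_le _ _
    have h3 := (hWi i).trans hW1
    have h4 : (2 : ℤ) ^ (p + (N + 3 * (n + p)) + sR) ≤ 2 ^ (L - 1) := hpow (by omega)
    have h5 : (2 : ℤ) ^ sW ≤ 2 ^ (L - 1) := hpow (by omega)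
    have h6 : (2 : ℤ) ^ L = 2 ^ (L - 1) * 2 := by rw [← pow_succ]; congr 1
    linarith
  obtain ⟨b, S, t, ht, hret, hinv⟩ := run_spec hn hp hR (L := L) (by omega) hR2 hW2 hY
    (fun i j => (hX0 i j).trans (hpow (by omega))) hZ
  simp only [shifted_eq] at hinv
  have hout : output (firstBlock b) Z = β := by
    refine output_eq hn hp ((Nat.cast_nonneg M).trans_lt hMm) (fun i => ?_) hτ hinv (fun j => ?_)
      hprim ?_ hMm hT hE (by linarith) (fun i => ?_) hrel
    · have h1 := hτ3.trans (hτ i)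
      rw [← Int.cast_abs] at h1
      exact_mod_cast h1
    · have h2 := abs_le.1 (hβ j)
      have h3 := hZ j
      simp only [shiftSet, Set.mem_Icc] at h3
      omega
    · refine lt_of_le_of_lt ?_ hM
      exact mul_le_mul_of_nonneg_left (sum_sq_shift_le hR hβ hZ) (by positivity)
    · refine lt_of_le_of_lt ?_ hMW
      exact mul_le_mul_of_nonneg_left (add_le_add_left (abs_apply_le_norm W i) 1)
        (Nat.cast_nonneg M)
  rw [hout] at hret
  refine ⟨t, hret, hak t L _ ht ?_⟩
  have h1 : (sR : ℝ) ≤ Real.logb 2 Rhat + 1 := cast_log_succ_le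
  have h2 : (sW : ℝ) ≤ Real.logb 2 What + 1 := cast_log_succ_le
  have h3 := logb_natCast_nonneg hR
  have h4 := logb_natCast_nonneg hW
  have h5 : (1 : ℝ) ≤ n := by exact_mod_cast hn
  have h6 : (1 : ℝ) ≤ p := by exact_mod_cast hp
  have h7 : (0 : ℝ) ≤ N := Nat.cast_nonneg N
  rw [hL]
  push_cast
  linarith

theorem sqrt_le_ceilSqrt (k : ℕ) : √(k : ℝ) ≤ ((Timed.ceilSqrt k).val : ℝ) := by
  obtain ⟨h0, -, h1, -⟩ := Timed.ceilSqrt_spec (k := k) (s := k)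
    (by exact_mod_cast Nat.lt_two_pow_self.le)
  rw [Real.sqrt_le_left (by exact_mod_cast h0)]
  exact_mod_cast h1

/-- The probability of failure for large `n p`, before the probability of a common divisor is
estimated. -/
theorem one_sub_le_measureReal_returnsWithin {a k N Rhat What : ℕ} {c C : ℝ} {D : Measure ℤ}
    {β : Fin p → ℤ} {W : Fin n → ℤ} {Ω : Type*} {_ : MeasurableSpace Ω} {P : Measure Ω}
    {X : Ω → Matrix (Fin n) (Fin p) ℤ} {Z : Ω → Fin p → ℤ}
    [IsProbabilityMeasure P] [IsProbabilityMeasure D]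
    (hak : ∀ (t L : ℕ) (y : ℝ), t ≤ L ^ 86 → (L : ℝ) ≤ 17 * y → (t : ℝ) ≤ a * y ^ k)
    (hn : 0 < n) (hp : 2 ≤ p) (hR : 0 < Rhat) (hW : 0 < What) (hc : 0 < c)
    (hD : ∀ v : ℤ, D.real {v} ≤ c / 2 ^ N) (hint : Integrable (fun v : ℤ => |(v : ℝ)|) D)
    (hmean : ∫ v : ℤ, |(v : ℝ)| ∂D ≤ C * 2 ^ N)
    (hX : ∀ i j, HasLaw (fun ω => X ω i j) D P)
    (hZ : ∀ j, HasLaw (fun ω => Z ω j) (uniformOn (shiftSet p Rhat)) P)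
    (hind : iIndepFun
      (Sum.elim (fun (ij : Fin n × Fin p) ω => X ω ij.1 ij.2) (fun j ω => Z ω j)) P)
    (hβ : ∀ j, |β j| ≤ Rhat) (hWW : ‖W‖ ≤ What)
    (hN : 1 / (2 * n) * (2 * n + p) *
        (2 * n + p + 10 * Real.logb 2 (Rhat * √p + (‖W‖ + 1) * √n))
      + 6 * Real.logb 2 ((1 + c) * n * p) ≤ (N : ℝ))
    (hA : 8 * max C 1 ≤ n * p) {L : ℕ} (hL : L = Rhat + Nat.log 2 p) (hL6 : 6 ≤ L) :
    1 - (5 / (n * p) + ((1 / 2 + 1 / (L : ℝ)) ^ p + 32 * (1 / 2) ^ p)) ≤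
      P.real {ω | ReturnsWithin (X ω *ᵥ β + W) (X ω) Rhat What (Z ω) β
        (a * (n + p + N + Real.logb 2 Rhat + Real.logb 2 What) ^ k)} := by
  obtain ⟨M, E, T, τ, hT0, hT3, hτ3, hMm, hM, hE, hMW, hfail⟩ :=
    exists_parameters (C := C) hn (by omega) hR hW hc (norm_nonneg W) hWW hA hN
      (sqrt_le_ceilSqrt p) (sqrt_le_ceilSqrt n)
  rw [← scale_val] at hMm
  have h := one_sub_le_measureReal_of_generic hR hp hX hZ hind hint hmean hT0 hD
    (by linarith : 0 ≤ τ) hL hL6 hβ W M E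
    (A := {ω | ReturnsWithin (X ω *ᵥ β + W) (X ω) Rhat What (Z ω) β
      (a * (n + p + N + Real.logb 2 Rhat + Real.logb 2 What) ^ k)})
    fun ω hT hτ hZω hprim hrel => returnsWithin_of_generic hak hn (by omega) hR hW hβ hWW hT3 hτ3
      hMm hM hE hMW hT hτ hZω hprim hrel
  linarith

end ELO

theorem mainTheorem1 :
    ∃ a k : ℕ,
      -- termination and running time on every input and for every random shift
      (∀ (n p B Rhat What : ℕ) (Y : Fin n → ℤ) (X : Matrix (Fin n) (Fin p) ℤ) (Z : Fin p → ℤ),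
        0 < n → 0 < p → 0 < Rhat → 0 < What →
        (∀ i, |Y i| ≤ 2 ^ B) → (∀ i j, |X i j| ≤ 2 ^ B) → (∀ j, Z j ∈ ELO.shiftSet p Rhat) →
        ∃ out : Fin p → ℤ, ELO.ReturnsWithin Y X Rhat What Z out
          (a * (n + p + B + Real.logb 2 Rhat + Real.logb 2 What) ^ k)) ∧
      -- exact recovery within the stated running time, with high probability
      ∀ c C κ : ℝ, 0 < c → 0 < C → 0 < κ → κ < 1 → ∃ K : ℝ, 0 < K ∧
        ∀ (n p N R Rhat What : ℕ) (D : Measure ℤ) (βstar : Fin p → ℤ) (W : Fin n → ℤ)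
          (Ω : Type*) (_ : MeasurableSpace Ω) (P : Measure Ω)
          (X : Ω → Matrix (Fin n) (Fin p) ℤ) (Z : Ω → Fin p → ℤ),
          0 < n → 0 < p → 0 < N → 0 < R → 0 < Rhat → 0 < What →
          IsProbabilityMeasure P → IsProbabilityMeasure D →
          (∀ v : ℤ, D.real {v} ≤ c / 2 ^ N) →
          Integrable (fun v : ℤ => |(v : ℝ)|) D →
          ∫ v : ℤ, |(v : ℝ)| ∂D ≤ C * 2 ^ N →
          (∀ i j, HasLaw (fun ω => X ω i j) D P) →
          (∀ j, HasLaw (fun ω => Z ω j) (uniformOn (ELO.shiftSet p Rhat)) P) →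
          iIndepFun (Sum.elim (fun (ij : Fin n × Fin p) ω => X ω ij.1 ij.2) (fun j ω => Z ω j)) P →
          (∀ j, |βstar j| ≤ R) → R ≤ Rhat → ‖W‖ ≤ What →
          1 / (2 * n) * (2 * n + p) *
              (2 * n + p + 10 * Real.logb 2 (Rhat * √p + (‖W‖ + 1) * √n))
            + 6 * Real.logb 2 ((1 + c) * n * p) ≤ (N : ℝ) →
          (1 - K * (1 / (n * p) + 2 ^ (-(κ * p))) ≤
            P.real {ω | ELO.ReturnsWithin (X ω *ᵥ βstar + W) (X ω) Rhat What (Z ω) βstar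
              (a * (n + p + N + Real.logb 2 Rhat + Real.logb 2 What) ^ k)}) ∧
          ((n : ℝ) ≤ 2 ^ (κ * p) → 1 - K / (n * p) ≤
            P.real {ω | ELO.ReturnsWithin (X ω *ᵥ βstar + W) (X ω) Rhat What (Z ω) βstar
              (a * (n + p + N + Real.logb 2 Rhat + Real.logb 2 What) ^ k)}) := by
  obtain ⟨a, k, hak⟩ := ELO.exists_time_bound 86
  refine ⟨a, k, ?_, ?_⟩
  · intro n p B Rhat What Y X Z hn hp hR hW hY hX hZ
    exact ELO.exists_returnsWithin hn hp hR hW hak hY hX hZ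
  intro c C κ hc hC hκ0 hκ1
  obtain ⟨p₀, K₁, hp₀, hK₁, hgcd⟩ := ELO.exists_gcd_bound hκ1
  set A₀ := 8 * max C 1 with hA₀
  have hA₀pos : 0 < A₀ := by positivity
  have hp₀pos : (0 : ℝ) < p₀ := by exact_mod_cast (by omega : 0 < p₀)
  have hpp : (0 : ℝ) < 2 ^ p₀ * p₀ := by positivity
  -- `5` and `K₁` bound the exceptional events, the other terms make the claim void in small cases
  refine ⟨5 + A₀ + K₁ + 2 ^ p₀ * p₀, by positivity, ?_⟩
  intro n p N R Rhat What D β W Ω _ P X Z hn hp _ _ hRhat hWhat hP hDp hD hint hmean hX hZ hind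
    hβ hRR hWW hN
  set K := 5 + A₀ + K₁ + 2 ^ p₀ * p₀ with hK
  have hn1 : (1 : ℝ) ≤ n := by exact_mod_cast hn
  have hp1 : (1 : ℝ) ≤ p := by exact_mod_cast hp
  have hnp : (0 : ℝ) < n * p := by positivity
  have hr0 : (0 : ℝ) < 2 ^ (-(κ * p)) := by positivity
  have hexp : (2 : ℝ) ^ (κ * p) * 2 ^ (-(κ * p)) = 1 := by
    rw [← Real.rpow_add (by norm_num), add_neg_cancel, Real.rpow_zero]
  by_cases hA : A₀ ≤ n * p
  swap
  · -- for small `n p` the bound `1 - K / (n p)` is not positive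
    have h1 : 1 ≤ K / (n * p) := by
      rw [one_le_div hnp]
      linarith
    refine ⟨le_trans ?_ measureReal_nonneg, fun _ => le_trans ?_ measureReal_nonneg⟩
    · have h2 : K / (n * p) = K * (1 / (n * p)) := by ring
      have h3 : 0 < K * 2 ^ (-(κ * p)) := by positivity
      rw [mul_add]
      linarith
    · linarith
  by_cases hpp₀ : p₀ ≤ p
  swap
  · -- for `p < p₀` both bounds are not positive either
    have hpp' : (p : ℝ) ≤ p₀ := by exact_mod_cast (by omega : p ≤ p₀)
    have hpow : (2 : ℝ) ^ (κ * p) ≤ 2 ^ p₀ := by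
      rw [← Real.rpow_natCast]
      refine Real.rpow_le_rpow_of_exponent_le (by norm_num) ?_
      nlinarith
    have hK2 : (2 : ℝ) ^ p₀ * p₀ ≤ K := by linarith
    refine ⟨le_trans ?_ measureReal_nonneg, fun hnκ => le_trans ?_ measureReal_nonneg⟩
    · have h2 : (2 : ℝ) ^ (κ * p) ≤ K := by
        have : (2 : ℝ) ^ p₀ ≤ 2 ^ p₀ * p₀ := le_mul_of_one_le_right (by positivity)
          (by exact_mod_cast (by omega : 1 ≤ p₀))
        linarith
      have h3 : 1 ≤ K * 2 ^ (-(κ * p)) := by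
        rw [← hexp]
        gcongr
      have h4 : 0 < K * (1 / (n * p)) := by positivity
      rw [mul_add]
      linarith
    · have h2 : 1 ≤ K / (n * p) := by
        rw [one_le_div hnp]
        calc (n : ℝ) * p ≤ 2 ^ p₀ * p₀ := by
              gcongr
              exact hnκ.trans hpow
          _ ≤ K := hK2
      linarith
  obtain ⟨hL6, hG⟩ := hgcd p (Rhat + Nat.log 2 p) hpp₀ (by omega)
  have hβ' (j : Fin p) : |β j| ≤ Rhat := (hβ j).trans (by exact_mod_cast hRR)
  have hmain := ELO.one_sub_le_measureReal_returnsWithin hak hn (by omega) hRhat hWhat hc hD hint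
    hmean hX hZ hind hβ' hWW hN hA rfl hL6
  set G := (1 / 2 + 1 / ((Rhat + Nat.log 2 p : ℕ) : ℝ)) ^ p + 32 * (1 / 2) ^ p with hGdef
  have hG0 : 0 ≤ G := by positivity
  refine ⟨le_trans ?_ hmain, fun hnκ => le_trans ?_ hmain⟩
  · have h1 : G ≤ K₁ * 2 ^ (-(κ * p)) := le_trans (le_mul_of_one_le_left hG0 hp1) hG
    have h2 : K₁ * 2 ^ (-(κ * p)) ≤ K * 2 ^ (-(κ * p)) := by
      gcongr
      linarith
    have h3 : 5 / (n * p : ℝ) ≤ K * (1 / (n * p)) := by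
      rw [mul_one_div]
      gcongr
      linarith
    rw [mul_add]
    linarith
  · have h1 : G ≤ K₁ / (n * p) := by
      rw [le_div_iff₀ hnp]
      calc G * (n * p) = n * (p * G) := by ring
        _ ≤ 2 ^ (κ * p) * (K₁ * 2 ^ (-(κ * p))) := by gcongr
        _ = K₁ * (2 ^ (κ * p) * 2 ^ (-(κ * p))) := by ring
        _ = K₁ := by rw [hexp, mul_one]
    have h2 : 5 / (n * p : ℝ) + K₁ / (n * p) ≤ K / (n * p) := by
      rw [← add_div]
      gcongr
      linarith
    linarith
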